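/- Let $\Delta$ be a finite simplicial graph with vertex set $V$, edge set $E$ and edge labels $m:E\to\mathbb N$, all of them positive and even; put $r=|V|$. Let $\Gamma$ be the Coxeter group with generators $g_v$ ($v\in V$) and relations $g_v^2=1$ and $\underbrace{g_vg_w\cdots}_{m(e)}=\underbrace{g_wg_v\cdots}_{m(e)}$ for every edge $e=[v,w]$, and let $\tilde\Gamma$ be the extended Coxeter group with generators $z,g_v$ ($v\in V$) and relations $z^2=1$, $[g_v,z]=1$, $g_v^2=z$ and $\underbrace{g_vg_w\cdots}_{m(e)}=z^{m(e)+1}\underbrace{g_wg_v\cdots}_{m(e)}$ for every edge $e=[v,w]$. Let $\phi:\tilde\Gamma\to\Gamma$ be the projection $z\mapsto 1$, $g_v\mapsto g_v$. For $S\subset V$, the parabolic subgroup of rank $|S|$ of $\Gamma$ (resp. $\tilde\Gamma$) is the one generated by the $g_v$, $v\in S$ (resp. by $z$ and the $g_v$, $v\in S$); a finite parabolic subgroup of rank at most $2$ is called elementary. For an affine algebraic group $H$ over a field of characteristic zero and $\Lambda\in\{\Gamma,\tilde\Gamma\}$, let $\hom(\Lambda,H)$ be the representation scheme, $\hom_o(\Lambda,H)$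 its open subscheme of the representations that are injective on every elementary subgroup, and, if $H$ is reductive, $X(\Lambda,H)=\hom(\Lambda,H)/\!/H$ the character scheme and $X_o(\Lambda,H)\subset X(\Lambda,H)$ the image of $\hom_o(\Lambda,H)$. A subscheme is clopen if it is both open and closed. 1. For every $H$, $\hom_o(\Gamma,H)$ and $\hom_o(\tilde\Gamma,H)$ are clopen subschemes of $\hom(\Gamma,H)$ and $\hom(\tilde\Gamma,H)$. If $H$ is reductive, $X_o(\Gamma,H)$ and $X_o(\tilde\Gamma,H)$ are clopen subschemes of $X(\Gamma,H)$ and $X(\tilde\Gamma,H)$. Let $p:\tilde G=SL(2,\mathbb C)\to G=PSL(2,\mathbb C)=SL(2,\mathbb C)/\{\pm1\}$ be the projection. 2. There is a morphism of $\mathbb C$-schemes $q:\hom_o(\tilde\Gamma,\tilde G)\to\hom_o(\Gamma,G)$ such that $p\circ\tilde\rho=\rho\circ\phi$ for every $\tilde\rho\in\hom_o(\tilde\Gamma,\tilde G)$ and $\rho=q(\tilde\rho)$. 3. This $q$ is a regular étale covering with deck group $\mathbb Z_2^r$: it is finite, étale and surjective, and $\mathbb Z_2^r$ acts on $Y=\hom_o(\tilde\Gamma,\tilde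 G)$ over $X=\hom_o(\Gamma,G)$, simply transitively on the fibres of $q$, in the sense that $\mathbb Z_2^r\times Y\to Y\times_X Y$, $(d,y)\mapsto(y,dy)$, is an isomorphism. -/

import Mathlib

open CategoryTheory AlgebraicGeometry TensorProduct WithConv

universe u v

noncomputable section

namespace RepScheme

section Points

variable {k : Type u} [Field k] {A : Type u} [CommRing A] [HopfAlgebra k A]

/-- The group `H(S)` of `S`-valued points of the affine group scheme `H = Spec A`. -/
abbrev Pt (k A S : Type u) [Field k] [CommRing A] [HopfAlgebra k A] [CommRing S] [Algebra k S] :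
    Type u :=
  WithConv (A →ₐ[k] S)

variable {S T : Type u} [CommRing S] [Algebra k S] [CommRing T] [Algebra k T]

/-- The group structure on `H(S)`: the convolution product, which Mathlib provides as a monoid
structure, together with `g⁻¹ = g ∘ antipode`. -/
instance instGroupPt : Group (Pt k A S) where
  inv g := toConv (g.ofConv.comp (HopfAlgebra.antipodeAlgHom k A))
  inv_mul_cancel g := by
    have h2 := AlgHom.comp_convMul_distrib g.ofConv
      (toConv (HopfAlgebra.antipodeAlgHom k A)) (toConv (AlgHom.id k A))
    rw [AlgHom.antipode_id_cancel] at h2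
    apply WithConv.ofConv_injective
    refine h2.symm.trans ?_
    ext a
    simp [AlgHom.convOne_def, Algebra.ofId_apply]

/-- Functoriality of `S ↦ H(S)`. -/
def mapPt (f : S →ₐ[k] T) : Pt k A S →* Pt k A T where
  toFun g := toConv (f.comp g.ofConv)
  map_one' := by
    apply WithConv.ofConv_injective
    ext a
    simp [AlgHom.convOne_def, Algebra.ofId_apply]
  map_mul' g h := by
    apply WithConv.ofConv_injective
    exact AlgHom.comp_convMul_distrib f g h

end Points

section RepresentationScheme

variable (k A : Type u) [Field k] [CommRing A] [HopfAlgebra k A]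
  {α : Type} [DecidableEq α] (rels : Set (FreeGroup α))

/-- The coordinate ring of `H ^ α`. -/
abbrev PowAlg (α : Type) : Type u := ⨂[k] _ : α, A

/-- The value of a word `w` at the universal tuple `(g_a)_{a ∈ α} ∈ H ^ α`; it is the
regular map `w : H ^ α → H`. -/
def wordMap : FreeGroup α →* Pt k A (PowAlg k A α) :=
  FreeGroup.lift fun a => toConv (PiTensorProduct.singleAlgHom (R := k) (A := fun _ : α => A) a)

/-- The ideal of the closed subscheme `{(g_a) ∈ H ^ α : r((g_a)) = 1 for all relators r}`. -/
def relIdeal : Ideal (PowAlg k A α) :=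
  Ideal.span {x | ∃ r ∈ rels, ∃ f : A,
    x = (wordMap k A r).ofConv f - (1 : Pt k A (PowAlg k A α)).ofConv f}

/-- The coordinate ring of the representation scheme `hom(⟨α | rels⟩, H)`. -/
def RepAlg : Type u := PowAlg k A α ⧸ relIdeal k A rels

instance : CommRing (RepAlg k A rels) :=
  inferInstanceAs (CommRing (PowAlg k A α ⧸ relIdeal k A rels))

instance : Algebra k (RepAlg k A rels) :=
  inferInstanceAs (Algebra k (PowAlg k A α ⧸ relIdeal k A rels))

/-- The quotient map, dual to the inclusion of `hom(⟨α | rels⟩, H)` in `H ^ α`. -/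
def RepAlg.mk : PowAlg k A α →ₐ[k] RepAlg k A rels := Ideal.Quotient.mkₐ k (relIdeal k A rels)

theorem RepAlg.wordMap_rel (r : FreeGroup α) (hr : r ∈ rels) :
    mapPt (RepAlg.mk k A rels) (wordMap k A r) = 1 := by
  rw [← map_one (mapPt (A := A) (RepAlg.mk k A rels))]
  apply WithConv.ofConv_injective
  ext f
  exact Ideal.Quotient.eq.2 (Ideal.subset_span ⟨r, hr, f, rfl⟩)

/-- The universal representation `⟨α | rels⟩ → H(O(hom(⟨α | rels⟩, H)))`. -/
def univRep : PresentedGroup rels →* Pt k A (RepAlg k A rels) :=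
  PresentedGroup.toGroup (f := fun a => mapPt (RepAlg.mk k A rels) (wordMap k A (FreeGroup.of a)))
    (by
      intro r hr
      rw [← RepAlg.wordMap_rel k A rels r hr]
      have : FreeGroup.lift
          (fun a => mapPt (RepAlg.mk k A rels) (wordMap k A (FreeGroup.of a))) =
          (mapPt (RepAlg.mk k A rels)).comp (wordMap k A) := by
        ext a; simp
      rw [this]; rfl)

/-- The representation scheme `hom(Γ, H)`, `Γ = ⟨α | rels⟩`, `H = Spec A`. -/
abbrev Hom : Scheme.{u} := Spec (CommRingCat.of (RepAlg k A rels))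

section Lift

variable {k A} [Fintype α]

/-- The homomorphism `O(H ^ α) → S` given by a tuple of points of `H(S)`. -/
def PowAlg.lift {S : Type u} [CommRing S] [Algebra k S] (g : α → Pt k A S) :
    PowAlg k A α →ₐ[k] S :=
  PiTensorProduct.liftAlgHom
    ((MultilinearMap.mkPiAlgebra k α S).compLinearMap fun a => (g a).ofConv.toLinearMap)
    (by simp) (fun x y => by
      simp only [MultilinearMap.compLinearMap_apply, MultilinearMap.mkPiAlgebra_apply,
        AlgHom.toLinearMap_apply, Pi.mul_apply, map_mul]
      exact Finset.prod_mul_distrib)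

theorem PowAlg.lift_comp_single {S : Type u} [CommRing S] [Algebra k S] (g : α → Pt k A S)
    (a : α) : (PowAlg.lift g).comp (PiTensorProduct.singleAlgHom (A := fun _ : α => A) a) = (g a).ofConv := by
  ext f
  have h : PowAlg.lift g (PiTensorProduct.tprod k (MonoidHom.mulSingle (fun _ => A) a f)) =
      ∏ b, (g b).ofConv (MonoidHom.mulSingle (fun _ => A) a f b) :=
    PiTensorProduct.lift.tprod _
  refine h.trans ?_
  rw [Finset.prod_eq_single a]
  · simp
  · intro b _ hb; simp [Pi.mulSingle_eq_of_ne hb]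
  · simp

theorem PowAlg.mapPt_lift {S : Type u} [CommRing S] [Algebra k S] (g : α → Pt k A S)
    (w : FreeGroup α) : mapPt (PowAlg.lift g) (wordMap k A w) = FreeGroup.lift g w := by
  have : (mapPt (PowAlg.lift g)).comp (wordMap k A) = FreeGroup.lift g := by
    ext a : 1
    rw [MonoidHom.comp_apply, wordMap, FreeGroup.lift_apply_of, FreeGroup.lift_apply_of]
    exact congrArg toConv (PowAlg.lift_comp_single g a)
  rw [← this]; rfl

/-- A tuple of points of `H(S)` satisfying the relations is an `S`-valued point of
`hom(⟨α | rels⟩, H)`. -/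
def RepAlg.lift {S : Type u} [CommRing S] [Algebra k S] (g : α → Pt k A S)
    (hg : ∀ r ∈ rels, FreeGroup.lift g r = 1) : RepAlg k A rels →ₐ[k] S :=
  Ideal.Quotient.liftₐ (relIdeal k A rels) (PowAlg.lift g) (by
    intro x hx
    refine (Ideal.span_le.2 ?_ : relIdeal k A rels ≤ RingHom.ker (PowAlg.lift g)) hx
    rintro _ ⟨r, hr, f, rfl⟩
    have h1 : mapPt (PowAlg.lift g) (wordMap k A r) = mapPt (PowAlg.lift g) 1 := by
      rw [PowAlg.mapPt_lift, hg r hr, map_one]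
    have h2 := DFunLike.congr_fun (congrArg ofConv h1) f
    rw [SetLike.mem_coe, RingHom.mem_ker, map_sub, sub_eq_zero]
    exact h2)

variable (k A)

/-- The coaction `O(hom(Γ, H)) → O(H) ⊗ O(hom(Γ, H))` dual to the action
`(g, ρ) ↦ g ρ g⁻¹` of `H` on `hom(Γ, H)`, where `Γ = ⟨α | rels⟩`. -/
def conjCoaction : RepAlg k A rels →ₐ[k] A ⊗[k] RepAlg k A rels :=
  RepAlg.lift rels
    (fun a =>
      (toConv Algebra.TensorProduct.includeLeft : Pt k A (A ⊗[k] RepAlg k A rels)) *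
      mapPt Algebra.TensorProduct.includeRight (univRep k A rels (PresentedGroup.of a)) *
      (toConv Algebra.TensorProduct.includeLeft)⁻¹)
    (by
      intro r hr
      have : FreeGroup.lift (fun a =>
          (toConv Algebra.TensorProduct.includeLeft : Pt k A (A ⊗[k] RepAlg k A rels)) *
          mapPt Algebra.TensorProduct.includeRight (univRep k A rels (PresentedGroup.of a)) *
          (toConv Algebra.TensorProduct.includeLeft)⁻¹) =
          (MulAut.conj (toConv Algebra.TensorProduct.includeLeft :
              Pt k A (A ⊗[k] RepAlg k A rels))).toMonoidHom.comp
            ((mapPt Algebra.TensorProduct.includeRight).comp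
              ((univRep k A rels).comp (PresentedGroup.mk rels))) := by
        ext a : 1
        simp [PresentedGroup.of]
      rw [this]
      simp [PresentedGroup.mk_eq_one_iff.2 (Subgroup.subset_normalClosure hr)])

/-- The algebra of `H`-invariant functions on `hom(Γ, H)`. -/
def invariants : Subalgebra k (RepAlg k A rels) :=
  AlgHom.equalizer (conjCoaction k A rels) Algebra.TensorProduct.includeRight

/-- The character scheme `X(Γ, H) = hom(Γ, H) // H`. -/
abbrev Char : Scheme.{u} := Spec (CommRingCat.of (invariants k A rels))

/-- The quotient morphism `hom(Γ, H) → X(Γ, H)`. -/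
def toChar : Hom k A rels ⟶ Char k A rels :=
  Spec.map (CommRingCat.ofHom (invariants k A rels).val.toRingHom)

end Lift

/-- The structure morphism `hom(Γ, H) → Spec k`. -/
def toBase : Hom k A rels ⟶ Spec (CommRingCat.of k) :=
  Spec.map (CommRingCat.ofHom (algebraMap k (RepAlg k A rels)))

/-- The morphism `hom(Γ, H) → H`, `ρ ↦ ρ(γ)`. -/
def eval (γ : PresentedGroup rels) : Hom k A rels ⟶ Spec (CommRingCat.of A) :=
  Spec.map (CommRingCat.ofHom (univRep k A rels γ).ofConv.toRingHom)

/-- The residue field `κ(x)` of a point of `hom(Γ, H)`. -/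
abbrev resField (x : PrimeSpectrum (RepAlg k A rels)) : Type u :=
  Ideal.ResidueField x.asIdeal

/-- The representation `Γ → H(κ(x))` that a point `x` of the scheme `hom(Γ, H)` stands for. -/
def repAt (x : PrimeSpectrum (RepAlg k A rels)) :
    PresentedGroup rels →* Pt k A (resField k A rels x) :=
  (mapPt (IsScalarTower.toAlgHom k (RepAlg k A rels) (resField k A rels x))).comp
    (univRep k A rels)

/-- The set of points of `hom(Γ, H)` that are injective on each of the given subgroups. -/
def injLocus (𝓔 : Set (Subgroup (PresentedGroup rels))) : Set (PrimeSpectrum (RepAlg k A rels)) :=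
  {x | ∀ K ∈ 𝓔, Set.InjOn (repAt k A rels x) (K : Set (PresentedGroup rels))}

theorem isOpen_injLocus (𝓔 : Set (Subgroup (PresentedGroup rels))) (h : 𝓔.Finite)
    (h' : ∀ K ∈ 𝓔, Finite K) : IsOpen (injLocus k A rels 𝓔) := by
  have key : injLocus k A rels 𝓔 = ⋂ K ∈ 𝓔, ⋂ γ ∈ (K : Set (PresentedGroup rels)),
      ⋂ δ ∈ (K : Set (PresentedGroup rels)), {x | repAt k A rels x γ = repAt k A rels x δ → γ = δ} := by
    ext x
    simp only [injLocus, Set.InjOn, Set.mem_iInter, Set.mem_ofPred_eq]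
  rw [key]
  refine h.isOpen_biInter fun K hK => ?_
  have hf : (K : Set (PresentedGroup rels)).Finite := h' K hK
  refine hf.isOpen_biInter fun γ _ => hf.isOpen_biInter fun δ _ => ?_
  by_cases e : γ = δ
  · simp [e]
  have : {x : PrimeSpectrum (RepAlg k A rels) | repAt k A rels x γ = repAt k A rels x δ → γ = δ} =
      (PrimeSpectrum.zeroLocus {y : RepAlg k A rels | ∃ f : A,
        y = (univRep k A rels γ).ofConv f - (univRep k A rels δ).ofConv f})ᶜ := by
    ext x
    have hx : repAt k A rels x γ = repAt k A rels x δ ↔ ∀ f : A,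
        (univRep k A rels γ).ofConv f - (univRep k A rels δ).ofConv f ∈
          x.asIdeal := by
      rw [← WithConv.ofConv_injective.eq_iff, DFunLike.ext_iff]
      refine forall_congr' fun f => ?_
      rw [← Ideal.algebraMap_residueField_eq_zero, map_sub, sub_eq_zero]
      rfl
    simp only [Set.mem_ofPred_eq, e, Set.mem_compl_iff, PrimeSpectrum.mem_zeroLocus, hx, imp_false]
    refine not_congr ⟨?_, ?_⟩
    · rintro H _ ⟨f, rfl⟩; exact H f
    · intro H f; exact H ⟨f, rfl⟩
  rw [this]
  exact (PrimeSpectrum.isClosed_zeroLocus _).isOpen_compl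

end RepresentationScheme

section Coxeter

/-- The alternating word `a b a b ⋯` with `n` letters. -/
def altWord {G : Type} [Group G] : G → G → ℕ → G
  | _, _, 0 => 1
  | a, b, n + 1 => a * altWord b a n

variable {V : Type} {Δ : SimpleGraph V} (m : Δ.edgeSet → ℕ)

/-- The relators of the Coxeter group of the graph `Δ` with edge labels `m`. -/
inductive CoxRel : FreeGroup V → Prop
  | sq (v : V) : CoxRel (FreeGroup.of v ^ 2)
  | edge (v w : V) (h : Δ.Adj v w) :
      CoxRel (altWord (FreeGroup.of v) (FreeGroup.of w) (m ⟨s(v, w), h⟩) *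
        (altWord (FreeGroup.of w) (FreeGroup.of v) (m ⟨s(v, w), h⟩))⁻¹)

/-- The relators of the extended Coxeter group; its generators are `z` (the letter `none`) and the
`g_v` (the letters `some v`). -/
inductive ExtRel : FreeGroup (Option V) → Prop
  | z_sq : ExtRel (FreeGroup.of none ^ 2)
  | comm (v : V) :
      ExtRel (FreeGroup.of (some v) * FreeGroup.of none * (FreeGroup.of (some v))⁻¹ *
        (FreeGroup.of none)⁻¹)
  | sq (v : V) : ExtRel (FreeGroup.of (some v) ^ 2 * (FreeGroup.of none)⁻¹)
  | edge (v w : V) (h : Δ.Adj v w) :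
      ExtRel (altWord (FreeGroup.of (some v)) (FreeGroup.of (some w)) (m ⟨s(v, w), h⟩) *
        (FreeGroup.of none ^ (m ⟨s(v, w), h⟩ + 1) *
          altWord (FreeGroup.of (some w)) (FreeGroup.of (some v)) (m ⟨s(v, w), h⟩))⁻¹)

/-- The relators of `Γ`. -/
abbrev coxRels : Set (FreeGroup V) := {r | CoxRel m r}

/-- The relators of `Γ̃`. -/
abbrev extRels : Set (FreeGroup (Option V)) := {r | ExtRel m r}

/-- The Coxeter group `Γ` of the labelled graph. -/
abbrev CoxGroup : Type := PresentedGroup (coxRels m)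

/-- The extended Coxeter group `Γ̃` of the labelled graph. -/
abbrev ExtGroup : Type := PresentedGroup (extRels m)

theorem map_altWord {G H : Type} [Group G] [Group H] (f : G →* H) (n : ℕ) :
    ∀ a b : G, f (altWord a b n) = altWord (f a) (f b) n := by
  induction n with
  | zero => intro a b; simp [altWord]
  | succ n ih => intro a b; simp [altWord, ih]

/-- The projection `φ : Γ̃ → Γ`, `z ↦ 1`, `g_v ↦ g_v`. -/
def proj : ExtGroup m →* CoxGroup m :=
  PresentedGroup.toGroup (f := fun o => o.elim 1 PresentedGroup.of) (by
    intro r hr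
    cases hr with
    | z_sq => simp
    | comm v => simp
    | sq v =>
      have := PresentedGroup.one_of_mem (rels := coxRels m) (CoxRel.sq v)
      simpa [PresentedGroup.of] using this
    | edge v w h =>
      have := PresentedGroup.one_of_mem (rels := coxRels m) (CoxRel.edge v w h)
      simpa [PresentedGroup.of, map_altWord] using this)

/-- The elementary subgroups of `Γ`: the finite parabolic subgroups of rank at most `2`. The
parabolic subgroup of a subgraph is the subgroup generated by the `g_v` for its vertices `v`, and
its rank is the number of vertices. -/
def coxElementary : Set (Subgroup (CoxGroup m)) :=
  {K | Finite K ∧ ∃ S : Finset V, S.card ≤ 2 ∧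
    K = Subgroup.closure (PresentedGroup.of '' (S : Set V))}

/-- The elementary subgroups of `Γ̃`: the finite parabolic subgroups of rank at most `2`. The
parabolic subgroup of a subgraph is the subgroup generated by `z` and the `g_v` for its
vertices `v`, and its rank is the number of vertices. -/
def extElementary : Set (Subgroup (ExtGroup m)) :=
  {K | Finite K ∧ ∃ S : Finset V, S.card ≤ 2 ∧
    K = Subgroup.closure
      (insert (PresentedGroup.of none) ((fun v => PresentedGroup.of (some v)) '' (S : Set V)))}

variable [Fintype V]

theorem coxElementary_finite : (coxElementary m).Finite :=
  (Set.finite_range fun S : Finset V =>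
    (Subgroup.closure (PresentedGroup.of '' (S : Set V)) : Subgroup (CoxGroup m))).subset
    fun _ ⟨_, S, _, h⟩ => ⟨S, h.symm⟩

theorem extElementary_finite : (extElementary m).Finite :=
  (Set.finite_range fun S : Finset V =>
    (Subgroup.closure (insert (PresentedGroup.of none)
      ((fun v => PresentedGroup.of (some v)) '' (S : Set V))) : Subgroup (ExtGroup m))).subset
    fun _ ⟨_, S, _, h⟩ => ⟨S, h.symm⟩

variable [DecidableEq V] (k A : Type u) [Field k] [CommRing A] [HopfAlgebra k A]

/-- `hom_o(Γ, H)`, as an open subscheme of `hom(Γ, H)`. -/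
def coxHomO : (Hom k A (coxRels m)).Opens :=
  ⟨injLocus k A (coxRels m) (coxElementary m),
    isOpen_injLocus k A _ _ (coxElementary_finite m) fun _ h => h.1⟩

/-- `hom_o(Γ̃, H)`, as an open subscheme of `hom(Γ̃, H)`. -/
def extHomO : (Hom k A (extRels m)).Opens :=
  ⟨injLocus k A (extRels m) (extElementary m),
    isOpen_injLocus k A _ _ (extElementary_finite m) fun _ h => h.1⟩

/-- `X_o(Γ, H)`, the image of `hom_o(Γ, H)` in `X(Γ, H)`. -/
def coxCharO : Set (Char k A (coxRels m)) :=
  toChar k A (coxRels m) '' (coxHomO m k A : Set (Hom k A (coxRels m)))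

/-- `X_o(Γ̃, H)`, the image of `hom_o(Γ̃, H)` in `X(Γ̃, H)`. -/
def extCharO : Set (Char k A (extRels m)) :=
  toChar k A (extRels m) '' (extHomO m k A : Set (Hom k A (extRels m)))

end Coxeter

/-- A set of points of a scheme is (the underlying set of) a clopen subscheme: it is open, and the
inclusion of the corresponding open subscheme is also a closed immersion. -/
def IsClopenSubscheme {X : Scheme.{u}} (Z : Set X) : Prop :=
  ∃ U : X.Opens, (U : Set X) = Z ∧ IsClosedImmersion U.ι

section Reductive

variable (k A : Type u) [Field k] [CommRing A] [HopfAlgebra k A]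
  {W : Type u} [AddCommGroup W] [Module k W]

variable {k A} in
/-- `δ : W → W ⊗ O(H)` makes `W` a comodule over `O(H)`, that is, a representation of `H`. -/
structure IsCoaction (δ : W →ₗ[k] W ⊗[k] A) : Prop where
  coassoc : (TensorProduct.assoc k W A A).toLinearMap ∘ₗ δ.rTensor A ∘ₗ δ =
    (Coalgebra.comul (R := k) (A := A)).lTensor W ∘ₗ δ
  counit : (TensorProduct.rid k W).toLinearMap ∘ₗ
    (Coalgebra.counit (R := k) (A := A)).lTensor W ∘ₗ δ = LinearMap.id

variable {k A} in
/-- `U` is a subrepresentation of the representation `(W, δ)`. -/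
def IsSubrep (δ : W →ₗ[k] W ⊗[k] A) (U : Submodule k W) : Prop :=
  ∀ u ∈ U, δ u ∈ LinearMap.range (U.subtype.rTensor A)

/-- An affine algebraic group `H` over a field `k` of characteristic zero is reductive:
every finite-dimensional representation of `H` is completely reducible. -/
def IsReductive : Prop :=
  ∀ (W : Type u) [AddCommGroup W] [Module k W] [Module.Finite k W] (δ : W →ₗ[k] W ⊗[k] A),
    IsCoaction δ → ∀ U : Submodule k W, IsSubrep δ U →
      ∃ U' : Submodule k W, IsSubrep δ U' ∧ IsCompl U U'

end Reductive

section Covering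

open Limits

/-- The morphism `q : Y ⟶ X` is a regular étale covering with deck group `D`: it is finite, étale
and surjective, and the finite group `D` acts on `Y` over `X`, simply transitively on the fibres in
the scheme-theoretic sense that `D × Y → Y ×_X Y`, `(d, y) ↦ (y, d y)` is an isomorphism. -/
structure IsRegularEtaleCovering (D : Type) [Group D] {X Y : Scheme.{u}} (q : Y ⟶ X) : Prop where
  finite : IsFinite q
  etale : Etale q
  surjective : Surjective q
  exists_deck : ∃ σ : D →* Aut (Over.mk q),
    IsIso (Sigma.desc fun d : D =>
      pullback.lift (f := q) (g := q) (𝟙 Y) (σ d).hom.left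
        ((Category.id_comp q).trans (Over.w (σ d).hom).symm))

end Covering

section SL2

variable (k : Type u) [Field k]

/-- The coordinate ring `k[x₀₀, x₀₁, x₁₀, x₁₁] / (det - 1)` of `SL(2)`. -/
def SL2Alg : Type u :=
  MvPolynomial (Fin 2 × Fin 2) k ⧸
    Ideal.span {(Matrix.mvPolynomialX (Fin 2) (Fin 2) k).det - 1}

instance : CommRing (SL2Alg k) :=
  inferInstanceAs (CommRing (MvPolynomial (Fin 2 × Fin 2) k ⧸
    Ideal.span {(Matrix.mvPolynomialX (Fin 2) (Fin 2) k).det - 1}))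

instance : Algebra k (SL2Alg k) :=
  inferInstanceAs (Algebra k (MvPolynomial (Fin 2 × Fin 2) k ⧸
    Ideal.span {(Matrix.mvPolynomialX (Fin 2) (Fin 2) k).det - 1}))

namespace SL2Alg

/-- The quotient map. -/
def mk : MvPolynomial (Fin 2 × Fin 2) k →ₐ[k] SL2Alg k := Ideal.Quotient.mkₐ k _

/-- The universal matrix of determinant `1`. -/
def X : Matrix (Fin 2) (Fin 2) (SL2Alg k) := Matrix.of fun i j => mk k (MvPolynomial.X (i, j))

theorem X_eq : X k = (Matrix.mvPolynomialX (Fin 2) (Fin 2) k).map (mk k) := by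
  ext i j; simp [X]

theorem det_X : (X k).det = 1 := by
  have h : (X k).det = mk k (Matrix.mvPolynomialX (Fin 2) (Fin 2) k).det := by
    rw [X_eq]; exact ((mk k).map_det _).symm
  rw [h, ← map_one (mk k)]
  exact Ideal.Quotient.eq.2 (Ideal.subset_span rfl)

variable {k}
variable {S : Type v} [CommRing S] [Algebra k S]

/-- A matrix of determinant `1` over `S` is an `S`-valued point of `SL(2)`. -/
def lift (M : Matrix (Fin 2) (Fin 2) S) (hM : M.det = 1) : SL2Alg k →ₐ[k] S :=
  Ideal.Quotient.liftₐ _ (MvPolynomial.aeval fun p : Fin 2 × Fin 2 => M p.1 p.2) (by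
    intro a ha
    refine (Ideal.span_le.2 ?_ : _ ≤ RingHom.ker (MvPolynomial.aeval (R := k)
      fun p : Fin 2 × Fin 2 => M p.1 p.2)) ha
    rintro _ rfl
    rw [SetLike.mem_coe, RingHom.mem_ker, map_sub, map_one, sub_eq_zero, ← hM]
    rw [AlgHom.map_det]
    congr 1
    ext i j
    simp)

@[simp] theorem lift_X (M : Matrix (Fin 2) (Fin 2) S) (hM : M.det = 1) (i j : Fin 2) :
    lift (k := k) M hM (X k i j) = M i j := by
  have h : lift (k := k) M hM (X k i j) =
    MvPolynomial.aeval (R := k) (fun p : Fin 2 × Fin 2 => M p.1 p.2) (MvPolynomial.X (i, j)) := rfl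
  rw [h, MvPolynomial.aeval_X]

theorem lift_map_X (M : Matrix (Fin 2) (Fin 2) S) (hM : M.det = 1) :
    (X k).map (lift (k := k) M hM) = M := by
  ext i j; simp

theorem algHom_ext {S : Type v} [Semiring S] [Algebra k S] {f g : SL2Alg k →ₐ[k] S}
    (h : ∀ i j, f (X k i j) = g (X k i j)) : f = g := by
  refine Ideal.Quotient.algHom_ext _ (MvPolynomial.algHom_ext fun p => ?_)
  exact h p.1 p.2

variable (k)

/-- `(g, h) ↦ g h`, dually. -/
def comulHom : SL2Alg k →ₐ[k] SL2Alg k ⊗[k] SL2Alg k :=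
  lift ((X k).map (Algebra.TensorProduct.includeLeft (R := k) (S := k) (B := SL2Alg k)) *
      (X k).map (Algebra.TensorProduct.includeRight (R := k) (A := SL2Alg k))) (by
    have h1 := (Algebra.TensorProduct.includeLeft (R := k) (S := k) (A := SL2Alg k)
      (B := SL2Alg k)).map_det (X k)
    have h2 := (Algebra.TensorProduct.includeRight (R := k) (A := SL2Alg k)
      (B := SL2Alg k)).map_det (X k)
    rw [det_X, map_one] at h1 h2
    rw [Matrix.det_mul]
    exact (congrArg₂ (· * ·) h1.symm h2.symm).trans (one_mul 1))

/-- The unit matrix, dually. -/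
def counitHom : SL2Alg k →ₐ[k] k := lift 1 Matrix.det_one

/-- `g ↦ g⁻¹`, dually; the inverse of a matrix of determinant `1` is its adjugate. -/
def antipodeHom : SL2Alg k →ₐ[k] SL2Alg k :=
  lift (X k).adjugate (by rw [Matrix.det_adjugate, det_X, one_pow])

theorem comulHom_X (i j : Fin 2) :
    comulHom k (X k i j) = ∑ l, X k i l ⊗ₜ[k] X k l j := by
  simp [comulHom, Matrix.mul_apply]

theorem counitHom_X (i j : Fin 2) : counitHom k (X k i j) = if i = j then 1 else 0 := by
  simp [counitHom, Matrix.one_apply]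

instance : Bialgebra k (SL2Alg k) :=
  Bialgebra.ofAlgHom (comulHom k) (counitHom k)
    (algHom_ext fun i j => by
      simp [comulHom_X, TensorProduct.add_tmul, TensorProduct.tmul_add, Fin.sum_univ_two]
      abel)
    (algHom_ext fun i j => by
      fin_cases i <;> fin_cases j <;>
      simp [comulHom_X, counitHom_X, Fin.sum_univ_two])
    (algHom_ext fun i j => by
      fin_cases i <;> fin_cases j <;>
      simp [comulHom_X, counitHom_X, Fin.sum_univ_two])

theorem comul_eq (a : SL2Alg k) : Coalgebra.comul (R := k) a = comulHom k a := rfl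
theorem counit_eq (a : SL2Alg k) : Coalgebra.counit (R := k) a = counitHom k a := rfl

instance : HopfAlgebra k (SL2Alg k) :=
  HopfAlgebra.ofAlgHom (antipodeHom k)
    (algHom_ext fun i j => by
      have h := congrFun (congrFun (Matrix.adjugate_mul (X k)) i) j
      rw [det_X, one_smul, Matrix.mul_apply] at h
      simp only [AlgHom.comp_apply, Bialgebra.comulAlgHom_apply, comul_eq, comulHom_X, map_sum,
        Algebra.TensorProduct.lift_tmul, antipodeHom, lift_X, AlgHom.id_apply,
        Bialgebra.counitAlgHom_apply, counit_eq, counitHom_X]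
      rw [h]
      simp [Matrix.one_apply])
    (algHom_ext fun i j => by
      have h := congrFun (congrFun (Matrix.mul_adjugate (X k)) i) j
      rw [det_X, one_smul, Matrix.mul_apply] at h
      simp only [AlgHom.comp_apply, Bialgebra.comulAlgHom_apply, comul_eq, comulHom_X, map_sum,
        Algebra.TensorProduct.lift_tmul, antipodeHom, lift_X, AlgHom.id_apply,
        Bialgebra.counitAlgHom_apply, counit_eq, counitHom_X]
      rw [h]
      simp [Matrix.one_apply])

end SL2Alg

end SL2

section PSL2

variable (k : Type u) [Field k]

namespace SL2Alg

/-- The involution `f(g) ↦ f(-g)` of `O(SL(2))`. -/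
def neg : SL2Alg k →ₐ[k] SL2Alg k :=
  lift (-X k) (by rw [Matrix.det_neg, det_X]; simp)

theorem neg_X (i j : Fin 2) : neg k (X k i j) = -X k i j := by simp [neg]

theorem neg_neg (a : SL2Alg k) : neg k (neg k a) = a := by
  have : (neg k).comp (neg k) = AlgHom.id k _ := algHom_ext fun i j => by simp [neg_X]
  exact DFunLike.congr_fun this a

theorem map_neg_id_comul (a : SL2Alg k) :
    Algebra.TensorProduct.map (neg k) (AlgHom.id k _) (comulHom k a) = comulHom k (neg k a) := by
  have : (Algebra.TensorProduct.map (neg k) (AlgHom.id k _)).comp (comulHom k) =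
      (comulHom k).comp (neg k) :=
    algHom_ext fun i j => by simp [neg_X, comulHom_X, TensorProduct.neg_tmul, add_comm]
  exact DFunLike.congr_fun this a

theorem map_id_neg_comul (a : SL2Alg k) :
    Algebra.TensorProduct.map (AlgHom.id k _) (neg k) (comulHom k a) = comulHom k (neg k a) := by
  have : (Algebra.TensorProduct.map (AlgHom.id k _) (neg k)).comp (comulHom k) =
      (comulHom k).comp (neg k) :=
    algHom_ext fun i j => by simp [neg_X, comulHom_X, TensorProduct.tmul_neg, add_comm]
  exact DFunLike.congr_fun this a

theorem antipode_neg (a : SL2Alg k) : antipodeHom k (neg k a) = neg k (antipodeHom k a) := by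
  have : (antipodeHom k).comp (neg k) = (neg k).comp (antipodeHom k) :=
    algHom_ext fun i j => by
      simp only [AlgHom.comp_apply, neg_X, map_neg, antipodeHom, lift_X, Matrix.adjugate_fin_two]
      fin_cases i <;> fin_cases j <;> simp [neg_X]
  exact DFunLike.congr_fun this a

end SL2Alg

open SL2Alg

/-- The coordinate ring of `PSL(2) = SL(2) / {±1}`: the functions `f` on `SL(2)` with
`f(-g) = f(g)`. -/
def evenSubalgebra : Subalgebra k (SL2Alg k) := AlgHom.equalizer (neg k) (AlgHom.id k _)

/-- The coordinate ring of `PSL(2)`. -/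
def PSL2Alg : Type u := evenSubalgebra k

instance : CommRing (PSL2Alg k) := inferInstanceAs (CommRing (evenSubalgebra k))

instance : Algebra k (PSL2Alg k) := inferInstanceAs (Algebra k (evenSubalgebra k))

namespace PSL2Alg

/-- The inclusion `O(PSL(2)) → O(SL(2))`. -/
def incl : PSL2Alg k →ₐ[k] SL2Alg k := (evenSubalgebra k).val

theorem neg_incl (a : PSL2Alg k) : neg k (incl k a) = incl k a := a.2

/-- The projection `f(g) ↦ (f(g) + f(-g)) / 2` of `O(SL(2))` onto `O(PSL(2))`. -/
def avg : SL2Alg k →ₗ[k] PSL2Alg k :=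
  LinearMap.codRestrict (Subalgebra.toSubmodule (evenSubalgebra k))
    ((2⁻¹ : k) • (LinearMap.id + (neg k).toLinearMap)) fun a => by
      change neg k ((2⁻¹ : k) • (a + neg k a)) = (2⁻¹ : k) • (a + neg k a)
      rw [map_smul, map_add, SL2Alg.neg_neg, add_comm]

theorem incl_avg (a : SL2Alg k) : incl k (avg k a) = (2⁻¹ : k) • (a + neg k a) := rfl

theorem incl_injective : Function.Injective (incl k) := Subtype.val_injective

/-- The counit of `O(PSL(2))`: the restriction of the one of `O(SL(2))`. -/
def counit' : PSL2Alg k →ₐ[k] k := (counitHom k).comp (incl k)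

/-- The antipode of `O(PSL(2))`: the restriction of the one of `O(SL(2))`. -/
def antipode' : PSL2Alg k →ₐ[k] PSL2Alg k :=
  AlgHom.codRestrict ((antipodeHom k).comp (incl k)) (evenSubalgebra k) fun a => by
    change neg k (antipodeHom k (incl k a)) = antipodeHom k (incl k a)
    rw [← antipode_neg, neg_incl]

theorem incl_antipode' (a : PSL2Alg k) : incl k (antipode' k a) = antipodeHom k (incl k a) := rfl

variable [CharZero k]

theorem avg_incl (a : PSL2Alg k) : avg k (incl k a) = a := by
  apply incl_injective k
  rw [incl_avg, neg_incl, ← two_smul k, smul_smul, inv_mul_cancel₀ two_ne_zero, one_smul]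

/-- The inclusion `O(PSL(2) × PSL(2)) → O(SL(2) × SL(2))`. -/
def incl₂ : PSL2Alg k ⊗[k] PSL2Alg k →ₐ[k] SL2Alg k ⊗[k] SL2Alg k :=
  Algebra.TensorProduct.map (incl k) (incl k)

theorem incl₂_injective : Function.Injective (incl₂ k) := by
  refine Function.LeftInverse.injective (g := TensorProduct.map (avg k) (avg k)) fun t => ?_
  induction t with
  | zero => simp
  | tmul a b => simp [incl₂, avg_incl]
  | add a b ha hb => rw [map_add, map_add, ha, hb]

theorem incl₃_injective :
    Function.Injective (TensorProduct.map (incl k).toLinearMap (incl₂ k).toLinearMap) := by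
  refine Function.LeftInverse.injective
    (g := TensorProduct.map (avg k) (TensorProduct.map (avg k) (avg k))) fun t => ?_
  rw [← LinearMap.comp_apply, ← TensorProduct.map_comp]
  have h1 : avg k ∘ₗ (incl k).toLinearMap = LinearMap.id := LinearMap.ext (avg_incl k)
  have h2 : TensorProduct.map (avg k) (avg k) ∘ₗ (incl₂ k).toLinearMap = LinearMap.id := by
    ext a b; simp [incl₂, avg_incl]
  rw [h1, h2, TensorProduct.map_id]; rfl

/-- The comultiplication of `O(PSL(2))`: the restriction of the one of `O(SL(2))`. -/
def comulLin : PSL2Alg k →ₗ[k] PSL2Alg k ⊗[k] PSL2Alg k :=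
  TensorProduct.map (avg k) (avg k) ∘ₗ (comulHom k).toLinearMap ∘ₗ (incl k).toLinearMap

theorem incl₂_comulLin (a : PSL2Alg k) : incl₂ k (comulLin k a) = comulHom k (incl k a) := by
  have h : ∀ t : SL2Alg k ⊗[k] SL2Alg k,
      incl₂ k (TensorProduct.map (avg k) (avg k) t) = (2⁻¹ * 2⁻¹ : k) •
        (t + Algebra.TensorProduct.map (neg k) (AlgHom.id k _) t +
          Algebra.TensorProduct.map (AlgHom.id k _) (neg k)
            (t + Algebra.TensorProduct.map (neg k) (AlgHom.id k _) t)) := by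
    intro t
    induction t with
    | zero => simp
    | tmul a b =>
      simp only [incl₂, TensorProduct.map_tmul, Algebra.TensorProduct.map_tmul, incl_avg,
        AlgHom.id_apply, map_add, TensorProduct.smul_tmul_smul, TensorProduct.add_tmul,
        TensorProduct.tmul_add]
    | add a b ha hb =>
      rw [map_add, map_add, ha, hb, ← smul_add]
      congr 1
      simp only [map_add]
      abel
  change incl₂ k (TensorProduct.map (avg k) (avg k) (comulHom k (incl k a))) = _
  rw [h, map_add, map_neg_id_comul, neg_incl, map_id_neg_comul, neg_incl,
    ← two_smul k (comulHom k (incl k a)), ← add_smul, smul_smul]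
  have : (2⁻¹ * 2⁻¹ * (2 + 2) : k) = 1 := by norm_num
  rw [this, one_smul]

/-- The comultiplication as a homomorphism of algebras. -/
def comul' : PSL2Alg k →ₐ[k] PSL2Alg k ⊗[k] PSL2Alg k :=
  AlgHom.ofLinearMap (comulLin k)
    (by apply incl₂_injective k; rw [incl₂_comulLin]; simp)
    (fun a b => by
      apply incl₂_injective k; rw [map_mul (incl₂ k), incl₂_comulLin, incl₂_comulLin,
        incl₂_comulLin, map_mul, map_mul])

theorem incl₂_comul' (a : PSL2Alg k) : incl₂ k (comul' k a) = comulHom k (incl k a) :=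
  incl₂_comulLin k a

instance : Bialgebra k (PSL2Alg k) :=
  Bialgebra.ofAlgHom (comul' k) (counit' k)
    (by
      ext a
      apply incl₃_injective k
      have key := Coalgebra.coassoc_apply (R := k) (incl k a)
      change (TensorProduct.assoc k _ _ _) ((comulHom k).toLinearMap.rTensor _
        (comulHom k (incl k a))) = (comulHom k).toLinearMap.lTensor _ (comulHom k (incl k a)) at key
      rw [← incl₂_comul'] at key
      have h1 : ∀ t : PSL2Alg k ⊗[k] PSL2Alg k,
          TensorProduct.map (incl k).toLinearMap (incl₂ k).toLinearMap
            (Algebra.TensorProduct.assoc k k k _ _ _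
              (Algebra.TensorProduct.map (comul' k) (AlgHom.id k _) t)) =
          TensorProduct.assoc k _ _ _ ((comulHom k).toLinearMap.rTensor _ (incl₂ k t)) := by
        intro t
        induction t with
        | zero => simp
        | add a b ha hb => simp only [map_add, ha, hb]
        | tmul a b =>
          simp only [Algebra.TensorProduct.map_tmul, incl₂, AlgHom.id_apply,
            LinearMap.rTensor_tmul, AlgHom.toLinearMap_apply]
          rw [← incl₂_comul']
          generalize comul' k a = t
          induction t with
          | zero => simp
          | add a b ha hb => simp only [map_add, TensorProduct.add_tmul, ha, hb]
          | tmul c d => simp [incl₂]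
      have h2 : ∀ t : PSL2Alg k ⊗[k] PSL2Alg k,
          TensorProduct.map (incl k).toLinearMap (incl₂ k).toLinearMap
            (Algebra.TensorProduct.map (AlgHom.id k _) (comul' k) t) =
          (comulHom k).toLinearMap.lTensor _ (incl₂ k t) := by
        intro t
        induction t with
        | zero => simp
        | add a b ha hb => simp only [map_add, ha, hb]
        | tmul a b =>
          simp only [Algebra.TensorProduct.map_tmul, incl₂, AlgHom.id_apply,
            LinearMap.lTensor_tmul, AlgHom.toLinearMap_apply, TensorProduct.map_tmul]
          rw [← incl₂_comul']; rfl
      exact (h1 _).trans (key.trans (h2 _).symm))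
    (by
      ext a
      have key := Coalgebra.rTensor_counit_comul (R := k) (incl k a)
      change (counitHom k).toLinearMap.rTensor _ (comulHom k (incl k a)) = _ at key
      rw [← incl₂_comul'] at key
      have h1 : ∀ t : PSL2Alg k ⊗[k] PSL2Alg k,
          incl k (Algebra.TensorProduct.lid k _
            (Algebra.TensorProduct.map (counit' k) (AlgHom.id k _) t)) =
          TensorProduct.lid k _ ((counitHom k).toLinearMap.rTensor _ (incl₂ k t)) := by
        intro t
        induction t with
        | zero => simp
        | add a b ha hb => simp only [map_add, ha, hb]
        | tmul a b => simp [incl₂, counit']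
      have h2 := (h1 (comul' k a)).trans (congrArg (TensorProduct.lid k _) key)
      apply (Algebra.TensorProduct.lid k (PSL2Alg k)).injective
      apply incl_injective k
      refine h2.trans ?_
      simp)
    (by
      ext a
      have key := Coalgebra.lTensor_counit_comul (R := k) (incl k a)
      change (counitHom k).toLinearMap.lTensor _ (comulHom k (incl k a)) = _ at key
      rw [← incl₂_comul'] at key
      have h1 : ∀ t : PSL2Alg k ⊗[k] PSL2Alg k,
          incl k (Algebra.TensorProduct.rid k k _
            (Algebra.TensorProduct.map (AlgHom.id k _) (counit' k) t)) =
          TensorProduct.rid k _ ((counitHom k).toLinearMap.lTensor _ (incl₂ k t)) := by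
        intro t
        induction t with
        | zero => simp
        | add a b ha hb => simp only [map_add, ha, hb]
        | tmul a b => simp [incl₂, counit']
      have h2 := (h1 (comul' k a)).trans (congrArg (TensorProduct.rid k _) key)
      apply (Algebra.TensorProduct.rid k k (PSL2Alg k)).injective
      apply incl_injective k
      refine h2.trans ?_
      simp)

instance : HopfAlgebra k (PSL2Alg k) :=
  HopfAlgebra.ofAlgHom (antipode' k)
    (by
      ext a
      apply incl_injective k
      have key := HopfAlgebra.mul_antipode_rTensor_comul_apply (R := k) (incl k a)
      change LinearMap.mul' k _ ((antipodeHom k).toLinearMap.rTensor _ (comulHom k (incl k a))) = _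
        at key
      rw [← incl₂_comul'] at key
      have h1 : ∀ t : PSL2Alg k ⊗[k] PSL2Alg k,
          incl k (Algebra.TensorProduct.lift (antipode' k) (AlgHom.id k _)
            (fun _ _ => Commute.all _ _) t) =
          LinearMap.mul' k _ ((antipodeHom k).toLinearMap.rTensor _ (incl₂ k t)) := by
        intro t
        induction t with
        | zero => simp
        | add a b ha hb => simp only [map_add, ha, hb]
        | tmul a b =>
          rw [Algebra.TensorProduct.lift_tmul, map_mul]
          simp [incl₂, incl_antipode']
      exact (h1 _).trans (key.trans ((incl k).commutes _).symm))
    (by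
      ext a
      apply incl_injective k
      have key := HopfAlgebra.mul_antipode_lTensor_comul_apply (R := k) (incl k a)
      change LinearMap.mul' k _ ((antipodeHom k).toLinearMap.lTensor _ (comulHom k (incl k a))) = _
        at key
      rw [← incl₂_comul'] at key
      have h1 : ∀ t : PSL2Alg k ⊗[k] PSL2Alg k,
          incl k (Algebra.TensorProduct.lift (AlgHom.id k _) (antipode' k)
            (fun _ _ => Commute.all _ _) t) =
          LinearMap.mul' k _ ((antipodeHom k).toLinearMap.lTensor _ (incl₂ k t)) := by
        intro t
        induction t with
        | zero => simp
        | add a b ha hb => simp only [map_add, ha, hb]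
        | tmul a b =>
          rw [Algebra.TensorProduct.lift_tmul, map_mul]
          simp [incl₂, incl_antipode']
      exact (h1 _).trans (key.trans ((incl k).commutes _).symm))

end PSL2Alg

/-- The quotient morphism `p : SL(2) → PSL(2)`. -/
def coverMap : Spec (CommRingCat.of (SL2Alg k)) ⟶ Spec (CommRingCat.of (PSL2Alg k)) :=
  Spec.map (CommRingCat.ofHom (PSL2Alg.incl k).toRingHom)

end PSL2

end RepScheme

end

/-! Clopenness rests on rigidity of torsion. Let `g` be a point of `H` over a `k`-algebra `S` with
`g ^ n = 1`, and let `J` be the ideal of `S` cutting out the locus where `g` is trivial. On the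
augmentation ideal the comultiplication is `a ↦ a ⊗ 1 + 1 ⊗ a` up to products, so the value of `g ^
n` at `a` is `n` times that of `g` modulo `J ^ 2`. Since `n` is invertible, `J = J ^ 2`; as `J` is
finitely generated, it is generated by an idempotent, and its zero locus is clopen
(`isClopen_zeroLocus_dispIdeal`). Injectivity on finitely many finite subgroups is a finite
intersection of complements of such loci, so `hom_o` is clopen, of the form `D(e)` with `e`
idempotent. The locus is stable under conjugation and an idempotent is determined by its basic open
set, so `e` is an invariant function. If `H` is reductive, then `hom → X` is surjective, and `X_o`
is the basic open set of `e` in `X`.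

The same rigidity says that a torsion point which is trivial at all field-valued points is trivial
(`eq_one_of_forall_field`). In `SL(2)` over a field of characteristic zero, `g ^ 2 = 1` forces `g =
±1`. Hence an elementary-injective representation of `Γ̃` sends `z ≠ 1` to `-1` and descends to `Γ →
PSL(2)`. Conversely, take an elementary-injective `ρ : Γ → PSL(2)` and arbitrary lifts `s_v` of the
`ρ(g_v)`. Both `s_v ^ 2` and `(s_v s_w) ^ m` are squares lying over `1`; they are nowhere `1`,
because `g_v` and `(g_v g_w) ^ (m / 2)` are nontrivial and `ρ` is injective on elementary subgroups.
So both equal `-1`, and since `m` is even these are the relations of `Γ̃`.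

Points of `Y` over `ρ` are therefore families of lifts of the `ρ(g_v)` to `SL(2)`
(`IsInjRep.exists_lift`), and `q` inherits its properties from `SL(2) → PSL(2)`: unique lifting
along square-zero ideals, integrality, lifting over algebraically closed fields, and a sign
ambiguity for each vertex. The group theory needed, `ExtGroup.z_ne_one` and
`CoxGroup.mul_pow_half_ne_one`, comes from explicit representations. -/

noncomputable section

namespace RepScheme

/-! ### The locus where a torsion point is trivial -/

section Displacement

variable {k : Type u} [Field k] {A : Type u} [CommRing A] [HopfAlgebra k A]
  {S T : Type u} [CommRing S] [Algebra k S] [CommRing T] [Algebra k T]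

theorem mapPt_apply (f : S →ₐ[k] T) (g : Pt k A S) (a : A) :
    (mapPt f g).ofConv a = f (g.ofConv a) := rfl

theorem pt_ext {g h : Pt k A S} (H : ∀ a, g.ofConv a = h.ofConv a) : g = h :=
  WithConv.ofConv_injective (AlgHom.ext H)

theorem one_pt_apply (a : A) :
    (1 : Pt k A S).ofConv a = algebraMap k S (Coalgebra.counit (R := k) a) := rfl

theorem mapPt_mapPt {U : Type u} [CommRing U] [Algebra k U] (f : S →ₐ[k] T) (g : T →ₐ[k] U)
    (x : Pt k A S) : mapPt g (mapPt f x) = mapPt (g.comp f) x := rfl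

variable (k A) in
/-- The augmentation ideal of `O(H)`, the ideal of the neutral element. -/
def augIdeal : Ideal A := RingHom.ker (Bialgebra.counitAlgHom k A)

theorem mem_augIdeal {a : A} : a ∈ augIdeal k A ↔ Coalgebra.counit (R := k) a = 0 := Iff.rfl

/-- The ideal of the closed subscheme of `Spec S` on which the point `g` is trivial. -/
def dispIdeal (g : Pt k A S) : Ideal S := (augIdeal k A).map g.ofConv

theorem sub_mem_dispIdeal (g : Pt k A S) (a : A) :
    g.ofConv a - algebraMap k S (Coalgebra.counit (R := k) a) ∈ dispIdeal g := by
  have h : a - algebraMap k A (Coalgebra.counit (R := k) a) ∈ augIdeal k A := by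
    rw [mem_augIdeal, map_sub, Bialgebra.counit_algebraMap, sub_self]
  have h2 := Ideal.mem_map_of_mem g.ofConv h
  rwa [map_sub, AlgHom.commutes] at h2

/-- The universal property of the closed locus: a base change factors through it exactly when it
kills the point. Questions about triviality are translated into ideals through this. -/
theorem dispIdeal_le_ker_iff (f : S →ₐ[k] T) (g : Pt k A S) :
    dispIdeal g ≤ RingHom.ker f ↔ mapPt f g = 1 := by
  constructor
  · intro h
    refine pt_ext fun a => ?_
    have := h (sub_mem_dispIdeal g a)
    rw [RingHom.mem_ker, map_sub, sub_eq_zero, AlgHom.commutes] at this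
    exact this
  · intro h
    rw [dispIdeal, Ideal.map_le_iff_le_comap]
    intro a ha
    rw [Ideal.mem_comap, RingHom.mem_ker, ← mapPt_apply, h, one_pt_apply, mem_augIdeal.1 ha,
      map_zero]

theorem dispIdeal_le_iff (g : Pt k A S) (J : Ideal S) :
    dispIdeal g ≤ J ↔ mapPt (Ideal.Quotient.mkₐ k J) g = 1 := by
  rw [← dispIdeal_le_ker_iff]
  exact iff_of_eq (congrArg _ (Ideal.Quotient.mkₐ_ker k J).symm)

theorem dispIdeal_eq_bot_iff (g : Pt k A S) : dispIdeal g = ⊥ ↔ g = 1 := by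
  have h := dispIdeal_le_ker_iff (AlgHom.id k S) g
  have h2 : RingHom.ker (AlgHom.id k S) = ⊥ := (RingHom.ker_eq_bot_iff_eq_zero _).2 fun _ h => h
  rw [h2, le_bot_iff] at h
  exact h

theorem dispIdeal_mapPt (f : S →ₐ[k] T) (g : Pt k A S) :
    dispIdeal (mapPt f g) = (dispIdeal g).map f := by
  rw [dispIdeal, dispIdeal, Ideal.map_mapₐ]
  rfl

theorem dispIdeal_conj_le (g h : Pt k A S) : dispIdeal (h * g * h⁻¹) ≤ dispIdeal g := by
  rw [dispIdeal_le_iff, map_mul, map_mul, (dispIdeal_le_iff g _).1 le_rfl, mul_one, ← map_mul,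
    mul_inv_cancel, map_one]

/-- Being trivial is invariant under conjugation; this is what later makes the injectivity locus
stable under `H`. -/
theorem dispIdeal_conj (g h : Pt k A S) : dispIdeal (h * g * h⁻¹) = dispIdeal g := by
  refine le_antisymm (dispIdeal_conj_le g h) ?_
  have := dispIdeal_conj_le (h * g * h⁻¹) h⁻¹
  rwa [show h⁻¹ * (h * g * h⁻¹) * h⁻¹⁻¹ = g by group] at this

theorem mul_apply_repr (g h : Pt k A S) (a : A) {ι : Type*} (r : Coalgebra.Repr k a ι) :
    (g * h).ofConv a = ∑ i ∈ r.index, g.ofConv (r.left i) * h.ofConv (r.right i) := by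
  have := AlgHom.convMul_apply (R := k) g h a
  refine this.trans ?_
  rw [← r.eq, map_sum]
  simp

/-- To first order at the neutral element, multiplication is addition. -/
theorem mul_apply_sub_mem {K : Ideal S} {g h : Pt k A S} (hg : dispIdeal g ≤ K)
    (hh : dispIdeal h ≤ K) {a : A} (ha : a ∈ augIdeal k A) :
    (g * h).ofConv a - (g.ofConv a + h.ofConv a) ∈ K * K := by
  let r := Coalgebra.Repr.arbitrary k a
  let ε : A → S := fun a => algebraMap k S (Coalgebra.counit (R := k) a)
  have h1 : ∑ i ∈ r.index, ε (r.left i) * h.ofConv (r.right i) = h.ofConv a := by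
    have := mul_apply_repr (1 : Pt k A S) h a r
    rw [one_mul] at this
    exact this.symm
  have h2 : ∑ i ∈ r.index, g.ofConv (r.left i) * ε (r.right i) = g.ofConv a := by
    have := mul_apply_repr g (1 : Pt k A S) a r
    rw [mul_one] at this
    exact this.symm
  have h3 : ∑ i ∈ r.index, ε (r.left i) * ε (r.right i) = 0 := by
    have := mul_apply_repr (1 : Pt k A S) (1 : Pt k A S) a r
    rw [mul_one, one_pt_apply, mem_augIdeal.1 ha, map_zero] at this
    exact this.symm
  -- By the counit identities, removing `ε` from both factors of every term of the comultiplication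
  -- leaves exactly the difference sought, now a sum of products of two elements of `K`.
  have h4 : (g * h).ofConv a - (g.ofConv a + h.ofConv a) =
      ∑ i ∈ r.index, (g.ofConv (r.left i) - ε (r.left i)) *
        (h.ofConv (r.right i) - ε (r.right i)) := by
    simp only [sub_mul, mul_sub, Finset.sum_sub_distrib, h1, h2, h3, mul_apply_repr g h a r]
    ring
  rw [h4]
  exact Ideal.sum_mem _ fun i _ =>
    Ideal.mul_mem_mul (hg (sub_mem_dispIdeal _ _)) (hh (sub_mem_dispIdeal _ _))

theorem dispIdeal_pow_le (g : Pt k A S) (n : ℕ) : dispIdeal (g ^ n) ≤ dispIdeal g := by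
  rw [dispIdeal_le_iff, map_pow, (dispIdeal_le_iff g _).1 le_rfl, one_pow]

theorem pow_apply_sub_mem (g : Pt k A S) (n : ℕ) {a : A} (ha : a ∈ augIdeal k A) :
    (g ^ n).ofConv a - n * g.ofConv a ∈ dispIdeal g * dispIdeal g := by
  induction n with
  | zero => simp [mem_augIdeal.1 ha]
  | succ n ih =>
    have h := mul_apply_sub_mem (dispIdeal_pow_le g n) le_rfl ha
    rw [← pow_succ] at h
    have := Ideal.add_mem _ h ih
    convert this using 1
    push_cast
    ring

/-- Modulo `J ^ 2` the relation `g ^ n = 1` reads `n * g(a) = 0` for `a` in the augmentation ideal,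
and `n` is invertible in characteristic zero. -/
theorem isIdempotentElem_dispIdeal [CharZero k] {g : Pt k A S} {n : ℕ} (hn : n ≠ 0) (hg : g ^ n = 1) :
    IsIdempotentElem (dispIdeal g) := by
  refine le_antisymm Ideal.mul_le_left ?_
  conv_lhs => rw [dispIdeal]
  rw [Ideal.map_le_iff_le_comap]
  intro a ha
  have h := pow_apply_sub_mem g n ha
  rw [hg, one_pt_apply, mem_augIdeal.1 ha, map_zero, zero_sub, neg_mem_iff] at h
  have h2 := Ideal.mul_mem_left _ (algebraMap k S (n : k)⁻¹) h
  rwa [← mul_assoc, ← map_natCast (algebraMap k S), ← map_mul,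
    inv_mul_cancel₀ (Nat.cast_ne_zero.2 hn), map_one, one_mul] at h2

variable [Algebra.FiniteType k A]

theorem fg_dispIdeal (g : Pt k A S) : (dispIdeal g).FG := by
  have : IsNoetherianRing A := Algebra.FiniteType.isNoetherianRing k A
  exact Ideal.FG.map (IsNoetherian.noetherian _) _

variable [CharZero k]

theorem exists_idempotent_dispIdeal {g : Pt k A S} {n : ℕ} (hn : n ≠ 0) (hg : g ^ n = 1) :
    ∃ e : S, IsIdempotentElem e ∧ dispIdeal g = Ideal.span {e} :=
  (Ideal.isIdempotentElem_iff_of_fg _ (fg_dispIdeal g)).1 (isIdempotentElem_dispIdeal hn hg)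

theorem isClopen_zeroLocus_dispIdeal {g : Pt k A S} {n : ℕ} (hn : n ≠ 0) (hg : g ^ n = 1) :
    IsClopen (PrimeSpectrum.zeroLocus (dispIdeal g : Set S)) := by
  obtain ⟨e, he, h⟩ := exists_idempotent_dispIdeal hn hg
  rw [h, PrimeSpectrum.zeroLocus_span]
  exact PrimeSpectrum.isClopen_iff_mul_add_zeroLocus.2 ⟨e, 1 - e, by
    rw [mul_sub, mul_one, he.eq, sub_self], by ring, rfl⟩

/-- A point of finite order that is trivial at all geometric points is trivial. -/
theorem eq_one_of_forall_field {g : Pt k A S} {n : ℕ} (hn : n ≠ 0) (hg : g ^ n = 1)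
    (h : ∀ (F : Type u) [Field F] [Algebra k F] (f : S →ₐ[k] F), mapPt f g = 1) : g = 1 := by
  obtain ⟨e, he, h1⟩ := exists_idempotent_dispIdeal hn hg
  -- Triviality at every residue field puts `e` in every prime. An idempotent that is nilpotent
  -- vanishes, so reducedness of `S` is not needed.
  have hnil : IsNilpotent e := by
    refine nilpotent_iff_mem_prime.2 fun P hP => ?_
    have h2 := (dispIdeal_le_ker_iff _ g).2
      (h P.ResidueField (IsScalarTower.toAlgHom k S P.ResidueField))
    have h3 : e ∈ dispIdeal g := by rw [h1]; exact Ideal.subset_span rfl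
    exact (Ideal.algebraMap_residueField_eq_zero).1 (h2 h3)
  obtain ⟨N, hN⟩ := hnil
  have h0 : e = 0 := by
    rcases N with _ | N
    · rw [pow_zero] at hN
      rw [← mul_one e, hN, mul_zero]
    · rwa [he.pow_succ_eq] at hN
  rw [← dispIdeal_eq_bot_iff, h1, h0, Ideal.span_singleton_eq_bot]

end Displacement

/-! ### The injectivity locus and its functor of points -/

section InjLocus

variable (k A : Type u) [Field k] [CommRing A] [HopfAlgebra k A]
  {α : Type} [DecidableEq α] (rels : Set (FreeGroup α))

variable {k A rels} in
theorem repAt_eq_one_iff (x : PrimeSpectrum (RepAlg k A rels)) (γ : PresentedGroup rels) :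
    repAt k A rels x γ = 1 ↔ dispIdeal (univRep k A rels γ) ≤ x.asIdeal := by
  have h := dispIdeal_le_ker_iff
    (IsScalarTower.toAlgHom k (RepAlg k A rels) (resField k A rels x)) (univRep k A rels γ)
  have h2 : RingHom.ker (IsScalarTower.toAlgHom k (RepAlg k A rels) (resField k A rels x)) =
      x.asIdeal := Ideal.ext fun a => Ideal.algebraMap_residueField_eq_zero
  rw [h2] at h
  exact h.symm

variable {k A rels} in
theorem mem_injLocus_iff {𝓔 : Set (Subgroup (PresentedGroup rels))}
    {x : PrimeSpectrum (RepAlg k A rels)} :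
    x ∈ injLocus k A rels 𝓔 ↔
      ∀ K ∈ 𝓔, ∀ γ ∈ K, dispIdeal (univRep k A rels γ) ≤ x.asIdeal → γ = 1 := by
  refine forall₂_congr fun K hK => ?_
  simp only [← repAt_eq_one_iff]
  constructor
  · intro h γ hγ h1
    exact h hγ K.one_mem (h1.trans (map_one _).symm)
  · intro h γ hγ δ hδ e
    rw [← mul_inv_eq_one]
    exact h _ (K.mul_mem hγ (K.inv_mem hδ)) (by rw [map_mul, map_inv, e, mul_inv_cancel])

/-- Injectivity on `K` means that no nontrivial element dies. Each element of the finite group `K`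
has finite order, so each of the finitely many conditions is clopen. -/
theorem isClopen_injLocus [CharZero k] [Algebra.FiniteType k A]
    (𝓔 : Set (Subgroup (PresentedGroup rels))) (h : 𝓔.Finite)
    (h' : ∀ K ∈ 𝓔, Finite K) : IsClopen (injLocus k A rels 𝓔) := by
  have key : injLocus k A rels 𝓔 = ⋂ K ∈ 𝓔, ⋂ γ ∈ (K : Set (PresentedGroup rels)) \ {1},
      (PrimeSpectrum.zeroLocus (dispIdeal (univRep k A rels γ) : Set (RepAlg k A rels)))ᶜ := by
    ext x
    simp only [mem_injLocus_iff, Set.mem_iInter, Set.mem_compl_iff, PrimeSpectrum.mem_zeroLocus,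
      Set.mem_sdiff, Set.mem_singleton_iff, SetLike.mem_coe, SetLike.coe_subset_coe]
    exact forall₃_congr fun K _ γ => by tauto
  rw [key]
  refine h.isClopen_biInter fun K hK => ?_
  have hf : (K : Set (PresentedGroup rels)).Finite := h' K hK
  refine (hf.subset Set.sdiff_subset).isClopen_biInter fun γ hγ => ?_
  have := h' K hK
  obtain ⟨n, hn, h1⟩ := isOfFinOrder_iff_pow_eq_one.1 (isOfFinOrder_of_finite (⟨γ, hγ.1⟩ : K))
  have h2 : univRep k A rels γ ^ n = 1 := by
    rw [← map_pow, show γ ^ n = 1 from congrArg Subtype.val h1, map_one]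
  exact (isClopen_zeroLocus_dispIdeal hn.ne' h2).compl

/-- A representation over `S` that is injective on each of the given subgroups at all
field-valued points of `Spec S`. -/
def IsInjRep {k A : Type u} [Field k] [CommRing A] [HopfAlgebra k A] {G : Type} [Group G]
    (𝓔 : Set (Subgroup G)) {S : Type u} [CommRing S] [Algebra k S] (ρ : G →* Pt k A S) : Prop :=
  ∀ (F : Type u) [Field F] [Algebra k F] (f : S →ₐ[k] F), ∀ K ∈ 𝓔, ∀ γ ∈ K,
    mapPt f (ρ γ) = 1 → γ = 1

theorem IsInjRep.map {k A : Type u} [Field k] [CommRing A] [HopfAlgebra k A] {G : Type} [Group G]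
    {𝓔 : Set (Subgroup G)} {S T : Type u} [CommRing S] [Algebra k S] [CommRing T] [Algebra k T]
    {ρ : G →* Pt k A S} (h : IsInjRep 𝓔 ρ) (f : S →ₐ[k] T) : IsInjRep 𝓔 ((mapPt f).comp ρ) :=
  fun F _ _ g K hK γ hγ h1 => h F (g.comp f) K hK γ hγ h1

variable {k A rels} {S : Type u} [CommRing S] [Algebra k S]

/-- With its converse `isInjRep_of_comap_mem`, this passes between points of the scheme and
representations over an arbitrary algebra. Residue fields suffice as test fields. -/
theorem comap_mem_injLocus (𝓔 : Set (Subgroup (PresentedGroup rels)))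
    (f : RepAlg k A rels →ₐ[k] S) (h : IsInjRep 𝓔 ((mapPt f).comp (univRep k A rels)))
    (y : PrimeSpectrum S) : PrimeSpectrum.comap (f : RepAlg k A rels →+* S) y ∈
      injLocus k A rels 𝓔 := by
  rw [mem_injLocus_iff]
  intro K hK γ hγ h1
  refine h y.asIdeal.ResidueField (IsScalarTower.toAlgHom k S y.asIdeal.ResidueField) K hK γ hγ ?_
  rw [MonoidHom.comp_apply, ← dispIdeal_le_ker_iff, dispIdeal_mapPt, Ideal.map_le_iff_le_comap]
  exact h1.trans fun a ha => Ideal.algebraMap_residueField_eq_zero.2 ha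

theorem isInjRep_of_comap_mem (𝓔 : Set (Subgroup (PresentedGroup rels)))
    (f : RepAlg k A rels →ₐ[k] S) (h : ∀ y : PrimeSpectrum S,
      PrimeSpectrum.comap (f : RepAlg k A rels →+* S) y ∈ injLocus k A rels 𝓔) :
    IsInjRep 𝓔 ((mapPt f).comp (univRep k A rels)) := by
  intro F _ _ g K hK γ hγ h1
  refine mem_injLocus_iff.1 (h ⟨RingHom.ker g, RingHom.ker_isPrime g⟩) K hK γ hγ ?_
  have h2 : mapPt (g.comp f) (univRep k A rels γ) = 1 := h1
  exact (dispIdeal_le_ker_iff _ _).2 h2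

theorem RepAlg.algHom_ext [Finite α] {f g : RepAlg k A rels →ₐ[k] S}
    (h : ∀ a, mapPt f (univRep k A rels (PresentedGroup.of a)) =
      mapPt g (univRep k A rels (PresentedGroup.of a))) : f = g := by
  refine Ideal.Quotient.algHom_ext _ (PiTensorProduct.algHom_ext fun a => ?_)
  have h1 : ∀ a, univRep k A rels (PresentedGroup.of a) =
      mapPt (RepAlg.mk k A rels) (wordMap k A (FreeGroup.of a)) := fun a => by
    rw [univRep, PresentedGroup.toGroup.of]
  have h2 := congrArg ofConv (h a)
  simp only [h1, wordMap, FreeGroup.lift_apply_of] at h2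
  exact h2

theorem RepAlg.mapPt_lift [Fintype α] (g : α → Pt k A S) (hg : ∀ r ∈ rels, FreeGroup.lift g r = 1) :
    (mapPt (RepAlg.lift rels g hg)).comp (univRep k A rels) = PresentedGroup.toGroup hg := by
  refine PresentedGroup.ext fun a => ?_
  rw [MonoidHom.comp_apply, PresentedGroup.toGroup.of, univRep, PresentedGroup.toGroup.of,
    mapPt_mapPt]
  have := PowAlg.mapPt_lift g (FreeGroup.of a)
  rw [FreeGroup.lift_apply_of] at this
  exact this

theorem toGroup_lift_eq {α : Type} {rels : Set (FreeGroup α)} (ρ : PresentedGroup rels →* Pt k A S) (r : FreeGroup α) :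
    FreeGroup.lift (fun a => ρ (PresentedGroup.of a)) r = ρ (PresentedGroup.mk rels r) := by
  have : FreeGroup.lift (fun a => ρ (PresentedGroup.of a)) = ρ.comp (PresentedGroup.mk rels) := by
    ext a : 1
    rw [FreeGroup.lift_apply_of]; rfl
  rw [this]; rfl

/-- The `S`-valued point of `hom(G, H)` given by a representation `G → H(S)`. -/
def RepAlg.ofRep [Fintype α] (ρ : PresentedGroup rels →* Pt k A S) : RepAlg k A rels →ₐ[k] S :=
  RepAlg.lift rels (fun a => ρ (PresentedGroup.of a)) fun r hr => by
    rw [toGroup_lift_eq, PresentedGroup.one_of_mem hr, map_one]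

theorem RepAlg.mapPt_ofRep [Fintype α] (ρ : PresentedGroup rels →* Pt k A S) :
    (mapPt (RepAlg.ofRep ρ)).comp (univRep k A rels) = ρ := by
  rw [RepAlg.ofRep, RepAlg.mapPt_lift]
  exact PresentedGroup.ext fun a => PresentedGroup.toGroup.of _

end InjLocus

/-! ### The coordinate ring of the injectivity locus -/

section Localized

variable {k A : Type u} [Field k] [CommRing A] [HopfAlgebra k A]
  {α : Type} [DecidableEq α] {rels : Set (FreeGroup α)} (e : RepAlg k A rels)
  {S : Type u} [CommRing S] [Algebra k S]

/-- The localization map of the representation algebra. -/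
def awayHom : RepAlg k A rels →ₐ[k] Localization.Away e :=
  IsScalarTower.toAlgHom k (RepAlg k A rels) (Localization.Away e)

/-- The universal representation over a basic open subset of the representation scheme. -/
def univAway : PresentedGroup rels →* Pt k A (Localization.Away e) :=
  (mapPt (awayHom e)).comp (univRep k A rels)

theorem away_algHom_ext [Finite α] {f g : Localization.Away e →ₐ[k] S}
    (h : ∀ a, mapPt f (univAway e (PresentedGroup.of a)) =
      mapPt g (univAway e (PresentedGroup.of a))) : f = g := by
  have h1 : f.comp (awayHom e) = g.comp (awayHom e) := RepAlg.algHom_ext h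
  have h2 : (f : Localization.Away e →+* S) = (g : Localization.Away e →+* S) :=
    IsLocalization.ringHom_ext (Submonoid.powers e) (congrArg AlgHom.toRingHom h1)
  exact AlgHom.ext fun x => DFunLike.congr_fun h2 x

variable {e} {𝓔 : Set (Subgroup (PresentedGroup rels))}
theorem isInjRep_univAway (he : injLocus k A rels 𝓔 = PrimeSpectrum.basicOpen e) :
    IsInjRep 𝓔 (univAway e) :=
  isInjRep_of_comap_mem 𝓔 (awayHom e) fun y => by
    rw [he, ← PrimeSpectrum.localization_away_comap_range (Localization.Away e) e]
    exact ⟨y, rfl⟩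

/-- `Localization.Away e` represents the elementary-injective representations: if `e` were not a
unit over `S`, a maximal ideal containing it would give a point outside the locus. -/
theorem exists_away_algHom [Fintype α]
    (he : injLocus k A rels 𝓔 = PrimeSpectrum.basicOpen e) {ρ : PresentedGroup rels →* Pt k A S}
    (h : IsInjRep 𝓔 ρ) :
    ∃ f : Localization.Away e →ₐ[k] S, (mapPt f).comp (univAway e) = ρ := by
  have hu : IsUnit (RepAlg.ofRep ρ e) := by
    by_contra hu
    obtain ⟨P, hP, h1⟩ := exists_max_ideal_of_mem_nonunits hu
    have h2 := comap_mem_injLocus 𝓔 (RepAlg.ofRep ρ) (by rwa [RepAlg.mapPt_ofRep])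
      ⟨P, hP.isPrime⟩
    rw [he] at h2
    exact h2 h1
  let f : Localization.Away e →+* S :=
    IsLocalization.Away.lift (g := (RepAlg.ofRep ρ : RepAlg k A rels →+* S)) e hu
  have hf : ∀ a, f (algebraMap _ _ a) = RepAlg.ofRep ρ a := fun a =>
    IsLocalization.Away.lift_eq e hu a
  refine ⟨{ f with commutes' := fun c => ?_ }, ?_⟩
  · change f (algebraMap k _ c) = _
    rw [IsScalarTower.algebraMap_apply k (RepAlg k A rels), hf, AlgHom.commutes]
  · conv_rhs => rw [← RepAlg.mapPt_ofRep ρ]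
    refine MonoidHom.ext fun γ => pt_ext fun a => ?_
    exact hf _

end Localized

/-! ### Local finiteness and exactness of invariants -/

section Comodule

variable {k A : Type u} [Field k] [CommRing A] [HopfAlgebra k A]
  {M N : Type u} [AddCommGroup M] [Module k M] [AddCommGroup N] [Module k N]

/-- Coassociativity, with its last factor contracted by a functional `l`. -/
theorem coaction_contract {δ : N →ₗ[k] N ⊗[k] A} (h : IsCoaction δ) (l : A →ₗ[k] k) (v : N) :
    δ (TensorProduct.rid k N (l.lTensor N (δ v))) =
      ((TensorProduct.rid k A).toLinearMap ∘ₗ l.lTensor A ∘ₗ Coalgebra.comul).lTensor N (δ v) := by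
  have h1 : ∀ t : N ⊗[k] A, δ (TensorProduct.rid k N (l.lTensor N t)) =
      ((TensorProduct.rid k A).toLinearMap ∘ₗ l.lTensor A).lTensor N
        (TensorProduct.assoc k N A A (δ.rTensor A t)) := by
    intro t
    induction t with
    | zero => simp
    | add a b ha hb => simp only [map_add, ha, hb]
    | tmul x a =>
      simp only [LinearMap.lTensor_tmul, TensorProduct.rid_tmul, map_smul, LinearMap.rTensor_tmul]
      generalize δ x = s
      induction s with
      | zero => simp
      | add a b ha hb => simp only [smul_add, map_add, TensorProduct.add_tmul, ha, hb]
      | tmul y c => simp [TensorProduct.tmul_smul]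
  rw [h1]
  have h2 := LinearMap.congr_fun h.coassoc v
  simp only [LinearMap.comp_apply, LinearEquiv.coe_coe] at h2
  rw [h2, ← LinearMap.comp_apply, ← LinearMap.lTensor_comp, LinearMap.comp_assoc]

/-- Comodules are locally finite. -/
theorem exists_finite_subrep {δ : N →ₗ[k] N ⊗[k] A} (h : IsCoaction δ) (v : N) :
    ∃ W : Submodule k N, Module.Finite k W ∧ v ∈ W ∧ IsSubrep δ W := by
  classical
  let B := Module.Basis.ofVectorSpace k A
  obtain ⟨b, hb⟩ := TensorProduct.eq_repr_basis_right B (δ v)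
  have hcon : ∀ l : A →ₗ[k] k, TensorProduct.rid k N (l.lTensor N (δ v)) =
      b.sum fun i m => l (B i) • m := by
    intro l
    rw [← hb]
    simp [Finsupp.sum]
  have hbi : ∀ i, TensorProduct.rid k N ((B.coord i).lTensor N (δ v)) = b i := by
    intro i
    rw [hcon, Finsupp.sum, Finset.sum_eq_single i]
    · simp
    · intro j _ hj; simp [Finsupp.single_eq_of_ne hj.symm]
    · intro hi; simpa using hi
  -- The span of the finitely many coefficients of `δ v` in a basis of `A`. Each coefficient is a
  -- contraction of `δ v` by a coordinate functional, so `coaction_contract` shows the span to be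
  -- stable; the counit recovers `v` in it.
  let W : Submodule k N := Submodule.span k (b.support.image b : Finset N)
  have hbW : ∀ i ∈ b.support, b i ∈ W := fun i hi =>
    Submodule.subset_span (Finset.mem_coe.2 (Finset.mem_image_of_mem b hi))
  have hδv : ∀ μ : A →ₗ[k] A, μ.lTensor N (δ v) ∈ LinearMap.range (W.subtype.rTensor A) := by
    intro μ
    rw [← hb, Finsupp.sum, map_sum]
    exact Submodule.sum_mem _ fun i hi => ⟨(⟨b i, hbW i hi⟩ : W) ⊗ₜ μ (B i), by simp⟩
  refine ⟨W, inferInstance, ?_, ?_⟩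
  · have h1 := LinearMap.congr_fun h.counit v
    simp only [LinearMap.comp_apply, LinearEquiv.coe_coe, LinearMap.id_apply] at h1
    rw [← h1, hcon]
    exact Submodule.sum_mem _ fun i hi => W.smul_mem _ (hbW i hi)
  · intro u hu
    have : W ≤ (LinearMap.range (W.subtype.rTensor A)).comap δ := by
      refine Submodule.span_le.2 fun x hx => ?_
      obtain ⟨i, hi, rfl⟩ := Finset.mem_image.1 (Finset.mem_coe.1 hx)
      rw [SetLike.mem_coe, Submodule.mem_comap, ← hbi i, coaction_contract h]
      exact hδv _
    exact this hu

/-- Tensor products over a field are exact, so `W ⊗ X` embeds in `N ⊗ X` and the comodule axioms can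
be checked there. -/
theorem exists_restrict_coaction {δ : N →ₗ[k] N ⊗[k] A} (h : IsCoaction δ) {W : Submodule k N}
    (hW : IsSubrep δ W) : ∃ δ' : W →ₗ[k] W ⊗[k] A, IsCoaction δ' ∧
      W.subtype.rTensor A ∘ₗ δ' = δ ∘ₗ W.subtype := by
  have hinj : ∀ (X : Type u) [AddCommGroup X] [Module k X],
      Function.Injective (W.subtype.rTensor X) := fun X _ _ =>
    Module.Flat.rTensor_preserves_injective_linearMap _ W.subtype_injective
  let E := LinearEquiv.ofInjective _ (hinj A)
  let δ' : W →ₗ[k] W ⊗[k] A := E.symm.toLinearMap ∘ₗ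
    LinearMap.codRestrict _ (δ ∘ₗ W.subtype) fun w => hW w w.2
  have hδ' : ∀ w, W.subtype.rTensor A (δ' w) = δ w := fun w =>
    congrArg Subtype.val (E.apply_symm_apply _)
  refine ⟨δ', ⟨?_, ?_⟩, LinearMap.ext hδ'⟩
  · ext w
    apply hinj (A ⊗[k] A)
    have h1 : ∀ t : W ⊗[k] A, W.subtype.rTensor (A ⊗[k] A)
        (TensorProduct.assoc k W A A (δ'.rTensor A t)) =
        TensorProduct.assoc k N A A (δ.rTensor A (W.subtype.rTensor A t)) := by
      intro t
      induction t with
      | zero => simp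
      | add a b ha hb => simp only [map_add, ha, hb]
      | tmul x a =>
        simp only [LinearMap.rTensor_tmul, Submodule.subtype_apply]
        rw [← hδ']
        generalize δ' x = s
        induction s with
        | zero => simp
        | add a b ha hb => simp only [map_add, TensorProduct.add_tmul, ha, hb]
        | tmul y c => simp
    have h2 := LinearMap.congr_fun h.coassoc w
    simp only [LinearMap.comp_apply, LinearEquiv.coe_coe] at h2 ⊢
    rw [h1, hδ', h2, ← hδ']
    exact LinearMap.congr_fun ((LinearMap.lTensor_comp_rTensor ..).trans
      (LinearMap.rTensor_comp_lTensor ..).symm) (δ' w)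
  · ext w
    have h2 := LinearMap.congr_fun h.counit w
    simp only [LinearMap.comp_apply, LinearEquiv.coe_coe, LinearMap.id_apply] at h2 ⊢
    rw [← hδ'] at h2
    refine Eq.trans ?_ h2
    generalize δ' w = s
    induction s with
    | zero => simp
    | add a b ha hb => simp only [map_add, Submodule.coe_add, ha, hb]
    | tmul y c => simp

/-- Taking invariants under a reductive group is exact. -/
theorem IsReductive.exists_invariant_lift (hred : IsReductive k A) {δ : N →ₗ[k] N ⊗[k] A}
    (hδ : IsCoaction δ) {δM : M →ₗ[k] M ⊗[k] A} {T : N →ₗ[k] M}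
    (hT : ∀ n, δM (T n) = T.rTensor A (δ n)) {n : N} (hn : δM (T n) = T n ⊗ₜ 1) :
    ∃ u, T u = T n ∧ δ u = u ⊗ₜ 1 := by
  obtain ⟨W, hfin, hnW, hW⟩ := exists_finite_subrep hδ n
  obtain ⟨δ', hδ', hcomm⟩ := exists_restrict_coaction hδ hW
  let T' : W →ₗ[k] M := T ∘ₗ W.subtype
  have hT' : ∀ w, δM (T' w) = T'.rTensor A (δ' w) := by
    intro w
    have := LinearMap.congr_fun hcomm w
    simp only [LinearMap.comp_apply, Submodule.subtype_apply] at this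
    rw [LinearMap.comp_apply, hT, Submodule.subtype_apply, ← this, LinearMap.rTensor_comp]
    rfl
  have hker : IsSubrep δ' (LinearMap.ker T') := by
    intro w hw
    have hex : Function.Exact (LinearMap.ker T').subtype T' := LinearMap.exact_subtype_ker_map T'
    refine (Module.Flat.rTensor_exact A hex (δ' w)).1 ?_
    rw [← hT', LinearMap.mem_ker.1 hw, map_zero]
  -- Complete reducibility splits off the kernel of `T'` on a finite-dimensional subrepresentation
  -- containing `n`. The component of `n` in the complement has the same image, and it is invariant
  -- because `T'` is injective and equivariant on the complement.
  obtain ⟨U, hU, hcompl⟩ := hred W δ' hδ' _ hker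
  obtain ⟨w0, hw0, w, hw, hsum⟩ :=
    Submodule.mem_sup.1 (hcompl.sup_eq_top ▸ Submodule.mem_top : (⟨n, hnW⟩ : W) ∈ _ ⊔ U)
  have hTw : T' w = T n := by
    have := congrArg T' hsum
    rw [map_add, LinearMap.mem_ker.1 hw0, zero_add] at this
    exact this
  have hinjU : Function.Injective ((T' ∘ₗ U.subtype).rTensor A) := by
    refine Module.Flat.rTensor_preserves_injective_linearMap _ ?_
    rw [← LinearMap.ker_eq_bot, LinearMap.ker_eq_bot']
    intro x hx
    have : (x : W) ∈ LinearMap.ker T' ⊓ U := ⟨hx, x.2⟩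
    rw [hcompl.inf_eq_bot] at this
    exact Subtype.ext this
  obtain ⟨t, ht⟩ := hU w hw
  have ht2 : t = (⟨w, hw⟩ : U) ⊗ₜ 1 := by
    apply hinjU
    rw [LinearMap.rTensor_comp, LinearMap.comp_apply, ht, ← hT', hTw, hn, ← hTw]
    simp
  refine ⟨w, hTw, ?_⟩
  have := LinearMap.congr_fun hcomm w
  simp only [LinearMap.comp_apply, Submodule.subtype_apply] at this
  rw [← this, ← ht, ht2]
  simp

end Comodule

/-! ### Conjugation as a right comodule structure -/

section CharacterScheme

variable (k A : Type u) [Field k] [CommRing A] [HopfAlgebra k A]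
  {α : Type} [DecidableEq α] [Fintype α] (rels : Set (FreeGroup α))

/-- The universal point of `H`, over `O(H)`, base changed to `A ⊗ S`. -/
abbrev ptLeft (S : Type u) [CommRing S] [Algebra k S] : Pt k A (A ⊗[k] S) :=
  toConv Algebra.TensorProduct.includeLeft

/-- The universal point of `H`, over `O(H)`, base changed to `S ⊗ A`. -/
abbrev ptRight (S : Type u) [CommRing S] [Algebra k S] : Pt k A (S ⊗[k] A) :=
  toConv Algebra.TensorProduct.includeRight

theorem mapPt_conjCoaction (γ : PresentedGroup rels) :
    mapPt (conjCoaction k A rels) (univRep k A rels γ) =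
      ptLeft k A _ * mapPt Algebra.TensorProduct.includeRight (univRep k A rels γ) *
        (ptLeft k A _)⁻¹ := by
  let ρ := (MulAut.conj (ptLeft k A (RepAlg k A rels))).toMonoidHom.comp
    ((mapPt Algebra.TensorProduct.includeRight).comp (univRep k A rels))
  have h : (mapPt (conjCoaction k A rels)).comp (univRep k A rels) = ρ := by
    rw [conjCoaction, RepAlg.mapPt_lift]
    exact PresentedGroup.ext fun a => PresentedGroup.toGroup.of _
  exact DFunLike.congr_fun h γ

/-- The coaction `O(hom(Γ, H)) → O(hom(Γ, H)) ⊗ O(H)` dual to `(ρ, g) ↦ g⁻¹ ρ g`. -/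
def rightCoaction : RepAlg k A rels →ₐ[k] RepAlg k A rels ⊗[k] A :=
  RepAlg.ofRep ((MulAut.conj (ptRight k A (RepAlg k A rels))⁻¹).toMonoidHom.comp
    ((mapPt Algebra.TensorProduct.includeLeft).comp (univRep k A rels)))

theorem mapPt_rightCoaction (γ : PresentedGroup rels) :
    mapPt (rightCoaction k A rels) (univRep k A rels γ) =
      (ptRight k A _)⁻¹ * mapPt Algebra.TensorProduct.includeLeft (univRep k A rels γ) *
        ptRight k A _ := by
  have h := DFunLike.congr_fun (RepAlg.mapPt_ofRep
    ((MulAut.conj (ptRight k A (RepAlg k A rels))⁻¹).toMonoidHom.comp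
      ((mapPt Algebra.TensorProduct.includeLeft).comp (univRep k A rels)))) γ
  refine h.trans ?_
  simp

/-- The comultiplication is the product of the two tautological points over `A ⊗ A`. Coassociativity
of the action thereby becomes a computation with group elements. -/
theorem comul_eq_mul : (toConv (Bialgebra.comulAlgHom k A) : Pt k A (A ⊗[k] A)) =
    ptLeft k A A * ptRight k A A := by
  have h := AlgHom.convMul_def (R := k) (ptLeft k A A) (ptRight k A A)
  rw [h]
  have : (Algebra.TensorProduct.lmul' k).comp (Algebra.TensorProduct.map (ptLeft k A A).ofConv
      (ptRight k A A).ofConv) = AlgHom.id k (A ⊗[k] A) := by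
    ext <;> simp
  refine pt_ext fun a => ?_
  exact (DFunLike.congr_fun this (Coalgebra.comul (R := k) a)).symm

/-- Homomorphisms out of `RepAlg` are determined by the universal representation, so the claim is
that conjugating by a product is conjugating twice. -/
theorem rightCoaction_coassoc :
    ((Algebra.TensorProduct.assoc k k k (RepAlg k A rels) A A).toAlgHom.comp
      (Algebra.TensorProduct.map (rightCoaction k A rels) (AlgHom.id k A))).comp
        (rightCoaction k A rels) =
    (Algebra.TensorProduct.map (AlgHom.id k (RepAlg k A rels)) (Bialgebra.comulAlgHom k A)).comp
      (rightCoaction k A rels) := by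
  refine RepAlg.algHom_ext fun a => ?_
  let R := RepAlg k A rels
  let F : R ⊗[k] A →ₐ[k] R ⊗[k] (A ⊗[k] A) :=
    (Algebra.TensorProduct.assoc k k k (RepAlg k A rels) A A).toAlgHom.comp
      (Algebra.TensorProduct.map (rightCoaction k A rels) (AlgHom.id k A))
  let F' : R ⊗[k] A →ₐ[k] R ⊗[k] (A ⊗[k] A) :=
    Algebra.TensorProduct.map (AlgHom.id k R) (Bialgebra.comulAlgHom k A)
  let J : R ⊗[k] A →ₐ[k] R ⊗[k] (A ⊗[k] A) :=
    Algebra.TensorProduct.map (AlgHom.id k R) Algebra.TensorProduct.includeLeft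
  let I : A ⊗[k] A →ₐ[k] R ⊗[k] (A ⊗[k] A) := Algebra.TensorProduct.includeRight
  have hF : F.comp Algebra.TensorProduct.includeLeft = J.comp (rightCoaction k A rels) := by
    refine AlgHom.ext fun r => ?_
    change Algebra.TensorProduct.assoc k k k R A A (rightCoaction k A rels r ⊗ₜ 1) =
      J (rightCoaction k A rels r)
    generalize rightCoaction k A rels r = t
    induction t with
    | zero => simp
    | add x y hx hy => rw [TensorProduct.add_tmul, map_add, map_add, hx, hy]
    | tmul x y => simp [J]
  have hF2 : mapPt F (ptRight k A R) = mapPt I (ptRight k A A) :=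
    pt_ext fun a => by
      change Algebra.TensorProduct.assoc k k k R A A (rightCoaction k A rels 1 ⊗ₜ a) =
        (1 : R) ⊗ₜ[k] ((1 : A) ⊗ₜ[k] a)
      rw [map_one]; rfl
  have hF3 : mapPt F' (ptRight k A R) = mapPt I (ptLeft k A A) * mapPt I (ptRight k A A) := by
    rw [← map_mul, ← comul_eq_mul]
    refine pt_ext fun a => ?_
    change Algebra.TensorProduct.map (AlgHom.id k R) (Bialgebra.comulAlgHom k A) (1 ⊗ₜ a) = _
    rw [Algebra.TensorProduct.map_tmul]; rfl
  have hF4 : F'.comp Algebra.TensorProduct.includeLeft = Algebra.TensorProduct.includeLeft := by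
    refine AlgHom.ext fun r => ?_
    change Algebra.TensorProduct.map (AlgHom.id k R) (Bialgebra.comulAlgHom k A) (r ⊗ₜ 1) = _
    rw [Algebra.TensorProduct.map_tmul, map_one]; rfl
  have hJ : J.comp Algebra.TensorProduct.includeLeft = Algebra.TensorProduct.includeLeft := by
    refine AlgHom.ext fun r => ?_
    change Algebra.TensorProduct.map (AlgHom.id k R) Algebra.TensorProduct.includeLeft (r ⊗ₜ 1) = _
    rw [Algebra.TensorProduct.map_tmul, map_one]; rfl
  have hJ2 : mapPt J (ptRight k A R) = mapPt I (ptLeft k A A) := rfl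
  change mapPt F (mapPt (rightCoaction k A rels) _) = mapPt F' (mapPt (rightCoaction k A rels) _)
  rw [mapPt_rightCoaction]
  simp only [map_mul, map_inv]
  rw [hF2, hF3, mapPt_mapPt, mapPt_mapPt, hF, hF4, ← mapPt_mapPt, mapPt_rightCoaction]
  simp only [map_mul, map_inv]
  rw [hJ2, mapPt_mapPt, hJ]
  group

theorem rightCoaction_counit :
    ((Algebra.TensorProduct.rid k k (RepAlg k A rels)).toAlgHom.comp
      (Algebra.TensorProduct.map (AlgHom.id k (RepAlg k A rels))
        (Bialgebra.counitAlgHom k A))).comp (rightCoaction k A rels) = AlgHom.id k _ := by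
  refine RepAlg.algHom_ext fun a => ?_
  let R := RepAlg k A rels
  let F : R ⊗[k] A →ₐ[k] R := (Algebra.TensorProduct.rid k k R).toAlgHom.comp
    (Algebra.TensorProduct.map (AlgHom.id k R) (Bialgebra.counitAlgHom k A))
  have hF : F.comp Algebra.TensorProduct.includeLeft = AlgHom.id k R := by
    refine AlgHom.ext fun r => ?_
    change Algebra.TensorProduct.rid k k R (Algebra.TensorProduct.map (AlgHom.id k R)
      (Bialgebra.counitAlgHom k A) (r ⊗ₜ 1)) = _
    rw [Algebra.TensorProduct.map_tmul, map_one]; simp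
  have hF2 : mapPt F (ptRight k A R) = 1 := pt_ext fun a => by
    change Algebra.TensorProduct.rid k k R (Algebra.TensorProduct.map (AlgHom.id k R)
      (Bialgebra.counitAlgHom k A) (1 ⊗ₜ a)) = algebraMap k R (Coalgebra.counit (R := k) a)
    rw [Algebra.TensorProduct.map_tmul]; simp [Algebra.algebraMap_eq_smul_one]
  change mapPt F (mapPt (rightCoaction k A rels) _) = _
  rw [mapPt_rightCoaction, map_mul, map_mul, map_inv, hF2, mapPt_mapPt, hF]
  simp [R]

theorem isCoaction_rightCoaction : IsCoaction (rightCoaction k A rels).toLinearMap := by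
  refine ⟨?_, ?_⟩
  · have := congrArg AlgHom.toLinearMap (rightCoaction_coassoc k A rels)
    refine Eq.trans ?_ (this.trans ?_) <;> rfl
  · have := congrArg AlgHom.toLinearMap (rightCoaction_counit k A rels)
    refine Eq.trans ?_ this
    rfl

variable {k A rels} in
-- The actions by `g` and by `g⁻¹` have the same invariants: the swap composed with the antipode, in
-- either direction, exchanges the two coactions.
theorem mem_invariants_iff (f : RepAlg k A rels) :
    f ∈ invariants k A rels ↔ rightCoaction k A rels f = f ⊗ₜ 1 := by
  let R := RepAlg k A rels
  let ap := HopfAlgebra.antipodeAlgHom k A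
  let sw : A ⊗[k] R →ₐ[k] R ⊗[k] A := (Algebra.TensorProduct.map (AlgHom.id k R) ap).comp
    (Algebra.TensorProduct.comm k A R).toAlgHom
  let sw' : R ⊗[k] A →ₐ[k] A ⊗[k] R := (Algebra.TensorProduct.comm k R A).toAlgHom.comp
    (Algebra.TensorProduct.map (AlgHom.id k R) ap)
  have h1 : sw.comp Algebra.TensorProduct.includeRight = Algebra.TensorProduct.includeLeft :=
    AlgHom.ext fun r => by
      change r ⊗ₜ ap 1 = _
      rw [map_one]; rfl
  have h2 : mapPt sw (ptLeft k A R) = (ptRight k A R)⁻¹ := rfl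
  have h1' : sw'.comp Algebra.TensorProduct.includeLeft = Algebra.TensorProduct.includeRight :=
    AlgHom.ext fun r => by
      change ap 1 ⊗ₜ r = _
      rw [map_one]; rfl
  have h2' : mapPt sw' (ptRight k A R) = (ptLeft k A R)⁻¹ := rfl
  have h3 : sw.comp (conjCoaction k A rels) = rightCoaction k A rels := by
    refine RepAlg.algHom_ext fun a => ?_
    rw [← mapPt_mapPt, mapPt_conjCoaction, mapPt_rightCoaction]
    simp only [map_mul, map_inv]
    rw [h2, mapPt_mapPt, h1, inv_inv]
  have h3' : sw'.comp (rightCoaction k A rels) = conjCoaction k A rels := by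
    refine RepAlg.algHom_ext fun a => ?_
    rw [← mapPt_mapPt, mapPt_conjCoaction, mapPt_rightCoaction]
    simp only [map_mul, map_inv]
    rw [h2', mapPt_mapPt, h1', inv_inv]
  have h4 : f ∈ invariants k A rels ↔ conjCoaction k A rels f = 1 ⊗ₜ f := Iff.rfl
  rw [h4]
  constructor
  · intro h
    rw [← h3, AlgHom.comp_apply, h]
    exact DFunLike.congr_fun h1 f
  · intro h
    rw [← h3', AlgHom.comp_apply, h]
    exact DFunLike.congr_fun h1' f

end CharacterScheme

/-! ### Comodules with a vector space of coefficients -/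

section TensorComodule

variable {k A : Type u} [Field k] [CommRing A] [HopfAlgebra k A]
  {M N : Type u} [AddCommGroup M] [Module k M] [AddCommGroup N] [Module k N]

theorem assoc_symm_tmul (a : M) (t : N ⊗[k] A) :
    (TensorProduct.assoc k M N A).symm (a ⊗ₜ t) = (TensorProduct.mk k M N a).rTensor A t := by
  induction t with
  | zero => rw [TensorProduct.tmul_zero, map_zero, map_zero]
  | add x y hx hy => rw [TensorProduct.tmul_add, map_add, map_add, hx, hy]
  | tmul x y => simp

variable (M) in
/-- The tensor product of a comodule with a vector space is a comodule. -/
theorem IsCoaction.tensor {rc : N →ₗ[k] N ⊗[k] A} (hrc : IsCoaction rc) :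
    IsCoaction (W := M ⊗[k] N)
      ((TensorProduct.assoc k M N A).symm.toLinearMap ∘ₗ rc.lTensor M) := by
  set δ : M ⊗[k] N →ₗ[k] (M ⊗[k] N) ⊗[k] A :=
    (TensorProduct.assoc k M N A).symm.toLinearMap ∘ₗ rc.lTensor M with hδdef
  let m : M → N →ₗ[k] M ⊗[k] N := fun a => TensorProduct.mk k M N a
  have hδm : ∀ a r, δ (a ⊗ₜ r) = (m a).rTensor A (rc r) := fun a r => assoc_symm_tmul a (rc r)
  refine ⟨?_, ?_⟩
  · refine TensorProduct.ext' fun a r => ?_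
    simp only [LinearMap.comp_apply, LinearEquiv.coe_coe, hδm]
    have h1 : ∀ t : N ⊗[k] A, TensorProduct.assoc k (M ⊗[k] N) A A
        (δ.rTensor A ((m a).rTensor A t)) = (m a).rTensor (A ⊗[k] A)
          (TensorProduct.assoc k N A A (rc.rTensor A t)) := by
      intro t
      induction t with
      | zero => simp
      | add x y hx hy => simp only [map_add, hx, hy]
      | tmul x y =>
        rw [LinearMap.rTensor_tmul, LinearMap.rTensor_tmul, LinearMap.rTensor_tmul]
        change TensorProduct.assoc k (M ⊗[k] N) A A (δ (a ⊗ₜ x) ⊗ₜ[k] y) = _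
        rw [hδm]
        generalize rc x = s
        induction s with
        | zero => simp
        | add x y hx hy => simp only [map_add, TensorProduct.add_tmul, hx, hy]
        | tmul c d => simp
    have h2 := LinearMap.congr_fun hrc.coassoc r
    simp only [LinearMap.comp_apply, LinearEquiv.coe_coe] at h2
    rw [h1, h2]
    exact LinearMap.congr_fun ((LinearMap.rTensor_comp_lTensor ..).trans
      (LinearMap.lTensor_comp_rTensor ..).symm) (rc r)
  · refine TensorProduct.ext' fun a r => ?_
    simp only [LinearMap.comp_apply, LinearEquiv.coe_coe, hδm, LinearMap.id_apply]
    have h2 := LinearMap.congr_fun hrc.counit r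
    simp only [LinearMap.comp_apply, LinearEquiv.coe_coe, LinearMap.id_apply] at h2
    conv_rhs => rw [← h2]
    change _ = m a _
    generalize rc r = t
    induction t with
    | zero => simp
    | add x y hx hy => simp only [map_add, hx, hy]
    | tmul x y => simp

/-- Invariants are the kernel of `rc - (· ⊗ 1)`, and tensoring with the flat module `M` preserves
kernels; so the invariants of `M ⊗ N` are `M ⊗ N^H`. -/
theorem exists_of_tensor_invariant {rc : N →ₗ[k] N ⊗[k] A} {w : M ⊗[k] N}
    (hw : (TensorProduct.assoc k M N A).symm (rc.lTensor M w) = w ⊗ₜ 1) :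
    ∃ w', (LinearMap.ker (rc - (TensorProduct.mk k N A).flip 1)).subtype.lTensor M w' = w := by
  let D : N →ₗ[k] N ⊗[k] A := rc - (TensorProduct.mk k N A).flip 1
  have h1 : ∀ t : M ⊗[k] N, (TensorProduct.assoc k M N A).symm (D.lTensor M t) =
      (TensorProduct.assoc k M N A).symm (rc.lTensor M t) - t ⊗ₜ[k] (1 : A) := by
    intro t
    induction t with
    | zero => simp
    | add x y hx hy =>
      simp only [map_add, hx, hy, TensorProduct.add_tmul]; abel
    | tmul x y =>
      rw [LinearMap.lTensor_tmul, LinearMap.sub_apply, TensorProduct.tmul_sub, map_sub]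
      rfl
  have h2 : D.lTensor M w = 0 := by
    rw [← (TensorProduct.assoc k M N A).symm.map_eq_zero_iff, h1, hw, sub_self]
  exact (Module.Flat.lTensor_exact M (LinearMap.exact_subtype_ker_map D) w).1 h2

end TensorComodule

/-! ### Surjectivity onto the character scheme and descent of idempotents -/

section CharacterScheme

variable (k A : Type u) [Field k] [CommRing A] [HopfAlgebra k A]
  {α : Type} [DecidableEq α] [Fintype α] (rels : Set (FreeGroup α))

variable {k A} in
-- The multiplication map `p ⊗ R → R` is equivariant with image `pR`. An invariant element of `pR`
-- lifts to an invariant of `p ⊗ R`, hence to `p ⊗ R^H`, and multiplying out lands in `p`.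
theorem IsReductive.comap_map_invariants (hred : IsReductive k A)
    (p : Ideal (invariants k A rels)) {f : invariants k A rels}
    (hf : (f : RepAlg k A rels) ∈ p.map (invariants k A rels).val) : f ∈ p := by
  let R := RepAlg k A rels
  let rc : R →ₗ[k] R ⊗[k] A := (rightCoaction k A rels).toLinearMap
  have hrc : IsCoaction rc := isCoaction_rightCoaction k A rels
  let P : Submodule k (invariants k A rels) := p.restrictScalars k
  let ι : P →ₗ[k] R := (invariants k A rels).val.toLinearMap ∘ₗ P.subtype
  let T : P ⊗[k] R →ₗ[k] R := TensorProduct.lift (LinearMap.mul k R ∘ₗ ι)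
  have hT : ∀ a r, T (a ⊗ₜ r) = ι a * r := fun a r => TensorProduct.lift.tmul a r
  let m : P → R →ₗ[k] P ⊗[k] R := fun a => TensorProduct.mk k P R a
  let δ : P ⊗[k] R →ₗ[k] (P ⊗[k] R) ⊗[k] A :=
    (TensorProduct.assoc k P R A).symm.toLinearMap ∘ₗ rc.lTensor P
  have hδm : ∀ a r, δ (a ⊗ₜ r) = (m a).rTensor A (rc r) := fun a r =>
    assoc_symm_tmul (A := A) a (rc r)
  have hδ : IsCoaction (W := P ⊗[k] R) δ := hrc.tensor P
  have hTeq : ∀ n, rc (T n) = T.rTensor A (δ n) := by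
    intro n
    induction n with
    | zero => simp
    | add x y hx hy => simp only [map_add, hx, hy]
    | tmul a r =>
      rw [hT, hδm]
      have h1 : rc (ι a) = ι a ⊗ₜ 1 := (mem_invariants_iff _).1 a.1.2
      have h2 : rc (ι a * r) = rc (ι a) * rc r := map_mul (rightCoaction k A rels) _ _
      rw [h2, h1]
      generalize rc r = t
      induction t with
      | zero => simp
      | add x y hx hy => simp only [map_add, mul_add, hx, hy]
      | tmul x y => simp [m, hT]
  have hsurj : ∀ x ∈ p.map (invariants k A rels).val, ∃ n, T n = x := by
    intro x hx
    refine Submodule.span_induction ?_ ⟨0, map_zero _⟩ ?_ ?_ hx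
    · rintro _ ⟨a, ha, rfl⟩
      exact ⟨(⟨a, ha⟩ : P) ⊗ₜ 1, (hT _ _).trans (mul_one _)⟩
    · rintro _ _ _ _ ⟨n, rfl⟩ ⟨n', rfl⟩
      exact ⟨n + n', map_add _ _ _⟩
    · rintro r _ - ⟨n, rfl⟩
      refine ⟨(LinearMap.mulLeft k r).lTensor P n, ?_⟩
      induction n with
      | zero => simp
      | add x y hx hy => simp only [map_add, smul_add, hx, hy]
      | tmul a s =>
        rw [LinearMap.lTensor_tmul, hT, hT, LinearMap.mulLeft_apply, smul_eq_mul]; ring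
  obtain ⟨n, hn⟩ := hsurj _ hf
  obtain ⟨w, hw, hinv⟩ := hred.exists_invariant_lift hδ hTeq (n := n) (by
    rw [hn]; exact (mem_invariants_iff _).1 f.2)
  let D : R →ₗ[k] R ⊗[k] A := rc - (TensorProduct.mk k R A).flip 1
  obtain ⟨w', rfl⟩ := exists_of_tensor_invariant hinv
  have hmem : ∀ w' : P ⊗[k] LinearMap.ker D,
      ∃ b ∈ p, T ((LinearMap.ker D).subtype.lTensor P w') = ((b : invariants k A rels) : R) := by
    intro w'
    induction w' with
    | zero => exact ⟨0, p.zero_mem, by simp⟩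
    | add x y hx hy =>
      obtain ⟨b, hb, hb'⟩ := hx
      obtain ⟨c, hc, hc'⟩ := hy
      exact ⟨b + c, p.add_mem hb hc, by rw [map_add, map_add, hb', hc']; rfl⟩
    | tmul a r =>
      have hr : (r : R) ∈ invariants k A rels :=
        (mem_invariants_iff _).2 (sub_eq_zero.1 r.2)
      exact ⟨a * ⟨r, hr⟩, p.mul_mem_right _ a.2, by
        rw [LinearMap.lTensor_tmul, hT]; rfl⟩
  obtain ⟨b, hb, hb'⟩ := hmem w'
  rw [hw, hn] at hb'
  rwa [Subtype.ext hb']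

variable {k A} in
-- A prime lies in the image of the map on spectra as soon as extending and contracting gives it
-- back.
theorem IsReductive.toChar_surjective (hred : IsReductive k A) :
    Function.Surjective (toChar k A rels) := by
  have h : ∀ p : PrimeSpectrum (invariants k A rels),
      p ∈ Set.range (PrimeSpectrum.comap (invariants k A rels).val.toRingHom) := fun p => by
    rw [PrimeSpectrum.mem_range_comap_iff]
    refine le_antisymm (fun f hf => ?_) Ideal.le_comap_map
    exact hred.comap_map_invariants rels p.asIdeal hf
  exact h

theorem conj_injLocus (𝓔 : Set (Subgroup (PresentedGroup rels)))
    (y : PrimeSpectrum (A ⊗[k] RepAlg k A rels)) :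
    PrimeSpectrum.comap (conjCoaction k A rels).toRingHom y ∈ injLocus k A rels 𝓔 ↔
      PrimeSpectrum.comap (Algebra.TensorProduct.includeRight :
        RepAlg k A rels →ₐ[k] A ⊗[k] RepAlg k A rels).toRingHom y ∈ injLocus k A rels 𝓔 := by
  rw [mem_injLocus_iff, mem_injLocus_iff]
  refine forall₄_congr fun K _ γ _ => imp_congr_left ?_
  have h : ∀ f : RepAlg k A rels →ₐ[k] A ⊗[k] RepAlg k A rels,
      dispIdeal (univRep k A rels γ) ≤ (PrimeSpectrum.comap f.toRingHom y).asIdeal ↔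
        dispIdeal (mapPt f (univRep k A rels γ)) ≤ y.asIdeal := fun f => by
    rw [dispIdeal_mapPt, Ideal.map_le_iff_le_comap]; rfl
  rw [h, h, mapPt_conjCoaction, dispIdeal_conj]

variable {k A} in
theorem IsReductive.isClopen_image_injLocus (hred : IsReductive k A)
    {𝓔 : Set (Subgroup (PresentedGroup rels))} (h : IsClopen (injLocus k A rels 𝓔)) :
    IsClopen (toChar k A rels '' (injLocus k A rels 𝓔)) := by
  obtain ⟨e, he, heq⟩ := PrimeSpectrum.exists_idempotent_basicOpen_eq_of_isClopen h
  -- The two pullbacks of `e` to `A ⊗ RepAlg` are idempotents with the same basic open set, by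
  -- `conj_injLocus`. They therefore coincide, so `e` descends to the invariants.
  have hinv : conjCoaction k A rels e = (Algebra.TensorProduct.includeRight :
        RepAlg k A rels →ₐ[k] A ⊗[k] RepAlg k A rels) e := by
    refine PrimeSpectrum.basicOpen_injOn_isIdempotentElem (he.map _) (he.map _) ?_
    refine TopologicalSpace.Opens.ext (Set.ext fun y => ?_)
    have h1 := conj_injLocus k A rels 𝓔 y
    rw [heq] at h1
    exact h1
  let e' : invariants k A rels := ⟨e, hinv⟩
  have he' : IsIdempotentElem e' := Subtype.ext he
  have himg : toChar k A rels '' (injLocus k A rels 𝓔) =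
      (PrimeSpectrum.basicOpen e' : Set (PrimeSpectrum (invariants k A rels))) := by
    rw [heq]
    ext p
    constructor
    · rintro ⟨x, hx, rfl⟩
      exact hx
    · intro hp
      obtain ⟨x, rfl⟩ := hred.toChar_surjective rels p
      exact ⟨x, hp, rfl⟩
  rw [himg]
  exact PrimeSpectrum.isClopen_iff_mul_add.2
    ⟨e', 1 - e', by rw [mul_sub, mul_one, he'.eq, sub_self], by ring, rfl⟩

end CharacterScheme

theorem isClopenSubscheme_of_isClopen {X : Scheme.{u}} {Z : Set X} (h : IsClopen Z) :
    IsClopenSubscheme Z :=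
  ⟨⟨Z, h.2⟩, rfl, IsClosedImmersion.of_isPreimmersion _ (by
    rw [Scheme.Opens.range_ι]; exact h.1)⟩

theorem clopen_part {V : Type} [Fintype V] [DecidableEq V] {Δ : SimpleGraph V}
    (m : Δ.edgeSet → ℕ) (k A : Type u) [Field k] [CharZero k] [CommRing A] [HopfAlgebra k A]
    [Algebra.FiniteType k A] :
    IsClopenSubscheme (coxHomO m k A : Set (Hom k A (coxRels m))) ∧
    IsClopenSubscheme (extHomO m k A : Set (Hom k A (extRels m))) ∧
    (IsReductive k A →
      IsClopenSubscheme (coxCharO m k A) ∧ IsClopenSubscheme (extCharO m k A)) := by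
  have h1 := isClopen_injLocus k A (coxRels m) _ (coxElementary_finite m) fun _ h => h.1
  have h2 := isClopen_injLocus k A (extRels m) _ (extElementary_finite m) fun _ h => h.1
  exact ⟨isClopenSubscheme_of_isClopen h1, isClopenSubscheme_of_isClopen h2, fun hred =>
    ⟨isClopenSubscheme_of_isClopen (hred.isClopen_image_injLocus _ h1),
      isClopenSubscheme_of_isClopen (hred.isClopen_image_injLocus _ h2)⟩⟩

/-! ### Even Coxeter groups and their extensions -/

section Groups

theorem altWord_two_mul {G : Type} [Group G] (a b : G) (n : ℕ) :
    altWord a b (2 * n) = (a * b) ^ n := by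
  induction n with
  | zero => simp [altWord]
  | succ n ih =>
    rw [show 2 * (n + 1) = 2 * n + 1 + 1 by ring, altWord, altWord, ih, ← mul_assoc, pow_succ']

/-- Conjugation by `a` inverts `a * b`, so every element has the form `(a * b) ^ i * a ^ j`, with
`i` taken modulo `n` and `j` modulo `2`. -/
theorem finite_closure_pair {G : Type*} [Group G] {a b : G} (ha : a ^ 2 = 1) (hb : b ^ 2 = 1)
    {n : ℕ} (hn : 0 < n) (hab : (a * b) ^ n = 1) : Finite (Subgroup.closure {a, b}) := by
  have hai : a⁻¹ = a := inv_eq_of_mul_eq_one_left (by rw [← sq, ha])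
  have hbi : b⁻¹ = b := inv_eq_of_mul_eq_one_left (by rw [← sq, hb])
  have hconj : ∀ i : ℤ, a * (a * b) ^ i = (a * b) ^ (-i) * a := by
    intro i
    have h1 : a * (a * b) * a⁻¹ = (a * b)⁻¹ := by
      rw [mul_inv_rev, hai, hbi]
      rw [← mul_assoc, ← sq, ha, one_mul]
    have h2 : a * (a * b) ^ i * a⁻¹ = (a * b) ^ (-i) := by
      rw [← conj_zpow, h1, inv_zpow, zpow_neg]
    rw [← h2]; group
  have hb2 : b = a * (a * b) := by rw [← mul_assoc, ← sq, ha, one_mul]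
  let K : Subgroup G :=
    { carrier := {x | ∃ i j : ℤ, x = (a * b) ^ i * a ^ j}
      one_mem' := ⟨0, 0, by simp⟩
      mul_mem' := by
        have haj : ∀ (j i : ℤ), ∃ i' : ℤ, a ^ j * (a * b) ^ i = (a * b) ^ i' * a ^ j := by
          intro j i
          obtain ⟨c, rfl | rfl⟩ := Int.even_or_odd' j
          · exact ⟨i, by rw [zpow_mul, zpow_ofNat, ha]; simp⟩
          · exact ⟨-i, by
              rw [zpow_add, zpow_mul, zpow_ofNat, ha, one_zpow, one_mul, zpow_one, hconj]⟩
        rintro _ _ ⟨i, j, rfl⟩ ⟨i', j', rfl⟩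
        obtain ⟨l, hl⟩ := haj j i'
        exact ⟨i + l, j + j', by
          rw [zpow_add, zpow_add, mul_assoc, ← mul_assoc (a ^ j), hl]; group⟩
      inv_mem' := by
        rintro _ ⟨i, j, rfl⟩
        obtain ⟨c, rfl | rfl⟩ := Int.even_or_odd' j
        · exact ⟨-i, 0, by rw [zpow_mul, zpow_ofNat, ha]; simp⟩
        · exact ⟨i, 1, by
            rw [zpow_add, zpow_mul, zpow_ofNat, ha, one_zpow, one_mul, zpow_one, mul_inv_rev, hai,
              ← zpow_neg, hconj, neg_neg]⟩ }
  have hle : Subgroup.closure {a, b} ≤ K := by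
    rw [Subgroup.closure_le]
    rintro x (rfl | rfl)
    · exact ⟨0, 1, by simp⟩
    · exact ⟨-1, 1, by rw [zpow_one, ← hconj, zpow_one, ← hb2]⟩
  have hfin : ((fun p : ℕ × ℕ => (a * b) ^ p.1 * a ^ p.2) ''
      (Set.Iio n ×ˢ Set.Iio 2)).Finite :=
    ((Set.finite_Iio n).prod (Set.finite_Iio 2)).image _
  refine hfin.subset fun x hx => ?_
  obtain ⟨i, j, rfl⟩ := hle hx
  have hpow : ∀ (g : G) (n : ℕ), 0 < n → g ^ n = 1 → ∀ i : ℤ, ∃ l < n, g ^ i = g ^ l := by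
    intro g n hn hg i
    refine ⟨(i % n).toNat, ?_, ?_⟩
    · have := Int.emod_lt_of_pos i (Int.natCast_pos.2 hn)
      have := Int.emod_nonneg i (Int.natCast_pos.2 hn).ne'
      omega
    · rw [← zpow_natCast, Int.toNat_of_nonneg (Int.emod_nonneg i (Int.natCast_pos.2 hn).ne')]
      conv_lhs => rw [← Int.emod_add_mul_ediv i n]
      rw [zpow_add, zpow_mul, zpow_natCast, hg, one_zpow, mul_one]
  obtain ⟨i', hi', e1⟩ := hpow _ n hn hab i
  obtain ⟨j', hj', e2⟩ := hpow _ 2 two_pos ha j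
  exact ⟨(i', j'), ⟨hi', hj'⟩, by rw [e1, e2]⟩

variable {V : Type} {Δ : SimpleGraph V} {m : Δ.edgeSet → ℕ}

/-- The generator `g_v` of the Coxeter group. -/
abbrev CoxGroup.g (m : Δ.edgeSet → ℕ) (v : V) : CoxGroup m := PresentedGroup.of v

/-- The generator `g_v` of the extended Coxeter group. -/
abbrev ExtGroup.g (m : Δ.edgeSet → ℕ) (v : V) : ExtGroup m := PresentedGroup.of (some v)

/-- The generator `z` of the extended Coxeter group. -/
abbrev ExtGroup.z (m : Δ.edgeSet → ℕ) : ExtGroup m := PresentedGroup.of none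

theorem CoxGroup.g_sq (v : V) : CoxGroup.g m v ^ 2 = 1 := by
  have := PresentedGroup.one_of_mem (rels := coxRels m) (CoxRel.sq v)
  rwa [map_pow] at this

theorem ExtGroup.z_sq : ExtGroup.z m ^ 2 = 1 := by
  have := PresentedGroup.one_of_mem (rels := extRels m) ExtRel.z_sq
  rwa [map_pow] at this

theorem ExtGroup.g_sq (v : V) : ExtGroup.g m v ^ 2 = ExtGroup.z m := by
  have := PresentedGroup.one_of_mem (rels := extRels m) (ExtRel.sq v)
  rwa [map_mul, map_inv, map_pow, mul_inv_eq_one] at this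

theorem ExtGroup.g_comm (v : V) : ExtGroup.g m v * ExtGroup.z m = ExtGroup.z m * ExtGroup.g m v := by
  have := PresentedGroup.one_of_mem (rels := extRels m) (ExtRel.comm v)
  rwa [map_mul, map_mul, map_mul, map_inv, map_inv, mul_inv_eq_one, mul_inv_eq_iff_eq_mul] at this

/-- With `z = 1` this is the dihedral identity for involutions. In the extension the two factors `z`
coming from `a` and `b` cancel. -/
theorem sq_eq_inv_mul_of_central {G : Type*} [Group G] {a b z : G} (ha : a ^ 2 = z) (hb : b ^ 2 = z)
    (hz : z ^ 2 = 1) (hbz : b * z = z * b) : b * a = (a * b)⁻¹ := by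
  have hai : a = a⁻¹ * z := by rw [← ha]; group
  have hbi : b = b⁻¹ * z := by rw [← hb]; group
  have hbz' : z * b⁻¹ = b⁻¹ * z := (Commute.inv_left (show Commute b z from hbz)).symm
  rw [mul_inv_rev]
  have haz : z * a⁻¹ = a⁻¹ * z := by
    have : Commute (a ^ 2) a⁻¹ := (Commute.pow_self a 2).inv_right
    rwa [ha] at this
  calc b * a = b⁻¹ * z * (a⁻¹ * z) := by rw [← hai, ← hbi]
    _ = b⁻¹ * a⁻¹ * z ^ 2 := by
      rw [mul_assoc, ← mul_assoc z, haz, sq]; group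
    _ = _ := by rw [hz, mul_one]

theorem CoxGroup.mul_pow (hm : ∀ e, 0 < m e ∧ Even (m e)) {v w : V} (h : Δ.Adj v w) :
    (CoxGroup.g m v * CoxGroup.g m w) ^ m ⟨s(v, w), h⟩ = 1 := by
  have := PresentedGroup.one_of_mem (rels := coxRels m) (CoxRel.edge v w h)
  obtain ⟨n, hn⟩ := even_iff_exists_two_mul.1 (hm ⟨s(v, w), h⟩).2
  rw [hn, altWord_two_mul, altWord_two_mul] at this
  rw [map_mul, map_inv, map_pow, map_pow, map_mul, map_mul, mul_inv_eq_one] at this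
  change (CoxGroup.g m v * CoxGroup.g m w) ^ n = (CoxGroup.g m w * CoxGroup.g m v) ^ n at this
  rw [sq_eq_inv_mul_of_central (z := 1) (CoxGroup.g_sq v) (CoxGroup.g_sq w) (one_pow _)
    (by simp), inv_pow] at this
  rw [hn, two_mul, pow_add, ← mul_inv_eq_one.2 this, inv_inv]

/-- For `m = 2n` the relator says `(ab) ^ n = z ^ (2n + 1) (ba) ^ n = z (ab) ^ (-n)`. -/
theorem ExtGroup.mul_pow (hm : ∀ e, 0 < m e ∧ Even (m e)) {v w : V} (h : Δ.Adj v w) :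
    (ExtGroup.g m v * ExtGroup.g m w) ^ m ⟨s(v, w), h⟩ = ExtGroup.z m := by
  have := PresentedGroup.one_of_mem (rels := extRels m) (ExtRel.edge v w h)
  obtain ⟨n, hn⟩ := even_iff_exists_two_mul.1 (hm ⟨s(v, w), h⟩).2
  rw [hn, altWord_two_mul, altWord_two_mul] at this
  rw [map_mul, map_inv, map_mul, map_pow, map_pow, map_pow, map_mul, map_mul, mul_inv_eq_one] at this
  change (ExtGroup.g m v * ExtGroup.g m w) ^ n =
    ExtGroup.z m ^ (2 * n + 1) * (ExtGroup.g m w * ExtGroup.g m v) ^ n at this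
  rw [sq_eq_inv_mul_of_central (ExtGroup.g_sq v) (ExtGroup.g_sq w) ExtGroup.z_sq
    (ExtGroup.g_comm w), inv_pow, pow_succ, pow_mul, ExtGroup.z_sq, one_pow, one_mul,
    eq_mul_inv_iff_mul_eq] at this
  rw [hn, two_mul, pow_add, this]

theorem CoxGroup.exists_hom {H : Type*} [Group H] (hm : ∀ e, 0 < m e ∧ Even (m e)) (f : V → H)
    (h2 : ∀ v, f v ^ 2 = 1) (he : ∀ v w (h : Δ.Adj v w), (f v * f w) ^ m ⟨s(v, w), h⟩ = 1) :
    ∃ ρ : CoxGroup m →* H, ∀ v, ρ (CoxGroup.g m v) = f v := by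
  refine ⟨PresentedGroup.toGroup (f := f) ?_, fun v => PresentedGroup.toGroup.of _⟩
  intro r hr
  cases hr with
  | sq v => simp [h2]
  | edge v w h =>
    have he := he v w h
    obtain ⟨n, hn⟩ := even_iff_exists_two_mul.1 (hm ⟨s(v, w), h⟩).2
    rw [hn, two_mul, pow_add] at he
    rw [hn, altWord_two_mul, altWord_two_mul]
    simp only [map_mul, map_inv, map_pow, FreeGroup.lift_apply_of]
    rw [sq_eq_inv_mul_of_central (h2 v) (h2 w) (one_pow _) (by simp), inv_pow, inv_inv, he]

theorem ExtGroup.exists_hom {H : Type*} [Group H] (hm : ∀ e, 0 < m e ∧ Even (m e)) (f : V → H)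
    (z : H) (hz : z ^ 2 = 1) (hc : ∀ v, f v * z = z * f v)
    (h2 : ∀ v, f v ^ 2 = z) (he : ∀ v w (h : Δ.Adj v w), (f v * f w) ^ m ⟨s(v, w), h⟩ = z) :
    ∃ ρ : ExtGroup m →* H, ρ (ExtGroup.z m) = z ∧ ∀ v, ρ (ExtGroup.g m v) = f v := by
  refine ⟨PresentedGroup.toGroup (f := fun o => o.elim z f) ?_, PresentedGroup.toGroup.of _,
    fun v => PresentedGroup.toGroup.of _⟩
  intro r hr
  cases hr with
  | z_sq => simp [hz]
  | comm v => simp [hc]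
  | sq v => simp [h2]
  | edge v w h =>
    have he := he v w h
    obtain ⟨n, hn⟩ := even_iff_exists_two_mul.1 (hm ⟨s(v, w), h⟩).2
    rw [hn, two_mul, pow_add] at he
    rw [hn, altWord_two_mul, altWord_two_mul]
    simp only [map_mul, map_inv, map_pow, FreeGroup.lift_apply_of, Option.elim]
    rw [sq_eq_inv_mul_of_central (h2 v) (h2 w) hz (hc w), inv_pow, pow_succ, pow_mul, hz, one_pow,
      one_mul, mul_inv_rev, inv_inv, ← mul_assoc, he, mul_inv_cancel]

/-- Detected by the sign character, which sends every generator to the nonzero element of `ℤ/2`. -/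
theorem CoxGroup.g_ne_one (hm : ∀ e, 0 < m e ∧ Even (m e)) (v : V) : CoxGroup.g m v ≠ 1 := by
  have hsq : ∀ x : Multiplicative (ZMod 2), x ^ 2 = 1 := by decide
  obtain ⟨ρ, hρ⟩ := CoxGroup.exists_hom hm (fun _ : V => Multiplicative.ofAdd (1 : ZMod 2))
    (fun _ => hsq _) fun v w h => by
      obtain ⟨n, hn⟩ := even_iff_exists_two_mul.1 (hm ⟨s(v, w), h⟩).2
      rw [hn, pow_mul, hsq, one_pow]
  intro h
  have := hρ v
  rw [h, map_one] at this
  exact absurd this (by decide)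

/-- Since all labels are even, every generator other than `g_v` and `g_w` may be sent to `1`. This
maps `Γ` to the dihedral group in which `g_v g_w` becomes a rotation of order exactly `2n`. -/
theorem CoxGroup.mul_pow_half_ne_one (hm : ∀ e, 0 < m e ∧ Even (m e)) {v w : V} (h : Δ.Adj v w)
    {n : ℕ} (hn : m ⟨s(v, w), h⟩ = 2 * n) : (CoxGroup.g m v * CoxGroup.g m w) ^ n ≠ 1 := by
  classical
  have hn0 : 0 < n := by have := (hm ⟨s(v, w), h⟩).1; omega
  let f : V → DihedralGroup (2 * n) := fun x =>
    if x = v then .sr 0 else if x = w then .sr 1 else 1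
  have hsq : ∀ x, f x ^ 2 = 1 := by
    intro x
    simp only [f]
    split_ifs <;> simp [sq]
  have hfv : f v = .sr 0 := if_pos rfl
  have hfw : f w = .sr 1 := by simp [f, h.ne']
  have hvw : f v * f w = .r 1 := by simp [hfv, hfw]
  obtain ⟨ρ, hρ⟩ := CoxGroup.exists_hom hm f hsq fun x y hxy => by
    obtain ⟨l, hl⟩ := even_iff_exists_two_mul.1 (hm ⟨s(x, y), hxy⟩).2
    have hone : ∀ {a b : DihedralGroup (2 * n)}, a ^ 2 = 1 → b ^ 2 = 1 → (a = 1 ∨ b = 1) →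
        (a * b) ^ m ⟨s(x, y), hxy⟩ = 1 := by
      rintro a b ha hb (rfl | rfl)
      · rw [one_mul, hl, pow_mul, hb, one_pow]
      · rw [mul_one, hl, pow_mul, ha, one_pow]
    by_cases hx : x = v ∨ x = w
    · by_cases hy : y = v ∨ y = w
      · have key : ∀ (e : Δ.edgeSet), e = ⟨s(v, w), h⟩ → m e = 2 * n := by rintro _ rfl; exact hn
        rcases hx with rfl | rfl <;> rcases hy with rfl | rfl
        · exact absurd rfl hxy.ne
        · rw [key _ rfl, hvw]; simp
        · rw [key _ (Subtype.ext Sym2.eq_swap)]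
          rw [sq_eq_inv_mul_of_central (hsq y) (hsq x) (one_pow _) (by simp), hvw]; simp
        · exact absurd rfl hxy.ne
      · exact hone (hsq x) (hsq y) (Or.inr (by simp only [f]; aesop))
    · exact hone (hsq x) (hsq y) (Or.inl (by simp only [f]; aesop))
  intro h1
  have h2 := congrArg ρ h1
  rw [map_pow, map_mul, hρ, hρ, hvw, map_one, DihedralGroup.r_one_pow, DihedralGroup.one_def,
    DihedralGroup.r.injEq, ZMod.natCast_eq_zero_iff] at h2
  have := Nat.le_of_dvd hn0 h2
  omega

end Groups

/-! ### The kernel of the projection and elementary subgroups -/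

section CentralElement

theorem piTensorProduct_nontrivial {ι : Type} [Fintype ι] :
    Nontrivial (⨂[ℂ] _ : ι, Fin 2 → ℂ) := by
  let L : (⨂[ℂ] _ : ι, Fin 2 → ℂ) →ₗ[ℂ] ℂ := PiTensorProduct.lift
    ((MultilinearMap.mkPiAlgebra ℂ ι ℂ).compLinearMap fun _ => LinearMap.proj 0)
  refine ⟨PiTensorProduct.tprod ℂ fun _ _ => 1, 0, fun h => ?_⟩
  have h2 := congrArg L h
  rw [map_zero, PiTensorProduct.lift.tprod] at h2
  simp at h2

/-- Two reflections whose product is `diag(ζ, ζ⁻¹)` with `ζ ^ n = -1`. The last equation is needed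
because an edge comes with no preferred order of its ends. -/
theorem exists_dihedral_pair {n : ℕ} (hn : 0 < n) : ∃ a b : Module.End ℂ (Fin 2 → ℂ),
    a ^ 2 = 1 ∧ b ^ 2 = 1 ∧ (a * b) ^ n = -1 ∧ (b * a) ^ n = -1 := by
  obtain ⟨ζ, hζ⟩ := IsAlgClosed.exists_pow_nat_eq (-1 : ℂ) hn
  have h0 : ζ ≠ 0 := by
    rintro rfl
    rw [zero_pow hn.ne'] at hζ
    norm_num at hζ
  let f := Matrix.toLinAlgEquiv' (R := ℂ) (n := Fin 2)
  have h1 : ∀ t s : ℂ, (!![t, 0; 0, s] : Matrix (Fin 2) (Fin 2) ℂ) ^ n = !![t ^ n, 0; 0, s ^ n] := by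
    intro t s
    have := Matrix.diagonal_pow (![t, s]) n
    rw [Matrix.diagonal_fin_two, Matrix.diagonal_fin_two] at this
    simpa using this
  have hneg : (!![-1, 0; 0, -1] : Matrix (Fin 2) (Fin 2) ℂ) = -1 := by
    ext i j; fin_cases i <;> fin_cases j <;> simp
  have hone : (!![1, 0; 0, 1] : Matrix (Fin 2) (Fin 2) ℂ) = 1 := Matrix.one_fin_two.symm
  have hζi : (ζ⁻¹) ^ n = -1 := by rw [inv_pow, hζ]; norm_num
  refine ⟨f !![0, 1; 1, 0], f !![0, ζ⁻¹; ζ, 0], ?_, ?_, ?_, ?_⟩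
  · rw [← map_pow, sq, Matrix.mul_fin_two]; simp [hone]
  · rw [← map_pow, sq, Matrix.mul_fin_two]; simp [hone, h0]
  · rw [← map_mul, ← map_pow, Matrix.mul_fin_two]
    simp only [zero_mul, one_mul, mul_zero, zero_add, add_zero]
    rw [h1, hζ, hζi, hneg, map_neg, map_one]
  · rw [← map_mul, ← map_pow, Matrix.mul_fin_two]
    simp only [mul_one, mul_zero, zero_add, add_zero]
    rw [h1, hζ, hζi, hneg, map_neg, map_one]

/-- In the tensor product over `ι`, a sign in any single factor becomes a global sign. This lets all
edges share one central element. -/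
theorem exists_tensor_rep (ι : Type) [Fintype ι] [DecidableEq ι] :
    ∃ (T : Type) (_ : AddCommGroup T) (_ : Module ℂ T) (_ : Nontrivial T)
      (Φ : (ι → Module.End ℂ (Fin 2 → ℂ)) →* Module.End ℂ T),
      ∀ i, Φ (Function.update (1 : ι → Module.End ℂ (Fin 2 → ℂ)) i (-1)) = -1 := by
  refine ⟨⨂[ℂ] _ : ι, Fin 2 → ℂ, inferInstance, inferInstance, piTensorProduct_nontrivial,
    PiTensorProduct.mapMonoidHom, fun i => PiTensorProduct.ext (MultilinearMap.ext fun x => ?_)⟩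
  refine (PiTensorProduct.map_tprod _ x).trans ?_
  have h : (fun j => Function.update (1 : ι → Module.End ℂ (Fin 2 → ℂ)) i (-1) j (x j)) =
      Function.update x i (-x i) := by
    ext1 j
    by_cases hj : j = i
    · subst hj; simp
    · simp [Function.update_of_ne hj]
  rw [h, MultilinearMap.map_update_neg, Function.update_eq_self]
  rfl

variable {V : Type} {Δ : SimpleGraph V} {m : Δ.edgeSet → ℕ}

/-- A representation with `z ↦ -1`. Each edge contributes a tensor factor `ℂ²` in which its two ends
act by a pair from `exists_dihedral_pair`, all other vertices acting trivially there. -/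
theorem ExtGroup.z_ne_one [Fintype V] (hm : ∀ e, 0 < m e ∧ Even (m e)) : ExtGroup.z m ≠ 1 := by
  classical
  choose a b ha hb hab hba using fun e : Δ.edgeSet => exists_dihedral_pair (hm e).1
  obtain ⟨T, _, _, _, Φ, hΦ⟩ := exists_tensor_rep Δ.edgeSet
  let B : V → Δ.edgeSet → Module.End ℂ (Fin 2 → ℂ) := fun v e =>
    if v = (Quot.out e.1).1 then a e else if v = (Quot.out e.1).2 then b e else 1
  have hB2 : ∀ v, B v ^ 2 = 1 := by
    intro v
    ext1 e
    simp only [Pi.pow_apply, B, Pi.one_apply]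
    split_ifs
    exacts [ha e, hb e, one_pow 2]
  have hBmem : ∀ v e, v ∉ e.1 → B v e = 1 := by
    intro v e hv
    have h1 : s((Quot.out e.1).1, (Quot.out e.1).2) = e.1 := Quot.out_eq e.1
    rw [← h1, Sym2.mem_iff, not_or] at hv
    simp only [B, if_neg hv.1, if_neg hv.2]
  have hBpow : ∀ v w (h : Δ.Adj v w), (B v * B w) ^ m ⟨s(v, w), h⟩ =
      Function.update (1 : Δ.edgeSet → Module.End ℂ (Fin 2 → ℂ)) ⟨s(v, w), h⟩ (-1) := by
    intro v w h
    ext1 e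
    by_cases he : e = ⟨s(v, w), h⟩
    · rw [he, Function.update_self, Pi.pow_apply, Pi.mul_apply]
      have h1 : s((Quot.out s(v, w)).1, (Quot.out s(v, w)).2) = s(v, w) := Quot.out_eq _
      simp only [B]
      rcases Sym2.eq_iff.1 h1 with ⟨h2, h3⟩ | ⟨h2, h3⟩
      · simp only [h2, h3, if_true, h.ne', if_false]
        exact hab _
      · simp only [h2, h3, if_true, h.ne, if_false]
        exact hba _
    · rw [Function.update_of_ne he, Pi.pow_apply, Pi.mul_apply, Pi.one_apply]
      obtain ⟨n, hn⟩ := even_iff_exists_two_mul.1 (hm ⟨s(v, w), h⟩).2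
      rw [hn, pow_mul]
      have h1 : v ∉ e.1 ∨ w ∉ e.1 := by
        by_contra! hcon
        exact he (Subtype.ext ((Sym2.mem_and_mem_iff h.ne).1 hcon))
      rcases h1 with h1 | h1
      · rw [hBmem v e h1, one_mul, show B w e ^ 2 = 1 from congrFun (hB2 w) e, one_pow]
      · rw [hBmem w e h1, mul_one, show B v e ^ 2 = 1 from congrFun (hB2 v) e, one_pow]
  -- The scalar `i` turns the involutions `Φ (B v)` into square roots of `-1`. In `(g v * g w) ^ m`
  -- it contributes `(-1) ^ m = 1`, so the sign from the factor of the edge survives.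
  let g : V → Module.End ℂ T := fun v => Complex.I • Φ (B v)
  have hg : ∀ v w, g v * g w = (-1 : ℂ) • Φ (B v * B w) := by
    intro v w
    rw [smul_mul_smul_comm, Complex.I_mul_I, map_mul]
  have hg2 : ∀ v, g v * g v = -1 := by
    intro v
    rw [hg, ← sq, hB2, map_one, neg_smul, one_smul]
  have hgm : ∀ v w (h : Δ.Adj v w), (g v * g w) ^ m ⟨s(v, w), h⟩ = -1 := by
    intro v w h
    obtain ⟨n, hn⟩ := even_iff_exists_two_mul.1 (hm ⟨s(v, w), h⟩).2
    rw [hg, smul_pow, ← map_pow, hBpow]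
    have h1 : (-1 : ℂ) ^ m ⟨s(v, w), h⟩ = 1 := (hm _).2.neg_one_pow
    rw [h1, one_smul, hΦ]
  let gu : V → (Module.End ℂ T)ˣ := fun v =>
    ⟨g v, -g v, by rw [mul_neg, hg2, neg_neg], by rw [neg_mul, hg2, neg_neg]⟩
  obtain ⟨ρ, hρ, -⟩ := ExtGroup.exists_hom hm gu (-1)
    (by rw [neg_one_sq]) (fun v => by rw [mul_neg_one, neg_one_mul])
    (fun v => Units.ext (by rw [sq]; exact hg2 v)) fun v w h => Units.ext (by
      rw [Units.val_pow_eq_pow_val]; exact hgm v w h)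
  intro hz
  rw [hz, map_one] at hρ
  have h2 := congrArg Units.val hρ
  obtain ⟨x, hx⟩ := exists_ne (0 : T)
  have h3 := LinearMap.congr_fun h2 x
  have h4 : x = -x := h3
  have h5 : (2 : ℂ) • x = 0 := by
    rw [two_smul]
    nth_rewrite 1 [h4]
    exact neg_add_cancel x
  exact hx ((smul_eq_zero.1 h5).resolve_left two_ne_zero)

theorem proj_g (v : V) : proj m (ExtGroup.g m v) = CoxGroup.g m v := PresentedGroup.toGroup.of _

theorem proj_z : proj m (ExtGroup.z m) = 1 := PresentedGroup.toGroup.of _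

theorem ExtGroup.z_comm (x : ExtGroup m) : x * ExtGroup.z m = ExtGroup.z m * x := by
  have h : x ∈ Subgroup.centralizer {ExtGroup.z m} := by
    have h1 : Subgroup.closure (Set.range (PresentedGroup.of (rels := extRels m))) ≤
        Subgroup.centralizer {ExtGroup.z m} := by
      rw [Subgroup.closure_le]
      rintro _ ⟨_ | v, rfl⟩
      · exact Subgroup.mem_centralizer_singleton_iff.2 rfl
      · exact Subgroup.mem_centralizer_singleton_iff.2 (ExtGroup.g_comm v)
    rw [PresentedGroup.closure_range_of] at h1
    exact h1 (Subgroup.mem_top x)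
  exact Subgroup.mem_centralizer_singleton_iff.1 h

/-- The relations of `Γ` hold in the quotient of `Γ̃` by `⟨z⟩`, so the kernel of the projection is
`⟨z⟩`, and `z ^ 2 = 1`. -/
theorem proj_eq_one (hm : ∀ e, 0 < m e ∧ Even (m e)) {x : ExtGroup m} (hx : proj m x = 1) :
    x = 1 ∨ x = ExtGroup.z m := by
  let N := Subgroup.zpowers (ExtGroup.z m)
  have hN : N.Normal := ⟨fun n hn g => by
    obtain ⟨i, rfl⟩ := hn
    have h1 : Commute g (ExtGroup.z m ^ i) :=
      Commute.zpow_right (show Commute g (ExtGroup.z m) from ExtGroup.z_comm g) i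
    refine ⟨i, ?_⟩
    change ExtGroup.z m ^ i = _ 
    rw [h1.eq, mul_inv_cancel_right]⟩
  have hz : (QuotientGroup.mk' N) (ExtGroup.z m) = 1 :=
    (QuotientGroup.eq_one_iff _).2 (Subgroup.mem_zpowers _)
  obtain ⟨ρ, hρ⟩ := CoxGroup.exists_hom hm (fun v => QuotientGroup.mk' N (ExtGroup.g m v))
    (fun v => by rw [← map_pow, ExtGroup.g_sq, hz])
    (fun v w h => by rw [← map_mul, ← map_pow, ExtGroup.mul_pow hm h, hz])
  have hcomp : ρ.comp (proj m) = QuotientGroup.mk' N := by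
    refine PresentedGroup.ext fun o => ?_
    rcases o with _ | v
    · rw [MonoidHom.comp_apply]
      exact (congrArg ρ proj_z).trans ((map_one ρ).trans hz.symm)
    · rw [MonoidHom.comp_apply]
      exact (congrArg ρ (proj_g v)).trans (hρ v)
  have h1 : QuotientGroup.mk' N x = 1 := by rw [← hcomp, MonoidHom.comp_apply, hx, map_one]
  obtain ⟨i, rfl⟩ := (QuotientGroup.eq_one_iff _).1 h1
  change ExtGroup.z m ^ i = 1 ∨ ExtGroup.z m ^ i = _
  obtain ⟨c, rfl | rfl⟩ := Int.even_or_odd' i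
  · left; rw [zpow_mul, zpow_ofNat, ExtGroup.z_sq, one_zpow]
  · right; rw [zpow_add, zpow_mul, zpow_ofNat, ExtGroup.z_sq, one_zpow, one_mul, zpow_one]

/-- The parabolic subgroup of `Γ` of a set of vertices. -/
def coxParabolic (m : Δ.edgeSet → ℕ) (S : Set V) : Subgroup (CoxGroup m) :=
  Subgroup.closure (PresentedGroup.of '' S)

/-- The parabolic subgroup of `Γ̃` of a set of vertices. -/
def extParabolic (m : Δ.edgeSet → ℕ) (S : Set V) : Subgroup (ExtGroup m) :=
  Subgroup.closure (insert (PresentedGroup.of none) ((fun v => PresentedGroup.of (some v)) '' S))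

theorem map_extParabolic (S : Set V) : (extParabolic m S).map (proj m) = coxParabolic m S := by
  rw [extParabolic, coxParabolic, MonoidHom.map_closure, Set.image_insert_eq, Set.image_image]
  have h1 : proj m (PresentedGroup.of none) = 1 := proj_z
  have h2 : ∀ v, proj m (PresentedGroup.of (some v)) = PresentedGroup.of v := proj_g
  simp only [h1, h2]
  refine le_antisymm ?_ (Subgroup.closure_mono (Set.subset_insert _ _))
  rw [Subgroup.closure_le]
  exact Set.insert_subset (Subgroup.one_mem _) Subgroup.subset_closure

/-- The projection maps one parabolic subgroup onto the other, with fibres of at most two elements.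
-/
theorem finite_extParabolic_iff (hm : ∀ e, 0 < m e ∧ Even (m e)) (S : Set V) :
    Finite (extParabolic m S) ↔ Finite (coxParabolic m S) := by
  constructor
  · intro h
    rw [← map_extParabolic]
    exact Set.Finite.image (proj m) (s := (extParabolic m S : Set (ExtGroup m))) h
  · intro h
    have h1 : ((proj m) ⁻¹' (coxParabolic m S : Set (CoxGroup m))).Finite := by
      refine Set.Finite.preimage' h fun b _ => ?_
      rcases (proj m ⁻¹' {b}).eq_empty_or_nonempty with h0 | ⟨x, hx⟩
      · rw [h0]; exact Set.finite_empty
      · refine (Set.toFinite {x, ExtGroup.z m * x}).subset fun y hy => ?_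
        have h2 : proj m (y * x⁻¹) = 1 := by
          rw [map_mul, map_inv, show proj m y = b from hy, show proj m x = b from hx,
            mul_inv_cancel]
        rcases proj_eq_one hm h2 with h3 | h3
        · exact Or.inl (mul_inv_eq_one.1 h3)
        · exact Or.inr (mul_inv_eq_iff_eq_mul.1 h3)
    refine h1.subset fun x hx => ?_
    rw [Set.mem_preimage, ← map_extParabolic]
    exact ⟨x, hx, rfl⟩

theorem exists_extElementary (hm : ∀ e, 0 < m e ∧ Even (m e)) {K : Subgroup (CoxGroup m)}
    (hK : K ∈ coxElementary m) : ∃ K' ∈ extElementary m, K'.map (proj m) = K := by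
  obtain ⟨hf, S, hS, rfl⟩ := hK
  exact ⟨extParabolic m S, ⟨(finite_extParabolic_iff hm _).2 hf, S, hS, rfl⟩, map_extParabolic _⟩

theorem map_mem_coxElementary (hm : ∀ e, 0 < m e ∧ Even (m e)) {K : Subgroup (ExtGroup m)}
    (hK : K ∈ extElementary m) : K.map (proj m) ∈ coxElementary m := by
  obtain ⟨hf, S, hS, rfl⟩ := hK
  have h := map_extParabolic (m := m) (S : Set V)
  exact ⟨h ▸ (finite_extParabolic_iff hm _).1 hf, S, hS, h⟩

theorem z_mem_of_mem_extElementary {K : Subgroup (ExtGroup m)} (hK : K ∈ extElementary m) :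
    ExtGroup.z m ∈ K := by
  obtain ⟨hf, S, hS, rfl⟩ := hK
  exact Subgroup.subset_closure (Set.mem_insert _ _)

/-- The parabolic subgroup of rank `0` is `⟨z⟩`. An elementary subgroup always exists, even for an
empty graph, and forces `z` to act nontrivially. -/
theorem exists_mem_extElementary (hm : ∀ e, 0 < m e ∧ Even (m e)) : ∃ K, K ∈ extElementary m := by
  have h : coxParabolic m ∅ = ⊥ := by simp [coxParabolic]
  exact ⟨extParabolic m ∅, (finite_extParabolic_iff hm _).2 (by rw [h]; infer_instance), ∅,
    by simp, by simp [extParabolic]⟩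

theorem closure_g_mem_coxElementary (v : V) :
    Subgroup.closure {CoxGroup.g m v} ∈ coxElementary m := by
  have := finite_closure_pair (CoxGroup.g_sq (m := m) v) (CoxGroup.g_sq v) one_pos
    (by rw [pow_one, ← sq, CoxGroup.g_sq])
  rw [Set.pair_eq_singleton] at this
  exact ⟨this, {v}, by simp, by simp⟩

theorem closure_pair_mem_coxElementary (hm : ∀ e, 0 < m e ∧ Even (m e)) {v w : V}
    (h : Δ.Adj v w) : Subgroup.closure {CoxGroup.g m v, CoxGroup.g m w} ∈ coxElementary m := by
  classical
  have := finite_closure_pair (CoxGroup.g_sq (m := m) v) (CoxGroup.g_sq w) (hm _).1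
    (CoxGroup.mul_pow hm h)
  exact ⟨this, {v, w}, Finset.card_le_two, by simp [Set.image_pair]⟩

end CentralElement

/-! ### Points of SL(2) and PSL(2) -/

section SL2Points

variable {k : Type u} [Field k] {S T : Type u} [CommRing S] [Algebra k S] [CommRing T] [Algebra k T]

/-- The matrix of a point of `SL(2)`. -/
def mat (g : Pt k (SL2Alg k) S) : Matrix (Fin 2) (Fin 2) S := (SL2Alg.X k).map g.ofConv

theorem mat_apply (g : Pt k (SL2Alg k) S) (i j : Fin 2) : mat g i j = g.ofConv (SL2Alg.X k i j) :=
  rfl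

theorem mat_injective : Function.Injective (mat (k := k) (S := S)) := fun _ _ H =>
  WithConv.ofConv_injective (SL2Alg.algHom_ext fun i j => congrFun (congrFun H i) j)

theorem det_mat (g : Pt k (SL2Alg k) S) : (mat g).det = 1 := by
  have h := g.ofConv.map_det (SL2Alg.X k)
  rw [SL2Alg.det_X, map_one] at h
  exact h.symm

theorem det_mat' (g : Pt k (SL2Alg k) S) : mat g 0 0 * mat g 1 1 - mat g 0 1 * mat g 1 0 = 1 := by
  rw [← Matrix.det_fin_two, det_mat]

variable (k) in
/-- The point of `SL(2)` given by a matrix of determinant `1`. -/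
def ofMat (M : Matrix (Fin 2) (Fin 2) S) (hM : M.det = 1) : Pt k (SL2Alg k) S :=
  toConv (SL2Alg.lift M hM)

theorem mat_ofMat (M : Matrix (Fin 2) (Fin 2) S) (hM : M.det = 1) : mat (ofMat k M hM) = M :=
  SL2Alg.lift_map_X M hM

theorem mat_mapPt (f : S →ₐ[k] T) (g : Pt k (SL2Alg k) S) : mat (mapPt f g) = (mat g).map f := rfl

theorem mat_one : mat (1 : Pt k (SL2Alg k) S) = 1 := by
  ext i j
  rw [mat_apply, one_pt_apply, SL2Alg.counit_eq, SL2Alg.counitHom_X, Matrix.one_apply]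
  split_ifs <;> simp

theorem mat_mul (g h : Pt k (SL2Alg k) S) : mat (g * h) = mat g * mat h := by
  ext i j
  have h1 := AlgHom.convMul_apply (R := k) g h (SL2Alg.X k i j)
  rw [SL2Alg.comul_eq, SL2Alg.comulHom_X, map_sum] at h1
  refine h1.trans ?_
  rw [Matrix.mul_apply]
  exact Finset.sum_congr rfl fun l _ => by simp [mat_apply]

variable (k S) in
/-- The point `-1` of `SL(2)`. -/
def negOne : Pt k (SL2Alg k) S := ofMat k (-1) (by rw [Matrix.det_neg]; simp)

theorem mat_negOne : mat (negOne k S) = -1 := mat_ofMat _ _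

theorem mat_negOne_mul (g : Pt k (SL2Alg k) S) : mat (negOne k S * g) = -mat g := by
  rw [mat_mul, mat_negOne, neg_one_mul]

theorem negOne_sq : negOne k S ^ 2 = 1 :=
  mat_injective (by rw [sq, mat_negOne_mul, mat_negOne, neg_neg, mat_one])

theorem negOne_comm (g : Pt k (SL2Alg k) S) : g * negOne k S = negOne k S * g :=
  mat_injective (by rw [mat_negOne_mul, mat_mul, mat_negOne, mul_neg_one])

theorem mapPt_negOne (f : S →ₐ[k] T) : mapPt f (negOne k S) = negOne k T :=
  mat_injective (by
    rw [mat_mapPt, mat_negOne, mat_negOne]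
    ext i j
    fin_cases i <;> fin_cases j <;> simp)

theorem negOne_ne_one [CharZero k] [Nontrivial S] : negOne k S ≠ 1 := by
  intro h
  have h1 := congrFun (congrFun (congrArg mat h) 0) 0
  rw [mat_negOne, mat_one, Matrix.neg_apply, Matrix.one_apply_eq] at h1
  have h2 : algebraMap k S 2 = 0 := by
    rw [map_ofNat]
    linear_combination -h1
  rw [map_eq_zero_iff _ (algebraMap k S).injective] at h2
  exact two_ne_zero h2

variable (k) in
/-- The function `x_{ij} x_{kl}` on `PSL(2)`. -/
def quad (p q : Fin 2 × Fin 2) : PSL2Alg k :=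
  ⟨SL2Alg.X k p.1 p.2 * SL2Alg.X k q.1 q.2, by
    change SL2Alg.neg k _ = _
    rw [map_mul, SL2Alg.neg_X, SL2Alg.neg_X, neg_mul_neg]; rfl⟩

theorem incl_quad (p q : Fin 2 × Fin 2) :
    PSL2Alg.incl k (quad k p q) = SL2Alg.X k p.1 p.2 * SL2Alg.X k q.1 q.2 := rfl

theorem avg_mul_incl (a : SL2Alg k) (b : PSL2Alg k) :
    PSL2Alg.avg k (a * PSL2Alg.incl k b) = PSL2Alg.avg k a * b := by
  apply PSL2Alg.incl_injective k
  rw [map_mul (PSL2Alg.incl k), PSL2Alg.incl_avg, PSL2Alg.incl_avg, map_mul, PSL2Alg.neg_incl, ← add_mul,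
    smul_mul_assoc]

variable [CharZero k]

variable (k) in
theorem adjoin_quad : Algebra.adjoin k (Set.range fun p : (Fin 2 × Fin 2) × (Fin 2 × Fin 2) =>
    quad k p.1 p.2) = ⊤ := by
  set P := Algebra.adjoin k (Set.range fun p : (Fin 2 × Fin 2) × (Fin 2 × Fin 2) =>
    quad k p.1 p.2)
  have hq : ∀ p q, quad k p q ∈ P := fun p q => Algebra.subset_adjoin ⟨(p, q), rfl⟩
  -- The averages of `f` and of `f` times a coordinate are treated together: multiplying `f` by one
  -- coordinate exchanges the two statements, and two coordinates combine to a `quad`, which can be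
  -- pulled out of the average.
  have key : ∀ f : MvPolynomial (Fin 2 × Fin 2) k, PSL2Alg.avg k (SL2Alg.mk k f) ∈ P ∧
      ∀ p : Fin 2 × Fin 2, PSL2Alg.avg k (SL2Alg.mk k f * SL2Alg.X k p.1 p.2) ∈ P := by
    intro f
    induction f using MvPolynomial.induction_on with
    | C c =>
      have h1 : SL2Alg.mk k (MvPolynomial.C c) = algebraMap k _ c :=
        (SL2Alg.mk k).commutes c
      refine ⟨?_, fun p => ?_⟩
      · have : PSL2Alg.avg k (SL2Alg.mk k (MvPolynomial.C c)) = algebraMap k _ c := by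
          rw [h1, ← (PSL2Alg.incl k).commutes, PSL2Alg.avg_incl]
        rw [this]; exact P.algebraMap_mem c
      · have : PSL2Alg.avg k (SL2Alg.mk k (MvPolynomial.C c) * SL2Alg.X k p.1 p.2) = 0 := by
          apply PSL2Alg.incl_injective k
          rw [PSL2Alg.incl_avg, map_mul, h1, AlgHom.commutes, SL2Alg.neg_X, map_zero]
          simp
        rw [this]; exact P.zero_mem
    | add f g hf hg =>
      refine ⟨?_, fun p => ?_⟩
      · rw [map_add, map_add]; exact P.add_mem hf.1 hg.1
      · rw [map_add, add_mul, map_add]; exact P.add_mem (hf.2 p) (hg.2 p)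
    | mul_X f q hf =>
      have h1 : SL2Alg.mk k (f * MvPolynomial.X q) = SL2Alg.mk k f * SL2Alg.X k q.1 q.2 :=
        map_mul _ _ _
      refine ⟨h1 ▸ hf.2 q, fun p => ?_⟩
      rw [h1, mul_assoc, ← incl_quad, avg_mul_incl]
      exact P.mul_mem hf.1 (hq _ _)
  refine eq_top_iff.2 fun a _ => ?_
  obtain ⟨f, hf⟩ := Ideal.Quotient.mk_surjective (PSL2Alg.incl k a)
  rw [← PSL2Alg.avg_incl k a]
  have := (key f).1
  rwa [show SL2Alg.mk k f = PSL2Alg.incl k a from hf] at this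

instance : Algebra.FiniteType k (PSL2Alg k) :=
  ⟨⟨(Set.finite_range fun p : (Fin 2 × Fin 2) × (Fin 2 × Fin 2) => quad k p.1 p.2).toFinset, by
    rw [Set.Finite.coe_toFinset]; exact adjoin_quad k⟩⟩

theorem pslPt_ext {g h : Pt k (PSL2Alg k) S}
    (H : ∀ p q, g.ofConv (quad k p q) = h.ofConv (quad k p q)) : g = h :=
  WithConv.ofConv_injective (AlgHom.ext_of_adjoin_eq_top (adjoin_quad k) (by
    rintro _ ⟨p, rfl⟩; exact H _ _))

variable (k) in
/-- The inclusion `O(PSL(2)) → O(SL(2))` as a homomorphism of bialgebras. -/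
def inclBialg : PSL2Alg k →ₐc[k] SL2Alg k :=
  BialgHom.ofAlgHom (PSL2Alg.incl k) rfl (AlgHom.ext fun a => PSL2Alg.incl₂_comul' k a)

/-- The projection `SL(2) → PSL(2)` on points. -/
def pr : Pt k (SL2Alg k) S →* Pt k (PSL2Alg k) S where
  toFun g := toConv (g.ofConv.comp (PSL2Alg.incl k))
  map_one' := rfl
  map_mul' g h := WithConv.ofConv_injective (AlgHom.convMul_comp_bialgHom_distrib g h (inclBialg k))

theorem pr_quad (g : Pt k (SL2Alg k) S) (p q : Fin 2 × Fin 2) :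
    (pr g).ofConv (quad k p q) = mat g p.1 p.2 * mat g q.1 q.2 :=
  map_mul g.ofConv (SL2Alg.X k p.1 p.2) (SL2Alg.X k q.1 q.2)

theorem mapPt_pr (f : S →ₐ[k] T) (g : Pt k (SL2Alg k) S) : mapPt f (pr g) = pr (mapPt f g) := rfl

theorem pr_eq_iff {g h : Pt k (SL2Alg k) S} : pr g = pr h ↔
    ∀ p q : Fin 2 × Fin 2, mat g p.1 p.2 * mat g q.1 q.2 = mat h p.1 p.2 * mat h q.1 q.2 := by
  constructor
  · intro H p q
    rw [← pr_quad, H, pr_quad]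
  · intro H
    exact pslPt_ext fun p q => by rw [pr_quad, pr_quad, H]

theorem pr_negOne : pr (negOne k S) = 1 := by
  rw [← map_one pr, pr_eq_iff]
  intro p q
  rw [mat_negOne, mat_one, Matrix.neg_apply, Matrix.neg_apply, neg_mul_neg]

/-- The entries of `g ^ 2` are quadratic in those of `g`, hence functions of the image in `PSL(2)`.
This makes kernel points torsion over any ring, so that `eq_one_of_forall_field` applies to them. -/
theorem sq_eq_one_of_pr_eq_one {g : Pt k (SL2Alg k) S} (h : pr g = 1) : g ^ 2 = 1 := by
  rw [← map_one pr, pr_eq_iff] at h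
  apply mat_injective
  rw [sq, mat_mul, mat_one]
  ext i j
  rw [Matrix.mul_apply]
  have := fun l => h (i, l) (l, j)
  simp only at this
  simp only [this, mat_one]
  rw [← Matrix.mul_apply, mul_one]

instance : Algebra.FiniteType k (SL2Alg k) :=
  inferInstanceAs (Algebra.FiniteType k (MvPolynomial (Fin 2 × Fin 2) k ⧸
    Ideal.span {(Matrix.mvPolynomialX (Fin 2) (Fin 2) k).det - 1}))

theorem eq_of_pr_eq_of_forall_field {g h : Pt k (SL2Alg k) S} (hpr : pr g = pr h)
    (H : ∀ (F : Type u) [Field F] [Algebra k F] (f : S →ₐ[k] F), mapPt f g = mapPt f h) :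
    g = h := by
  rw [← mul_inv_eq_one]
  refine eq_one_of_forall_field two_ne_zero
    (sq_eq_one_of_pr_eq_one (by rw [map_mul, map_inv, hpr, mul_inv_cancel])) fun F _ _ f => ?_
  rw [map_mul, map_inv, H, mul_inv_cancel]

section Fields

variable {F : Type u} [Field F] [Algebra k F]

theorem eq_or_eq_of_pr_eq {g h : Pt k (SL2Alg k) F} (H : pr g = pr h) :
    g = h ∨ g = negOne k F * h := by
  rw [pr_eq_iff] at H
  have hdet := det_mat' h
  obtain ⟨p, hp⟩ : ∃ p : Fin 2 × Fin 2, mat h p.1 p.2 ≠ 0 := by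
    by_contra! hcon
    rw [hcon (0, 0), hcon (0, 1)] at hdet
    simp at hdet
  rcases mul_self_eq_mul_self_iff.1 (H p p) with h1 | h1
  · left
    apply mat_injective
    ext i j
    have h2 := H p (i, j)
    rw [h1] at h2
    exact mul_left_cancel₀ hp h2
  · right
    apply mat_injective
    ext i j
    have h2 := H p (i, j)
    rw [h1] at h2
    rw [mat_negOne_mul, Matrix.neg_apply]
    refine mul_left_cancel₀ hp ?_
    linear_combination -h2

theorem eq_one_or_of_pr_eq_one {g : Pt k (SL2Alg k) F} (H : pr g = 1) :
    g = 1 ∨ g = negOne k F := by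
  have := eq_or_eq_of_pr_eq (g := g) (h := 1) (by rw [H, map_one])
  rwa [mul_one] at this

/-- If the trace vanished, Cayley–Hamilton would give `g ^ 2 = -1`, contrary to `2 ≠ 0`. The
off-diagonal entries of `g ^ 2` are the trace times those of `g`, so `g` is diagonal, and then a
sign. -/
theorem pr_eq_one_of_sq_eq_one {g : Pt k (SL2Alg k) F} (H : g ^ 2 = 1) : pr g = 1 := by
  have hd := det_mat' g
  have h1 : mat g * mat g = 1 := by rw [← mat_mul, ← sq, H, mat_one]
  have e := fun i j => congrFun (congrFun h1 i) j
  have e00 := e 0 0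
  have e01 := e 0 1
  have e10 := e 1 0
  have e11 := e 1 1
  simp only [Matrix.mul_apply, Fin.sum_univ_two, Matrix.one_apply_eq] at e00 e11
  simp only [Matrix.mul_apply, Fin.sum_univ_two, Matrix.one_apply_ne zero_ne_one,
    Matrix.one_apply_ne one_ne_zero] at e01 e10
  have : CharZero F := charZero_of_injective_algebraMap (algebraMap k F).injective
  have hs : (mat g 0 0 + mat g 1 1) ≠ 0 := by
    intro h0
    have h2 : (2 : F) = 0 := by linear_combination mat g 0 0 * h0 - hd - e00
    exact two_ne_zero h2
  have h01 : mat g 0 1 = 0 := by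
    refine (mul_eq_zero.1 ?_).resolve_left hs
    linear_combination e01
  have h10 : mat g 1 0 = 0 := by
    refine (mul_eq_zero.1 ?_).resolve_left hs
    linear_combination e10
  rw [h01, zero_mul, add_zero] at e00
  rw [h10, zero_mul, zero_add] at e11
  rw [h01, zero_mul, sub_zero] at hd
  rw [← map_one pr, pr_eq_iff, mat_one]
  rintro ⟨i, j⟩ ⟨i', j'⟩
  fin_cases i <;> fin_cases j <;> fin_cases i' <;> fin_cases j' <;>
    simp [h01, h10, e00, e11, hd, mul_comm (mat g 1 1)]

/-- A point of `PSL(2)` is a rank-one symmetric form `M` on the matrix coordinates. Dividing a row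
by a square root of its nonzero diagonal entry writes `M` as the square of a vector. -/
theorem exists_pr_eq [IsAlgClosed F] (g : Pt k (PSL2Alg k) F) : ∃ s : Pt k (SL2Alg k) F, pr s = g := by
  let M : Fin 2 × Fin 2 → Fin 2 × Fin 2 → F := fun p q => g.ofConv (quad k p q)
  have hM : ∀ p q r s, M p q * M r s = M p r * M q s := by
    intro p q r s
    simp only [M, ← map_mul]
    congr 1
    apply PSL2Alg.incl_injective k
    simp only [map_mul, incl_quad]
    ring
  have hdet : M (0, 0) (1, 1) - M (0, 1) (1, 0) = 1 := by
    simp only [M, ← map_sub]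
    rw [← map_one g.ofConv]
    congr 1
    apply PSL2Alg.incl_injective k
    simp only [map_sub, incl_quad, map_one]
    rw [← Matrix.det_fin_two, SL2Alg.det_X]
  obtain ⟨p, hp⟩ : ∃ p, M p p ≠ 0 := by
    by_contra! hcon
    have h1 : ∀ p q, M p q = 0 := fun p q => by
      have := hM p q p q
      rw [hcon, zero_mul] at this
      exact mul_self_eq_zero.1 this
    rw [h1, h1] at hdet
    simp at hdet
  obtain ⟨r, hr⟩ := IsAlgClosed.exists_pow_nat_eq (M p p) two_pos
  have hr0 : r ≠ 0 := by rintro rfl; simp at hr; exact hp hr.symm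
  have hs : ∀ q q', M p q / r * (M p q' / r) = M q q' := by
    intro q q'
    have := hM p q p q'
    field_simp
    rw [hr, this]
  refine ⟨ofMat k (Matrix.of fun i j => M p (i, j) / r) ?_, pslPt_ext fun q q' => ?_⟩
  · rw [Matrix.det_fin_two]
    simp only [Matrix.of_apply, hs, hdet]
  · rw [pr_quad, mat_ofMat]
    exact hs q q'

end Fields

/-- The infinitesimal lifting property of `SL(2) → PSL(2)`: as above, a rank-one form is written as
a square, but the square root required is that of an element congruent to `1` modulo a square-zero
ideal. -/
theorem exists_lift_of_sq_eq_bot {I : Ideal S} (hI : I ^ 2 = ⊥) (g : Pt k (PSL2Alg k) S)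
    (s : Pt k (SL2Alg k) (S ⧸ I)) (hs : pr s = mapPt (Ideal.Quotient.mkₐ k I) g) :
    ∃ t : Pt k (SL2Alg k) S, pr t = g ∧ mapPt (Ideal.Quotient.mkₐ k I) t = s := by
  let M : Fin 2 × Fin 2 → Fin 2 × Fin 2 → S := fun p q => g.ofConv (quad k p q)
  have hM : ∀ p q r s, M p q * M r s = M p r * M q s := by
    intro p q r s
    simp only [M, ← map_mul]
    congr 1
    apply PSL2Alg.incl_injective k
    simp only [map_mul, incl_quad]
    ring
  have hdet : M (0, 0) (1, 1) - M (0, 1) (1, 0) = 1 := by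
    simp only [M, ← map_sub]
    rw [← map_one g.ofConv]
    congr 1
    apply PSL2Alg.incl_injective k
    simp only [map_sub, incl_quad, map_one]
    rw [← Matrix.det_fin_two, SL2Alg.det_X]
  have hsM : ∀ p q : Fin 2 × Fin 2, Ideal.Quotient.mk I (M p q) = mat s p.1 p.2 * mat s q.1 q.2 := by
    intro p q
    rw [← pr_quad, hs]; rfl
  choose t ht using fun p : Fin 2 × Fin 2 => Ideal.Quotient.mk_surjective (mat s p.1 p.2)
  have hsd := det_mat' s
  -- `N` is the value of `M` on the functional `x ↦ x₀₀ t₁₁ - x₀₁ t₁₀`. Modulo `I` this functional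
  -- takes the value `det s = 1` on `s`, so `N` is `1` modulo `I`.
  let N : S := M (0, 0) (0, 0) * t (1, 1) ^ 2 - 2 * M (0, 0) (0, 1) * t (1, 1) * t (1, 0) +
    M (0, 1) (0, 1) * t (1, 0) ^ 2
  have hN : N - 1 ∈ I := by
    rw [← Ideal.Quotient.eq_zero_iff_mem]
    simp only [N, map_sub, map_add, map_mul, map_pow, hsM, ht, map_one, map_ofNat]
    linear_combination (mat s 0 0 * mat s 1 1 - mat s 0 1 * mat s 1 0 + 1) * hsd
  have hN2 : (N - 1) * (N - 1) = 0 := by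
    have := Ideal.mul_mem_mul hN hN
    rwa [← sq I, hI] at this
  let c : S := algebraMap k S 2⁻¹
  have hc : 2 * c = 1 := by
    rw [← map_ofNat (algebraMap k S) 2, ← map_mul, mul_inv_cancel₀ two_ne_zero, map_one]
  -- The binomial series for `N ^ (-1/2)`, which stops after the linear term because `(N - 1) ^ 2 =
  -- 0`.
  let w : S := 1 - c * (N - 1)
  have hw : w ^ 2 * N = 1 := by
    simp only [w]
    linear_combination (c ^ 2 * N - 2 * c) * hN2 + (1 - N) * hc
  have hwI : Ideal.Quotient.mk I w = 1 := by
    simp only [w, map_sub (Ideal.Quotient.mk I) 1, map_mul, map_one,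
      Ideal.Quotient.eq_zero_iff_mem.2 hN]
    simp
  let x : Fin 2 × Fin 2 → S := fun p => (M p (0, 0) * t (1, 1) - M p (0, 1) * t (1, 0)) * w
  have hx : ∀ p q, x p * x q = M p q := by
    intro p q
    have h1 := hM p (0, 0) q (0, 0)
    have h2 := hM p (0, 0) q (0, 1)
    have h3 := hM p (0, 1) q (0, 0)
    have h4 := hM p (0, 1) q (0, 1)
    have h5 : M (0, 1) (0, 0) = M (0, 0) (0, 1) := by
      simp only [M]; congr 1
      apply PSL2Alg.incl_injective k
      simp only [incl_quad, mul_comm]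
    rw [h5] at h3
    have h6 : x p * x q = w ^ 2 * N * M p q := by
      simp only [x, N]
      linear_combination w ^ 2 * (t (1, 1) ^ 2 * h1 - t (1, 1) * t (1, 0) * (h2 + h3) +
        t (1, 0) ^ 2 * h4)
    rw [h6, hw, one_mul]
  refine ⟨ofMat k (Matrix.of fun i j => x (i, j)) ?_, pslPt_ext fun p q => ?_, ?_⟩
  · rw [Matrix.det_fin_two]
    simp only [Matrix.of_apply, hx, hdet]
  · rw [pr_quad, mat_ofMat]
    exact hx p q
  · apply mat_injective
    rw [mat_mapPt, mat_ofMat]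
    ext i j
    change Ideal.Quotient.mk I (x (i, j)) = _
    simp only [x, map_mul, map_sub, hwI, hsM, ht]
    linear_combination (mat s i j) * hsd

/-- Maps to fields kill the nilpotent ideal `I`, so agreement modulo `I` is agreement at all
field-valued points. -/
theorem eq_of_pr_eq_of_sq_eq_bot {I : Ideal S} (hI : I ^ 2 = ⊥) {g h : Pt k (SL2Alg k) S}
    (hpr : pr g = pr h)
    (H : mapPt (Ideal.Quotient.mkₐ k I) g = mapPt (Ideal.Quotient.mkₐ k I) h) : g = h := by
  refine eq_of_pr_eq_of_forall_field hpr fun F _ _ f => ?_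
  have hf : ∀ a ∈ I, f a = 0 := fun a ha => by
    have h1 := Ideal.mul_mem_mul ha ha
    rw [← sq I, hI] at h1
    have h2 : f (a * a) = 0 := by rw [show a * a = 0 from h1, map_zero]
    rw [map_mul] at h2
    exact mul_self_eq_zero.1 h2
  exact congrArg (mapPt (Ideal.Quotient.liftₐ I f hf)) H

end SL2Points

/-! ### Descending and lifting representations -/

section Lifting

variable {k : Type u} [Field k] [CharZero k] {S : Type u} [CommRing S] [Algebra k S]
  {V : Type} {Δ : SimpleGraph V} {m : Δ.edgeSet → ℕ}

theorem IsInjRep.map_z [Fintype V] (hm : ∀ e, 0 < m e ∧ Even (m e))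
    {ρ : ExtGroup m →* Pt k (SL2Alg k) S} (h : IsInjRep (extElementary m) ρ) :
    ρ (ExtGroup.z m) = negOne k S := by
  obtain ⟨K, hK⟩ := exists_mem_extElementary hm
  have hz2 : ρ (ExtGroup.z m) ^ 2 = 1 := by rw [← map_pow, ExtGroup.z_sq, map_one]
  have hinv : (negOne k S)⁻¹ = negOne k S :=
    inv_eq_of_mul_eq_one_left (by rw [← sq, negOne_sq])
  -- The claim becomes that the torsion point `ρ(z) * (-1)` is trivial. At a field-valued point
  -- `ρ(z)` is an involution other than `1`, hence `-1`.
  rw [← hinv, ← mul_eq_one_iff_eq_inv]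
  refine eq_one_of_forall_field two_ne_zero ?_ fun F _ _ f => ?_
  · have hc : Commute (ρ (ExtGroup.z m)) (negOne k S) := negOne_comm _
    rw [hc.mul_pow, hz2, negOne_sq, one_mul]
  · have h1 : mapPt f (ρ (ExtGroup.z m)) ≠ 1 := fun h1 =>
      ExtGroup.z_ne_one hm (h F f K hK _ (z_mem_of_mem_extElementary hK) h1)
    have h2 : mapPt f (ρ (ExtGroup.z m)) ^ 2 = 1 := by rw [← map_pow, hz2, map_one]
    rw [map_mul, mapPt_negOne,
      (eq_one_or_of_pr_eq_one (pr_eq_one_of_sq_eq_one h2)).resolve_left h1, ← sq, negOne_sq]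

theorem IsInjRep.exists_descent [Fintype V] (hm : ∀ e, 0 < m e ∧ Even (m e))
    {ρ' : ExtGroup m →* Pt k (SL2Alg k) S} (h : IsInjRep (extElementary m) ρ') :
    ∃ ρ : CoxGroup m →* Pt k (PSL2Alg k) S, IsInjRep (coxElementary m) ρ ∧
      ρ.comp (proj m) = pr.comp ρ' := by
  have hz := h.map_z hm
  have hpz : pr (ρ' (ExtGroup.z m)) = 1 := by rw [hz, pr_negOne]
  obtain ⟨ρ, hρ⟩ := CoxGroup.exists_hom hm (fun v => pr (ρ' (ExtGroup.g m v)))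
    (fun v => by rw [← map_pow, ← map_pow, ExtGroup.g_sq, hpz])
    (fun v w e => by rw [← map_mul, ← map_mul, ← map_pow, ← map_pow, ExtGroup.mul_pow hm e, hpz])
  have hcomp : ρ.comp (proj m) = pr.comp ρ' := by
    refine PresentedGroup.ext fun o => ?_
    rcases o with _ | v
    · exact (congrArg ρ proj_z).trans ((map_one ρ).trans hpz.symm)
    · exact (congrArg ρ (proj_g v)).trans (hρ v)
  refine ⟨ρ, fun F _ _ f K hK γ hγ h1 => ?_, hcomp⟩
  obtain ⟨K', hK', rfl⟩ := exists_extElementary hm hK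
  obtain ⟨x, hx, rfl⟩ := hγ
  have h2 : ρ (proj m x) = pr (ρ' x) := DFunLike.congr_fun hcomp x
  rw [h2, mapPt_pr] at h1
  rcases eq_one_or_of_pr_eq_one h1 with h3 | h3
  · rw [h F f K' hK' x hx h3, map_one]
  -- If `x` acts as `-1`, then `x z⁻¹`, still in the elementary subgroup, acts trivially. So `x =
  -- z`, which dies in `Γ`.
  · have h4 := h F f K' hK' (x * (ExtGroup.z m)⁻¹)
      (K'.mul_mem hx (K'.inv_mem (z_mem_of_mem_extElementary hK')))
      (by rw [map_mul, map_mul, map_inv, map_inv, h3, hz, mapPt_negOne, mul_inv_cancel])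
    rw [mul_inv_eq_one.1 h4, proj_z]

/-- The lifts of the generators may be chosen independently: the relations of `Γ̃` then hold by
themselves, by rigidity and injectivity. This is where evenness of the labels enters the covering.
-/
theorem IsInjRep.exists_lift (hm : ∀ e, 0 < m e ∧ Even (m e))
    {ρ : CoxGroup m →* Pt k (PSL2Alg k) S} (h : IsInjRep (coxElementary m) ρ)
    {s : V → Pt k (SL2Alg k) S} (hs : ∀ v, pr (s v) = ρ (CoxGroup.g m v)) :
    ∃ ρ' : ExtGroup m →* Pt k (SL2Alg k) S, IsInjRep (extElementary m) ρ' ∧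
      ρ' (ExtGroup.z m) = negOne k S ∧ ∀ v, ρ' (ExtGroup.g m v) = s v := by
  have hmem : ∀ v w, CoxGroup.g m v ∈ Subgroup.closure {CoxGroup.g m v, CoxGroup.g m w} ∧
      CoxGroup.g m w ∈ Subgroup.closure {CoxGroup.g m v, CoxGroup.g m w} := fun v w =>
    ⟨Subgroup.subset_closure (by simp), Subgroup.subset_closure (by simp)⟩
  have hsq : ∀ v, s v ^ 2 = negOne k S := by
    intro v
    refine eq_of_pr_eq_of_forall_field ?_ fun F _ _ f => ?_
    · rw [map_pow, hs, ← map_pow, CoxGroup.g_sq, map_one, pr_negOne]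
    · rw [mapPt_negOne]
      have h1 : pr (mapPt f (s v ^ 2)) = 1 := by
        rw [← mapPt_pr, map_pow, hs, ← map_pow, CoxGroup.g_sq, map_one, map_one]
      refine (eq_one_or_of_pr_eq_one h1).resolve_left fun h2 => ?_
      rw [map_pow] at h2
      have h3 := pr_eq_one_of_sq_eq_one h2
      rw [← mapPt_pr, hs] at h3
      exact CoxGroup.g_ne_one hm v (h F f _ (closure_g_mem_coxElementary v) _
        (Subgroup.subset_closure rfl) h3)
  have hpow : ∀ v w (e : Δ.Adj v w), (s v * s w) ^ m ⟨s(v, w), e⟩ = negOne k S := by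
    intro v w e
    obtain ⟨n, hn⟩ := even_iff_exists_two_mul.1 (hm ⟨s(v, w), e⟩).2
    have h0 : pr ((s v * s w) ^ m ⟨s(v, w), e⟩) = 1 := by
      rw [map_pow, map_mul, hs, hs, ← map_mul, ← map_pow, CoxGroup.mul_pow hm, map_one]
    refine eq_of_pr_eq_of_forall_field (by rw [h0, pr_negOne]) fun F _ _ f => ?_
    rw [mapPt_negOne]
    refine (eq_one_or_of_pr_eq_one (by rw [← mapPt_pr, h0, map_one])).resolve_left fun h2 => ?_
    -- With `m = 2n`, the bad case makes `(s_v s_w) ^ n` an involution at a field-valued point,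
    -- hence trivial in `PSL(2)`, although `(g_v g_w) ^ n ≠ 1` lies in an elementary subgroup.
    rw [hn, mul_comm 2 n, pow_mul, map_pow] at h2
    have h3 := pr_eq_one_of_sq_eq_one h2
    rw [← mapPt_pr, map_pow, map_mul, hs, hs, ← map_mul, ← map_pow] at h3
    exact CoxGroup.mul_pow_half_ne_one hm e hn (h F f _ (closure_pair_mem_coxElementary hm e) _
      (Subgroup.pow_mem _ (Subgroup.mul_mem _ (hmem v w).1 (hmem v w).2) n) h3)
  obtain ⟨ρ', hz, hg⟩ := ExtGroup.exists_hom hm s (negOne k S) negOne_sq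
    (fun v => negOne_comm _) hsq hpow
  have hcomp : ρ.comp (proj m) = pr.comp ρ' := by
    refine PresentedGroup.ext fun o => ?_
    rcases o with _ | v
    · exact (congrArg ρ proj_z).trans
        ((map_one ρ).trans (pr_negOne.symm.trans (congrArg pr hz.symm)))
    · exact (congrArg ρ (proj_g v)).trans ((hs v).symm.trans (congrArg pr (hg v).symm))
  refine ⟨ρ', fun F _ _ f K hK x hx h1 => ?_, hz, hg⟩
  have h2 : mapPt f (ρ (proj m x)) = 1 := by
    rw [show ρ (proj m x) = pr (ρ' x) from DFunLike.congr_fun hcomp x, mapPt_pr, h1, map_one]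
  have h3 := h F f _ (map_mem_coxElementary hm hK) _ ⟨x, hx, rfl⟩ h2
  rcases proj_eq_one hm h3 with h4 | h4
  · exact h4
  · rw [h4, hz, mapPt_negOne] at h1
    exact absurd h1 negOne_ne_one

end Lifting

/-! ### Finite generation of the coordinate rings -/

section FiniteType

variable {k A : Type u} [Field k] [CommRing A] [HopfAlgebra k A]
  {α : Type} [DecidableEq α] {rels : Set (FreeGroup α)}

theorem PowAlg.map_mem [Fintype α] {C : Type u} [CommRing C] [Algebra k C] (h : PowAlg k A α →ₐ[k] C)
    (P : Subring C) (hk : ∀ c, algebraMap k C c ∈ P)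
    (hP : ∀ a x, h (PiTensorProduct.singleAlgHom (R := k) (A := fun _ : α => A) a x) ∈ P)
    (x : PowAlg k A α) : h x ∈ P := by
  induction x using PiTensorProduct.induction_on with
  | smul_tprod r f =>
    have h1 : PiTensorProduct.tprod k f = ∏ a, PiTensorProduct.tprod k (Pi.mulSingle a (f a)) := by
      rw [← PiTensorProduct.tprod_prod, Finset.univ_prod_mulSingle]
    rw [Algebra.smul_def, map_mul, AlgHom.commutes, h1, map_prod]
    exact P.mul_mem (hk r) (P.prod_mem fun a _ => hP a (f a))
  | add x y hx hy => rw [map_add]; exact P.add_mem hx hy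

instance [Fintype α] [Algebra.FiniteType k A] : Algebra.FiniteType k (PowAlg k A α) := by
  classical
  obtain ⟨s, hs⟩ := Algebra.FiniteType.out (R := k) (A := A)
  let t : Set (PowAlg k A α) := ⋃ a : α,
    PiTensorProduct.singleAlgHom (R := k) (A := fun _ : α => A) a '' (s : Set A)
  have ht : t.Finite := Set.finite_iUnion fun a => s.finite_toSet.image _
  refine ⟨⟨ht.toFinset, ?_⟩⟩
  rw [Set.Finite.coe_toFinset, eq_top_iff]
  intro x _
  refine PowAlg.map_mem (AlgHom.id k _) (Algebra.adjoin k t).toSubring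
    (fun c => (Algebra.adjoin k t).algebraMap_mem c) (fun a y => ?_) x
  have h1 : y ∈ Algebra.adjoin k (s : Set A) := by rw [hs]; trivial
  have h2 : (Algebra.adjoin k (s : Set A)).map
      (PiTensorProduct.singleAlgHom (R := k) (A := fun _ : α => A) a) ≤ Algebra.adjoin k t := by
    rw [AlgHom.map_adjoin]
    exact Algebra.adjoin_mono (Set.subset_iUnion_of_subset a subset_rfl)
  exact h2 ⟨y, h1, rfl⟩

theorem RepAlg.mk_surjective : Function.Surjective (RepAlg.mk k A rels) :=
  Ideal.Quotient.mk_surjective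

instance [Fintype α] [Algebra.FiniteType k A] : Algebra.FiniteType k (RepAlg k A rels) :=
  Algebra.FiniteType.of_surjective (RepAlg.mk k A rels) RepAlg.mk_surjective

/-- An idempotent becomes `1` once inverted, so localizing at it is passing to a quotient. -/
theorem awayHom_surjective {e : RepAlg k A rels} (he : IsIdempotentElem e) :
    Function.Surjective (awayHom e) := by
  have h1 : algebraMap _ (Localization.Away e) e = 1 := by
    have hu := IsLocalization.Away.algebraMap_isUnit (S := Localization.Away e) e
    have := he.map (algebraMap _ (Localization.Away e))
    exact hu.mul_left_cancel (by rw [this.eq, mul_one])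
  intro x
  obtain ⟨a, ⟨_, n, rfl⟩, rfl⟩ := IsLocalization.exists_mk'_eq (Submonoid.powers e) x
  refine ⟨a, ?_⟩
  have := IsLocalization.mk'_spec (Localization.Away e) a
    (⟨e ^ n, n, rfl⟩ : Submonoid.powers e)
  rw [map_pow, h1, one_pow, mul_one] at this
  exact this.symm

theorem finiteType_away [Fintype α] [Algebra.FiniteType k A] {e : RepAlg k A rels} (he : IsIdempotentElem e) :
    Algebra.FiniteType k (Localization.Away e) :=
  Algebra.FiniteType.of_surjective (awayHom e) (awayHom_surjective he)

theorem away_mem [Fintype α] {e : RepAlg k A rels} (he : IsIdempotentElem e)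
    (P : Subring (Localization.Away e)) (hk : ∀ c, algebraMap k _ c ∈ P)
    (hP : ∀ a x, (univAway e (PresentedGroup.of a)).ofConv x ∈ P) (x : Localization.Away e) :
    x ∈ P := by
  obtain ⟨y, rfl⟩ := awayHom_surjective he x
  obtain ⟨y, rfl⟩ := RepAlg.mk_surjective y
  refine PowAlg.map_mem ((awayHom e).comp (RepAlg.mk k A rels)) P hk (fun a x => ?_) y
  have h := hP a x
  rw [univAway, MonoidHom.comp_apply, univRep, PresentedGroup.toGroup.of, wordMap,
    FreeGroup.lift_apply_of] at h
  exact h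

theorem SL2Alg.map_mem {C : Type u} [CommRing C] [Algebra k C] (g : Pt k (SL2Alg k) C)
    (P : Subring C) (hk : ∀ c, algebraMap k C c ∈ P) (hP : ∀ i j, mat g i j ∈ P)
    (x : SL2Alg k) : g.ofConv x ∈ P := by
  obtain ⟨f, rfl⟩ : ∃ f, SL2Alg.mk k f = x := Ideal.Quotient.mk_surjective x
  induction f using MvPolynomial.induction_on with
  | C c =>
    have h1 : SL2Alg.mk k (MvPolynomial.C c) = algebraMap k _ c := (SL2Alg.mk k).commutes c
    rw [h1, AlgHom.commutes]; exact hk c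
  | add f g hf hg => rw [map_add, map_add]; exact P.add_mem hf hg
  | mul_X f q hf => rw [map_mul, map_mul]; exact P.mul_mem hf (hP q.1 q.2)

end FiniteType

/-! ### The covering on coordinate rings -/

section CoverAlgebra

variable (k : Type u) [Field k]

/-- The central point `1` or `-1` of `SL(2)` labelled by an element of `ℤ/2`. -/
def signPt (S : Type u) [CommRing S] [Algebra k S] (x : ZMod 2) : Pt k (SL2Alg k) S :=
  if x = 0 then 1 else negOne k S

variable {k} {S T : Type u} [CommRing S] [Algebra k S] [CommRing T] [Algebra k T]

theorem signPt_add (x y : ZMod 2) : signPt k S (x + y) = signPt k S x * signPt k S y := by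
  have h2 : negOne k S * negOne k S = 1 := by rw [← sq, negOne_sq]
  have h11 : (1 : ZMod 2) + 1 = 0 := rfl
  have h01 : ∀ x : ZMod 2, x = 0 ∨ x = 1 := by decide
  rcases h01 x with rfl | rfl <;> rcases h01 y with rfl | rfl <;> simp [signPt, h2, h11]

theorem signPt_zero : signPt k S 0 = 1 := if_pos rfl

theorem mapPt_signPt (f : S →ₐ[k] T) (x : ZMod 2) : mapPt f (signPt k S x) = signPt k T x := by
  unfold signPt
  split_ifs
  · exact map_one _
  · exact mapPt_negOne f

variable [CharZero k]

theorem pr_signPt (x : ZMod 2) : pr (signPt k S x) = 1 := by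
  unfold signPt
  split_ifs
  · exact map_one _
  · exact pr_negOne

theorem signPt_eq_one [Nontrivial S] {x : ZMod 2} (h : signPt k S x = 1) : x = 0 := by
  by_contra hx
  rw [signPt, if_neg hx] at h
  exact negOne_ne_one h

variable {V : Type} [DecidableEq V] {Δ : SimpleGraph V} {m : Δ.edgeSet → ℕ}
  {e : RepAlg k (PSL2Alg k) (coxRels m)} {e' : RepAlg k (SL2Alg k) (extRels m)}

theorem away_ext_cox [Fintype V] {f g : Localization.Away e →ₐ[k] S}
    (h : ∀ v, mapPt f (univAway e (CoxGroup.g m v)) = mapPt g (univAway e (CoxGroup.g m v))) :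
    f = g := away_algHom_ext e h

theorem away_ext_ext [Fintype V] (hm : ∀ e, 0 < m e ∧ Even (m e))
    (he' : injLocus k (SL2Alg k) (extRels m) (extElementary m) = PrimeSpectrum.basicOpen e')
    {f g : Localization.Away e' →ₐ[k] S}
    (h : ∀ v, mapPt f (univAway e' (ExtGroup.g m v)) = mapPt g (univAway e' (ExtGroup.g m v))) :
    f = g := by
  refine away_algHom_ext e' fun o => ?_
  rcases o with _ | v
  · have hz := (isInjRep_univAway he').map_z hm
    exact (congrArg (mapPt f) hz).trans ((mapPt_negOne f).trans ((mapPt_negOne g).symm.trans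
      (congrArg (mapPt g) hz.symm)))
  · exact h v

/-- A homomorphism of coordinate rings that is dual to composition of representations with
`SL(2) → PSL(2)`. -/
def IsCoverHom (ψ : Localization.Away e →ₐ[k] Localization.Away e') : Prop :=
  ((mapPt ψ).comp (univAway e)).comp (proj m) = pr.comp (univAway e')

theorem exists_coverHom [Fintype V] (hm : ∀ e, 0 < m e ∧ Even (m e))
    (he : injLocus k (PSL2Alg k) (coxRels m) (coxElementary m) = PrimeSpectrum.basicOpen e)
    (he' : injLocus k (SL2Alg k) (extRels m) (extElementary m) = PrimeSpectrum.basicOpen e') :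
    ∃ ψ : Localization.Away e →ₐ[k] Localization.Away e', IsCoverHom ψ := by
  obtain ⟨ρ, hρ, hcomp⟩ := (isInjRep_univAway he').exists_descent hm
  obtain ⟨ψ, hψ⟩ := exists_away_algHom he hρ
  exact ⟨ψ, by rw [IsCoverHom, hψ, hcomp]⟩

variable {ψ : Localization.Away e →ₐ[k] Localization.Away e'}

theorem IsCoverHom.apply_g (hψ : IsCoverHom ψ) (v : V) :
    mapPt ψ (univAway e (CoxGroup.g m v)) = pr (univAway e' (ExtGroup.g m v)) := by
  have := DFunLike.congr_fun hψ (ExtGroup.g m v)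
  simp only [MonoidHom.comp_apply] at this
  rw [← this, proj_g]

/-- Lifts of a point of `hom_o(Γ, PSL(2))` correspond to lifts of the images of the generators. -/
theorem IsCoverHom.exists_lift [Fintype V] (hψ : IsCoverHom ψ) (hm : ∀ e, 0 < m e ∧ Even (m e))
    (he : injLocus k (PSL2Alg k) (coxRels m) (coxElementary m) = PrimeSpectrum.basicOpen e)
    (he' : injLocus k (SL2Alg k) (extRels m) (extElementary m) = PrimeSpectrum.basicOpen e')
    (f : Localization.Away e →ₐ[k] S) (s : V → Pt k (SL2Alg k) S)
    (hs : ∀ v, pr (s v) = mapPt f (univAway e (CoxGroup.g m v))) :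
    ∃ F : Localization.Away e' →ₐ[k] S, F.comp ψ = f ∧
      ∀ v, mapPt F (univAway e' (ExtGroup.g m v)) = s v := by
  obtain ⟨ρ', hρ', -, hg⟩ := ((isInjRep_univAway he).map f).exists_lift hm hs
  obtain ⟨F, hF⟩ := exists_away_algHom he' hρ'
  have hFv : ∀ v, mapPt F (univAway e' (ExtGroup.g m v)) = s v := fun v => by
    rw [← hg, ← hF]; rfl
  refine ⟨F, away_ext_cox fun v => ?_, hFv⟩
  rw [← mapPt_mapPt, hψ.apply_g, mapPt_pr, hFv, hs]

theorem IsCoverHom.apply_g' (hψ : IsCoverHom ψ) (F : Localization.Away e' →ₐ[k] S) (v : V) :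
    pr (mapPt F (univAway e' (ExtGroup.g m v))) =
      mapPt (F.comp ψ) (univAway e (CoxGroup.g m v)) := by
  rw [← mapPt_mapPt, hψ.apply_g, mapPt_pr]

/-- Points upstairs are families of lifts of generators, so unique lifting along square-zero ideals
is inherited from `SL(2) → PSL(2)`, one vertex at a time. -/
theorem IsCoverHom.formallyEtale [Fintype V] (hψ : IsCoverHom ψ) (hm : ∀ e, 0 < m e ∧ Even (m e))
    (he : injLocus k (PSL2Alg k) (coxRels m) (coxElementary m) = PrimeSpectrum.basicOpen e)
    (he' : injLocus k (SL2Alg k) (extRels m) (extElementary m) = PrimeSpectrum.basicOpen e') :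
    ψ.toRingHom.FormallyEtale := by
  let B := Localization.Away e
  let C := Localization.Away e'
  let _ : Algebra B C := ψ.toRingHom.toAlgebra
  have : IsScalarTower k B C := IsScalarTower.of_algebraMap_eq fun c => (ψ.commutes c).symm
  change Algebra.FormallyEtale B C
  refine Algebra.FormallyEtale.iff_comp_bijective.2 ?_
  intro S _ _ I hI
  let _ : Algebra k S := ((algebraMap B S).comp (algebraMap k B)).toAlgebra
  have : IsScalarTower k B S := IsScalarTower.of_algebraMap_eq fun c => rfl
  let b : B →ₐ[k] S := IsScalarTower.toAlgHom k B S
  have hb : ∀ (F : C →ₐ[B] S), (F.restrictScalars k).comp ψ = b := fun F =>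
    AlgHom.ext fun x => F.commutes x
  constructor
  · intro F₁ F₂ h
    have h1 : F₁.restrictScalars k = F₂.restrictScalars k := by
      refine away_ext_ext hm he' fun v => eq_of_pr_eq_of_sq_eq_bot hI ?_ ?_
      · rw [hψ.apply_g', hψ.apply_g', hb, hb]
      · rw [mapPt_mapPt, mapPt_mapPt]
        congr 2
        exact AlgHom.ext fun x => DFunLike.congr_fun h x
    exact AlgHom.ext fun x => DFunLike.congr_fun h1 x
  · intro G
    have hG : (G.restrictScalars k).comp ψ = (Ideal.Quotient.mkₐ k I).comp b :=
      AlgHom.ext fun x => G.commutes x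
    choose t ht1 ht2 using fun v => exists_lift_of_sq_eq_bot hI
      (mapPt b (univAway e (CoxGroup.g m v)))
      (mapPt (G.restrictScalars k) (univAway e' (ExtGroup.g m v)))
      (by rw [hψ.apply_g', hG, mapPt_mapPt])
    obtain ⟨F, hF, hFv⟩ := hψ.exists_lift hm he he' b t ht1
    refine ⟨{ F with commutes' := fun x => DFunLike.congr_fun hF x }, ?_⟩
    have h1 : (Ideal.Quotient.mkₐ k I).comp F = G.restrictScalars k := by
      refine away_ext_ext hm he' fun v => ?_
      rw [← mapPt_mapPt, hFv, ht2]
    exact AlgHom.ext fun x => DFunLike.congr_fun h1 x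

/-- The ring upstairs is generated by matrix entries. For `z` they are constants, and the square of
an entry of the matrix of `g_v` is a function pulled back from downstairs; integrality and finite
type give finiteness. -/
theorem IsCoverHom.finite [Fintype V] (hψ : IsCoverHom ψ) (hm : ∀ e, 0 < m e ∧ Even (m e))
    (he' : injLocus k (SL2Alg k) (extRels m) (extElementary m) = PrimeSpectrum.basicOpen e')
    (hi' : IsIdempotentElem e') : ψ.toRingHom.Finite := by
  let B := Localization.Away e
  let C := Localization.Away e'
  let _ : Algebra B C := ψ.toRingHom.toAlgebra
  have : IsScalarTower k B C := IsScalarTower.of_algebraMap_eq fun c => (ψ.commutes c).symm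
  change Module.Finite B C
  have : Algebra.FiniteType k C := finiteType_away hi'
  have : Algebra.FiniteType B C := Algebra.FiniteType.of_restrictScalars_finiteType k B C
  have : Algebra.IsIntegral B C := by
    refine ⟨fun x => ?_⟩
    have hk : ∀ c, algebraMap k C c ∈ (integralClosure B C).toSubring := fun c => by
      rw [IsScalarTower.algebraMap_apply k B C]
      exact (integralClosure B C).algebraMap_mem _
    refine away_mem hi' (integralClosure B C).toSubring hk (fun o y => ?_) x
    refine SL2Alg.map_mem _ _ hk (fun i j => ?_) y
    rcases o with _ | v
    · have hz := (isInjRep_univAway he').map_z hm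
      rw [show univAway e' (PresentedGroup.of none) = negOne k _ from hz, mat_negOne]
      have h1 : ((-1 : Matrix (Fin 2) (Fin 2) C) i j) = -(if i = j then 1 else 0) := by
        rw [Matrix.neg_apply, Matrix.one_apply]
      rw [h1]
      refine Subring.neg_mem _ ?_
      split_ifs
      exacts [Subring.one_mem _, Subring.zero_mem _]
    · have h1 : mat (univAway e' (ExtGroup.g m v)) i j ^ 2 = algebraMap B C
          ((univAway e (CoxGroup.g m v)).ofConv (quad k (i, j) (i, j))) := by
        have h2 := pr_quad (univAway e' (ExtGroup.g m v)) (i, j) (i, j)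
        rw [← hψ.apply_g] at h2
        rw [sq]
        exact h2.symm
      exact IsIntegral.of_pow two_pos (h1 ▸ isIntegral_algebraMap)
  exact Algebra.IsIntegral.finite

theorem IsCoverHom.etale [Fintype V] (hψ : IsCoverHom ψ) (hm : ∀ e, 0 < m e ∧ Even (m e))
    (he : injLocus k (PSL2Alg k) (coxRels m) (coxElementary m) = PrimeSpectrum.basicOpen e)
    (he' : injLocus k (SL2Alg k) (extRels m) (extElementary m) = PrimeSpectrum.basicOpen e')
    (hi : IsIdempotentElem e) (hi' : IsIdempotentElem e') : ψ.toRingHom.Etale := by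
  let B := Localization.Away e
  let C := Localization.Away e'
  have h1 := hψ.formallyEtale hm he he'
  have h2 := hψ.finite hm he' hi'
  let _ : Algebra B C := ψ.toRingHom.toAlgebra
  have : Algebra.FormallyEtale B C := h1
  have : Module.Finite B C := h2
  have : Algebra.FiniteType k B := finiteType_away hi
  have : IsNoetherianRing B := Algebra.FiniteType.isNoetherianRing k B
  have : Algebra.FinitePresentation B C := Algebra.FinitePresentation.of_finiteType.1 inferInstance
  change Algebra.Etale B C
  exact ⟨inferInstance, inferInstance⟩

/-- Lifting a matrix requires a square root, hence the passage to an algebraic closure of the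
residue field. -/
theorem IsCoverHom.comap_surjective [Fintype V] (hψ : IsCoverHom ψ) (hm : ∀ e, 0 < m e ∧ Even (m e))
    (he : injLocus k (PSL2Alg k) (coxRels m) (coxElementary m) = PrimeSpectrum.basicOpen e)
    (he' : injLocus k (SL2Alg k) (extRels m) (extElementary m) = PrimeSpectrum.basicOpen e') :
    Function.Surjective (PrimeSpectrum.comap ψ.toRingHom) := by
  intro p
  let κ := p.asIdeal.ResidueField
  let f : Localization.Away e →ₐ[k] AlgebraicClosure κ :=
    (IsScalarTower.toAlgHom k κ (AlgebraicClosure κ)).comp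
      (IsScalarTower.toAlgHom k (Localization.Away e) κ)
  choose s hs using fun v => exists_pr_eq (mapPt f (univAway e (CoxGroup.g m v)))
  obtain ⟨F, hF, -⟩ := hψ.exists_lift hm he he' f s hs
  refine ⟨⟨RingHom.ker F, RingHom.ker_isPrime F⟩, PrimeSpectrum.ext (Ideal.ext fun x => ?_)⟩
  change F.comp ψ x = 0 ↔ _
  rw [hF]
  change algebraMap κ (AlgebraicClosure κ) (algebraMap _ κ x) = 0 ↔ _
  rw [map_eq_zero_iff _ (algebraMap κ (AlgebraicClosure κ)).injective,
    Ideal.algebraMap_residueField_eq_zero]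

/-- The deck transformations. -/
theorem IsCoverHom.exists_deck [Fintype V] (hψ : IsCoverHom ψ) (hm : ∀ e, 0 < m e ∧ Even (m e))
    (he : injLocus k (PSL2Alg k) (coxRels m) (coxElementary m) = PrimeSpectrum.basicOpen e)
    (he' : injLocus k (SL2Alg k) (extRels m) (extElementary m) = PrimeSpectrum.basicOpen e') :
    ∃ θ : (V → ZMod 2) → (Localization.Away e' →ₐ[k] Localization.Away e'),
      θ 0 = AlgHom.id k _ ∧ (∀ d d', θ (d + d') = (θ d).comp (θ d')) ∧
      (∀ d, (θ d).comp ψ = ψ) ∧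
      (∀ (F : Type u) [Field F] (f : Localization.Away e' →+* F) (d : V → ZMod 2),
        f.comp (θ d).toRingHom = f → d = 0) ∧
      ∀ (F : Type u) [Field F] (f f' : Localization.Away e' →+* F),
        f.comp ψ.toRingHom = f'.comp ψ.toRingHom → ∃ d, f.comp (θ d).toRingHom = f' := by
  -- `θ d` multiplies the matrix of `g_v` by the sign `(-1) ^ (d v)`, which is invisible in
  -- `PSL(2)`.
  choose θ hθψ hθ using fun d : V → ZMod 2 => hψ.exists_lift hm he he' ψ
    (fun v => signPt k _ (d v) * univAway e' (ExtGroup.g m v))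
    (fun v => by rw [map_mul, pr_signPt, one_mul, hψ.apply_g])
  refine ⟨θ, ?_, ?_, hθψ, ?_, ?_⟩
  · refine away_ext_ext hm he' fun v => ?_
    rw [hθ, Pi.zero_apply, signPt_zero, one_mul]; rfl
  · intro d d'
    refine away_ext_ext hm he' fun v => ?_
    rw [hθ, ← mapPt_mapPt, hθ, map_mul, hθ, mapPt_signPt, Pi.add_apply, add_comm, signPt_add,
      mul_assoc]
  · intro F _ f d h
    let _ : Algebra k F := (f.comp (algebraMap k _)).toAlgebra
    let g : Localization.Away e' →ₐ[k] F := { f with commutes' := fun c => rfl }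
    have hg : g.comp (θ d) = g := AlgHom.ext fun x => DFunLike.congr_fun h x
    ext1 v
    refine signPt_eq_one (k := k) (S := F) ?_
    have h1 := mapPt_mapPt (θ d) g (univAway e' (ExtGroup.g m v))
    rw [hg, hθ, map_mul, mapPt_signPt] at h1
    exact mul_eq_right.1 h1
  · intro F _ f f' h
    let _ : Algebra k F := (f.comp (algebraMap k _)).toAlgebra
    let g : Localization.Away e' →ₐ[k] F := { f with commutes' := fun c => rfl }
    -- The `k`-structure of `F` comes from `f`. Since `f` and `f'` agree on the image of `ψ`, which
    -- contains the constants, `f'` respects it as well.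
    let g' : Localization.Away e' →ₐ[k] F := { f' with
      commutes' := fun c => by
        have h1 := DFunLike.congr_fun h (algebraMap k _ c)
        have h2 : ψ.toRingHom (algebraMap k _ c) = algebraMap k _ c := ψ.commutes c
        simp only [RingHom.comp_apply, h2] at h1
        exact h1.symm }
    have hgg : g.comp ψ = g'.comp ψ := AlgHom.ext fun x => DFunLike.congr_fun h x
    have h1 : ∀ v, ∃ x : ZMod 2, mapPt g' (univAway e' (ExtGroup.g m v)) =
        signPt k F x * mapPt g (univAway e' (ExtGroup.g m v)) := by
      intro v
      rcases eq_or_eq_of_pr_eq (g := mapPt g' (univAway e' (ExtGroup.g m v)))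
        (h := mapPt g (univAway e' (ExtGroup.g m v)))
        (by rw [hψ.apply_g', hψ.apply_g', hgg]) with h2 | h2
      · exact ⟨0, by rw [signPt_zero, one_mul, h2]⟩
      · exact ⟨1, by rw [h2]; rfl⟩
    choose d hd using h1
    have h2 : g.comp (θ d) = g' := by
      refine away_ext_ext hm he' fun v => ?_
      rw [← mapPt_mapPt, hθ, map_mul, mapPt_signPt, hd]
    exact ⟨d, RingHom.ext fun x => DFunLike.congr_fun h2 x⟩

end CoverAlgebra

/-! ### A pointwise criterion for regular étale coverings -/

section RegularCovering

open Limits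

theorem exists_spec_field_range_eq {Z : Scheme.{u}} (p : Z) :
    ∃ (K : Type u) (_ : Field K) (z : Spec (CommRingCat.of K) ⟶ Z), Set.range z = {p} :=
  ⟨IsLocalRing.ResidueField (Z.presheaf.stalk p), inferInstance, Z.fromSpecResidueField p,
    Z.range_fromSpecResidueField p⟩

/-- A finite étale surjective morphism is a regular covering if the deck transformations act
simply transitively on the field-valued points of the fibres. -/
theorem isRegularEtaleCovering_of {D : Type} [CommGroup D] [Finite D] {X Y : Scheme.{u}} (q : Y ⟶ X)
    [IsFinite q] [Etale q] [Surjective q] (τ : D → (Y ⟶ Y)) (hone : τ 1 = 𝟙 Y)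
    (hmul : ∀ d d', τ (d * d') = τ d ≫ τ d') (hq : ∀ d, τ d ≫ q = q)
    (free : ∀ (K : Type u) [Field K] (y : Spec (CommRingCat.of K) ⟶ Y) d, y ≫ τ d = y → d = 1)
    (trans : ∀ (K : Type u) [Field K] (y y' : Spec (CommRingCat.of K) ⟶ Y),
      y ≫ q = y' ≫ q → ∃ d, y ≫ τ d = y') :
    IsRegularEtaleCovering D q := by
  have hinv : ∀ d, τ d ≫ τ d⁻¹ = 𝟙 Y := fun d => by rw [← hmul, mul_inv_cancel, hone]
  have hinv' : ∀ d, τ d⁻¹ ≫ τ d = 𝟙 Y := fun d => by rw [← hmul, inv_mul_cancel, hone]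
  have hiso : ∀ d, IsIso (τ d) := fun d => ⟨τ d⁻¹, hinv d, hinv' d⟩
  let σ : D →* Aut (Over.mk q) :=
    { toFun := fun d => Over.isoMk ⟨τ d, τ d⁻¹, hinv d, hinv' d⟩ (hq d)
      map_one' := by
        ext : 2
        exact hone
      map_mul' := fun d d' => by
        ext : 2
        -- Multiplication in `Aut` composes in the order opposite to `≫`; commutativity of `D`
        -- reconciles the two.
        exact (congrArg τ (mul_comm d d')).trans (hmul d' d) }
  refine ⟨inferInstance, inferInstance, inferInstance, σ, ?_⟩
  let f : ∀ _ : D, Y ⟶ pullback q q := fun d =>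
    pullback.lift (𝟙 Y) (τ d) ((Category.id_comp q).trans (hq d).symm)
  have hf1 : ∀ d, f d ≫ pullback.fst q q = 𝟙 Y := fun d => pullback.lift_fst _ _ _
  have hf2 : ∀ d, f d ≫ pullback.snd q q = τ d := fun d => pullback.lift_snd _ _ _
  -- The graph of `τ d` is the diagonal, an open immersion because `q` is étale, followed by the
  -- automorphism `id × τ d` of the fibre product.
  have hopen : ∀ d, IsOpenImmersion (f d) := fun d => by
    have hd : f d = pullback.diagonal q ≫ pullback.map q q q q (𝟙 Y) (τ d) (𝟙 X)
        (by simp) (by simp [hq]) := by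
      apply pullback.hom_ext
      · rw [hf1, pullback.map, Category.assoc, pullback.lift_fst, ← Category.assoc,
          pullback.diagonal_fst, Category.id_comp]
      · rw [hf2, pullback.map, Category.assoc, pullback.lift_snd, ← Category.assoc,
          pullback.diagonal_snd, Category.id_comp]
    rw [hd]
    infer_instance
  -- Open immersions form a coproduct when their images cover and are disjoint. Both are checked at
  -- field-valued points: covering is transitivity, disjointness is freeness.
  refine (Cofan.nonempty_isColimit_iff_isIso_sigmaDesc (Cofan.mk (pullback q q) f)).1
    (nonempty_isColimit_cofanMk_of f ?_ ?_)
  · refine top_le_iff.1 fun p _ => ?_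
    obtain ⟨K, _, z, hz⟩ := exists_spec_field_range_eq p
    obtain ⟨d, hd⟩ := trans _ (z ≫ pullback.fst q q) (z ≫ pullback.snd q q)
      (by rw [Category.assoc, Category.assoc, pullback.condition])
    have h1 : z = (z ≫ pullback.fst q q) ≫ f d := by
      apply pullback.hom_ext
      · rw [Category.assoc, hf1, Category.comp_id]
      · rw [Category.assoc, hf2, hd]
    have h2 : p ∈ Set.range z := by rw [hz]; rfl
    obtain ⟨t, ht⟩ := h2
    refine TopologicalSpace.Opens.mem_iSup.2 ⟨d, ?_⟩
    refine ⟨(z ≫ pullback.fst q q) t, ?_⟩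
    rw [← Scheme.Hom.comp_apply, ← h1, ht]
  · intro d d' hdd
    refine TopologicalSpace.Opens.coe_disjoint.1 (Set.disjoint_left.2 fun p hp hp' => hdd ?_)
    obtain ⟨K, _, z, hz⟩ := exists_spec_field_range_eq p
    have hr : ∀ d'', p ∈ (f d'').opensRange → Set.range z ⊆ Set.range (f d'') := by
      intro d'' h
      rw [hz]
      exact Set.singleton_subset_iff.2 h
    have h1 := IsOpenImmersion.lift_fac (f d) z (hr d hp)
    have h2 := IsOpenImmersion.lift_fac (f d') z (hr d' hp')
    set y := IsOpenImmersion.lift (f d) z (hr d hp)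
    set y' := IsOpenImmersion.lift (f d') z (hr d' hp')
    have h3 : y = y' := by
      have := congrArg (· ≫ pullback.fst q q) (h1.trans h2.symm)
      simpa only [Category.assoc, hf1, Category.comp_id] using this
    have h4 : y ≫ τ d = y ≫ τ d' := by
      have := congrArg (· ≫ pullback.snd q q) (h1.trans h2.symm)
      simpa only [Category.assoc, hf2, ← h3] using this
    have h5 := free _ (y ≫ τ d) (d⁻¹ * d') (by
      rw [Category.assoc, ← hmul, mul_inv_cancel_left, ← h4])
    exact inv_mul_eq_one.1 h5

end RegularCovering

/-! ### The injectivity locus as an affine scheme -/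

section CoverScheme

variable {k A : Type u} [Field k] [CommRing A] [HopfAlgebra k A] {α : Type} [DecidableEq α]
  {rels : Set (FreeGroup α)} {e : RepAlg k A rels}

instance isOpenImmersion_awayHom :
    IsOpenImmersion (Spec.map (CommRingCat.ofHom (awayHom e).toRingHom)) :=
  inferInstanceAs (IsOpenImmersion
    (Spec.map (CommRingCat.ofHom (algebraMap (RepAlg k A rels) (Localization.Away e)))))

/-- An open subscheme of the representation scheme that is a basic open set is affine. -/
def opensIsoAway (U : (Hom k A rels).Opens)
    (h : U.1 = (PrimeSpectrum.basicOpen e : Set (PrimeSpectrum (RepAlg k A rels)))) :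
    U.toScheme ≅ Spec (CommRingCat.of (Localization.Away e)) :=
  IsOpenImmersion.isoOfRangeEq U.ι (Spec.map (CommRingCat.ofHom (awayHom e).toRingHom))
    ((Scheme.Opens.range_ι U).trans
      (h.trans (PrimeSpectrum.localization_away_comap_range (Localization.Away e) e).symm))

theorem opensIsoAway_hom_comp (U : (Hom k A rels).Opens)
    (h : U.1 = (PrimeSpectrum.basicOpen e : Set (PrimeSpectrum (RepAlg k A rels)))) :
    (opensIsoAway U h).hom ≫ Spec.map (CommRingCat.ofHom (awayHom e).toRingHom) = U.ι :=
  IsOpenImmersion.isoOfRangeEq_hom_fac _ _ _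

theorem opensIsoAway_inv_comp (U : (Hom k A rels).Opens)
    (h : U.1 = (PrimeSpectrum.basicOpen e : Set (PrimeSpectrum (RepAlg k A rels)))) :
    (opensIsoAway U h).inv ≫ U.ι = Spec.map (CommRingCat.ofHom (awayHom e).toRingHom) :=
  IsOpenImmersion.isoOfRangeEq_inv_fac _ _ _

end CoverScheme

/-! ### Assembling the covering of schemes -/

section CoverTheorem

variable (k : Type u) [Field k] [CharZero k] {V : Type} [Fintype V] [DecidableEq V]
  {Δ : SimpleGraph V} (m : Δ.edgeSet → ℕ)

/-- Composition with `SL(2) → PSL(2)` is a regular étale covering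
`hom_o(Γ̃, SL(2)) → hom_o(Γ, PSL(2))`. -/
theorem exists_covering (hm : ∀ e, 0 < m e ∧ Even (m e)) :
    ∃ q : (extHomO m k (SL2Alg k)).toScheme ⟶ (coxHomO m k (PSL2Alg k)).toScheme,
      q ≫ (coxHomO m k (PSL2Alg k)).ι ≫ toBase _ _ _ =
        (extHomO m k (SL2Alg k)).ι ≫ toBase _ _ _ ∧
      (∀ γ : ExtGroup m,
        (extHomO m k (SL2Alg k)).ι ≫ eval _ _ _ γ ≫ coverMap k =
          q ≫ (coxHomO m k (PSL2Alg k)).ι ≫ eval _ _ _ (proj m γ)) ∧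
      IsRegularEtaleCovering (Multiplicative (V → ZMod 2)) q := by
  obtain ⟨e, hi, he⟩ := PrimeSpectrum.exists_idempotent_basicOpen_eq_of_isClopen
    (isClopen_injLocus k (PSL2Alg k) (coxRels m) _ (coxElementary_finite m) fun _ h => h.1)
  obtain ⟨e', hi', he'⟩ := PrimeSpectrum.exists_idempotent_basicOpen_eq_of_isClopen
    (isClopen_injLocus k (SL2Alg k) (extRels m) _ (extElementary_finite m) fun _ h => h.1)
  obtain ⟨ψ, hψ⟩ := exists_coverHom hm he he'
  obtain ⟨θ, hθ0, hθadd, hθψ, hfree, htrans⟩ := hψ.exists_deck hm he he'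
  let a := opensIsoAway (extHomO m k (SL2Alg k)) he'
  let b := opensIsoAway (coxHomO m k (PSL2Alg k)) he
  have ha : a.hom ≫ Spec.map (CommRingCat.ofHom (awayHom e').toRingHom) =
    (extHomO m k (SL2Alg k)).ι := opensIsoAway_hom_comp _ he'
  have hb : b.inv ≫ (coxHomO m k (PSL2Alg k)).ι =
    Spec.map (CommRingCat.ofHom (awayHom e).toRingHom) := opensIsoAway_inv_comp _ he
  let s : Spec (CommRingCat.of (Localization.Away e')) ⟶ Spec (CommRingCat.of (Localization.Away e)) :=
    Spec.map (CommRingCat.ofHom ψ.toRingHom)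
  have : IsFinite s := (IsFinite.SpecMap_iff _).2 (hψ.finite hm he' hi')
  have : Etale s := (HasRingHomProperty.Spec_iff (P := @Etale)).2 (hψ.etale hm he he' hi hi')
  have : Surjective s := ⟨hψ.comap_surjective hm he he'⟩
  -- The morphism dual to `ψ`, carried over to the open subschemes by their identifications with
  -- spectra of localizations.
  let q := a.hom ≫ s ≫ b.inv
  have hqb : q ≫ b.hom = a.hom ≫ s := by simp [q]
  let t : (V → ZMod 2) → (Spec (CommRingCat.of (Localization.Away e')) ⟶
      Spec (CommRingCat.of (Localization.Away e'))) := fun d =>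
    Spec.map (CommRingCat.ofHom (θ d).toRingHom)
  let τ : Multiplicative (V → ZMod 2) → ((extHomO m k (SL2Alg k)).toScheme ⟶
      (extHomO m k (SL2Alg k)).toScheme) := fun d => a.hom ≫ t d.toAdd ≫ a.inv
  have hτ : ∀ d, τ d ≫ a.hom = a.hom ≫ t d.toAdd := fun d => by simp [τ]
  have ht0 : t 0 = 𝟙 _ := by
    simp only [t, hθ0]
    exact Spec.map_id _
  have htadd : ∀ d d', t (d + d') = t d ≫ t d' := fun d d' => by
    simp only [t, hθadd, ← Spec.map_comp]
    rfl
  have hts : ∀ d, t d ≫ s = s := fun d => by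
    simp only [t, s, ← Spec.map_comp, ← CommRingCat.ofHom_comp]
    exact congrArg (fun f => Spec.map (CommRingCat.ofHom (AlgHom.toRingHom f))) (hθψ d)
  have hpt : ∀ (K : Type u) [Field K] (y : Spec (CommRingCat.of K) ⟶ (extHomO m k (SL2Alg k)).toScheme),
      ∃ f : Localization.Away e' →+* K, y ≫ a.hom = Spec.map (CommRingCat.ofHom f) :=
    fun K _ y => ⟨(Spec.preimage (y ≫ a.hom)).hom, (Spec.map_preimage _).symm⟩
  have hinj : ∀ (R S : Type u) [CommRing R] [CommRing S] (f g : R →+* S),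
      Spec.map (CommRingCat.ofHom f) = Spec.map (CommRingCat.ofHom g) → f = g :=
    fun R S _ _ f g h => congrArg CommRingCat.Hom.hom (Spec.map_injective h)
  have hbase : q ≫ (coxHomO m k (PSL2Alg k)).ι =
      a.hom ≫ Spec.map (CommRingCat.ofHom (ψ.comp (awayHom e)).toRingHom) := by
    simp only [q, Category.assoc, hb, s, ← Spec.map_comp]
    rfl
  refine ⟨q, ?_, fun γ => ?_, ?_⟩
  · rw [reassoc_of% hbase, ← ha, Category.assoc]
    simp only [toBase, ← Spec.map_comp, ← CommRingCat.ofHom_comp]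
    congr 3
    ext c
    exact ((ψ.comp (awayHom e)).commutes c).trans ((awayHom e').commutes c).symm
  · rw [reassoc_of% hbase, ← ha, Category.assoc]
    simp only [eval, coverMap, ← Spec.map_comp, ← CommRingCat.ofHom_comp]
    congr 3
    ext x
    exact (DFunLike.congr_fun (congrArg ofConv (DFunLike.congr_fun hψ γ)) x).symm
  · have : IsFinite q := inferInstance
    have : Etale q := inferInstance
    have : Surjective q := inferInstance
    refine isRegularEtaleCovering_of q τ ?_ ?_ ?_ ?_ ?_
    · rw [← cancel_mono a.hom, hτ, toAdd_one, ht0, Category.comp_id, Category.id_comp]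
    · intro d d'
      rw [← cancel_mono a.hom, hτ, Category.assoc, hτ, reassoc_of% (hτ d), toAdd_mul, htadd]
    · intro d
      rw [← cancel_mono b.hom, Category.assoc, hqb, reassoc_of% (hτ d), hts]
    · intro K _ y d h
      obtain ⟨f, hf⟩ := hpt K y
      have h1 : Spec.map (CommRingCat.ofHom (f.comp (θ d.toAdd).toRingHom)) =
          Spec.map (CommRingCat.ofHom f) := by
        rw [CommRingCat.ofHom_comp, Spec.map_comp, ← hf]
        conv_rhs => rw [← h, Category.assoc, hτ]
        rw [Category.assoc]
      exact hfree K f _ (hinj _ _ _ _ h1)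
    · intro K _ y y' h
      obtain ⟨f, hf⟩ := hpt K y
      obtain ⟨f', hf'⟩ := hpt K y'
      have h1 : Spec.map (CommRingCat.ofHom (f.comp ψ.toRingHom)) =
          Spec.map (CommRingCat.ofHom (f'.comp ψ.toRingHom)) := by
        rw [CommRingCat.ofHom_comp, CommRingCat.ofHom_comp, Spec.map_comp, Spec.map_comp, ← hf,
          ← hf', Category.assoc, Category.assoc]
        change y ≫ a.hom ≫ s = y' ≫ a.hom ≫ s
        rw [← hqb, reassoc_of% h]
      obtain ⟨d, hd⟩ := htrans K f f' (hinj _ _ _ _ h1)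
      refine ⟨Multiplicative.ofAdd d, ?_⟩
      rw [← cancel_mono a.hom, Category.assoc, hτ, hf', ← hd, CommRingCat.ofHom_comp,
        Spec.map_comp, ← hf, Category.assoc]

end CoverTheorem

end RepScheme

end

theorem lemma2p8 {V : Type} [Fintype V] [DecidableEq V] (Δ : SimpleGraph V) (m : Δ.edgeSet → ℕ)
    (hm : ∀ e, 0 < m e ∧ Even (m e)) :
    (∀ (k A : Type u) [Field k] [CharZero k] [CommRing A] [HopfAlgebra k A]
        [Algebra.FiniteType k A],
      RepScheme.IsClopenSubscheme
        (RepScheme.coxHomO m k A : Set (RepScheme.Hom k A (RepScheme.coxRels m))) ∧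
      RepScheme.IsClopenSubscheme
        (RepScheme.extHomO m k A : Set (RepScheme.Hom k A (RepScheme.extRels m))) ∧
      (RepScheme.IsReductive k A →
        RepScheme.IsClopenSubscheme (RepScheme.coxCharO m k A) ∧
        RepScheme.IsClopenSubscheme (RepScheme.extCharO m k A))) ∧
    ∃ q : (RepScheme.extHomO m ℂ (RepScheme.SL2Alg ℂ)).toScheme ⟶
        (RepScheme.coxHomO m ℂ (RepScheme.PSL2Alg ℂ)).toScheme,
      q ≫ (RepScheme.coxHomO m ℂ (RepScheme.PSL2Alg ℂ)).ι ≫ RepScheme.toBase _ _ _ =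
        (RepScheme.extHomO m ℂ (RepScheme.SL2Alg ℂ)).ι ≫ RepScheme.toBase _ _ _ ∧
      (∀ γ : RepScheme.ExtGroup m,
        (RepScheme.extHomO m ℂ (RepScheme.SL2Alg ℂ)).ι ≫
            RepScheme.eval _ _ _ γ ≫ RepScheme.coverMap ℂ =
          q ≫ (RepScheme.coxHomO m ℂ (RepScheme.PSL2Alg ℂ)).ι ≫
            RepScheme.eval _ _ _ (RepScheme.proj m γ)) ∧
      RepScheme.IsRegularEtaleCovering (Multiplicative (V → ZMod 2)) q :=
  ⟨fun k A => RepScheme.clopen_part m k A, RepScheme.exists_covering ℂ m hm⟩
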